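/- **Model.** Let $m\in C^2([0,1]^2)$, $\tau\in C^2[0,1]$ with $\tau>0$, $\phi\in C^2[0,1]$ with values in $(0,1)$, and $m_\phi(x,y)=m(x,y)+\tau(x)\mathbf 1_{[0,\phi(x)]}(y)$. For each $n$ one observes $$Y_{i_1,i_2}=m_\phi(x_{i_1},x_{i_2})+\varepsilon_{i_1,i_2},\qquad 1\le i_1,i_2\le n,$$ on a deterministic regular grid, $x_i=x_{i,n}\in[(i-1)/n,\,i/n]$. The errors are i.i.d. and centred with variance $\sigma^2$, $\mathbb E|\varepsilon_{1,1}|^5<\infty$, and a law not depending on $n$. For all large $n$ the bandwidth $h=h_n$ satisfies $C_1(\ln n)^{\eta}n^{-1/2}\le h_n\le C_2n^{-1/3}$, where $C_1,C_2>0$ and $\eta>1$ are constants. **Kernel.** $K_1,K_2:\mathbb R\to\mathbb R$ vanish outside $[-1,1]$, are three times continuously differentiable on $[-1,1]$, and satisfy $K_1^{(j)}(\pm1)=K_2^{(j)}(\pm1)=0$ for $j=0,1,2$. $K_1$ is even, positive on $(-1,1)$, and $\int_{-1}^1K_1=1$. $K_2$ is odd, $\int_0^1K_2=1$, $K_2'(0)>0$,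 and its primitive $\bar K_2(y)=\int_{-1}^yK_2(t)\,dt$ (for which $\bar K_2(0)=-1$) satisfies $|\bar K_2(y)|<1$ for all $y\in[-1,1]\setminus\{0\}$; the last condition holds for instance if $K_2\ge0$ on $[0,1]$. Let $K(z_1,z_2)=K_1(z_1)K_2(z_2)$, $K(\mathbf z;\psi,h)=h^{-2}K(h^{-1}R_{-\psi}\mathbf z)$ with $R_\psi=\begin{pmatrix}\cos\psi&-\sin\psi\\ \sin\psi&\cos\psi\end{pmatrix}$, and $$\hat M_n(\mathbf z;\psi,h)=n^{-2}\sum_{i_1,i_2=1}^nY_{i_1,i_2}\,K\big(\mathbf z-(x_{i_1},x_{i_2})^\top;\psi,h\big).$$ **Estimators.** Fix $x\in(0,1)$ and let $\psi(x)=\arctan\phi'(x)$. For all large $n$ let $$(\hat\phi,\hat\psi)\in\operatorname*{arg\,max}_{y\in[\sqrt2h,\,1-\sqrt2h],\ \psi\in[-\pi/2,\pi/2]}\hat M_n((x,y)^\top;\psi,h)$$ almost surely, with $\hat\phi$ and $\hat\psi$ random variables, and let $(\phi_n,\psi_n)$ be a maximizer of $\mathbb E\,\hat M_n((x,y)^\top;\psi,h)$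 over the same set. Put $$\hat w=\frac{\hat\phi-\phi(x)}h,\quad w_n=\frac{\phi_n-\phi(x)}h,\quad \hat\tau=\hat M_n((x,\hat\phi)^\top;\hat\psi,h),\quad \tau_n=\mathbb E\,\hat M_n((x,y)^\top;\psi,h)\Big|_{(y,\psi)=(\phi_n,\psi_n)} .$$ **Theorem.** As $n\to\infty$, $$nh\begin{pmatrix}\hat w-w_n\\ \hat\psi-\psi_n\\ \hat\tau-\tau_n\end{pmatrix}\rightsquigarrow\mathcal N_3\big[\mathbf 0,\ \sigma^2\,\Sigma(x)\big],\qquad \Sigma(x)=\operatorname{diag}\Big[\frac{V_\phi^S(x)}{V_\phi^H(x)^2},\ \frac{V_\psi^S}{V_\psi^H(x)^2},\ V_\tau^S\Big],$$ where $$V_\phi^H(x)=\tau(x)\cos^2(\psi(x))\,K_2'(0),\qquad V_\psi^H(x)=\tau(x)K_2'(0)\int_{-1}^1y^2K_1(y)\,dy,$$ $$V_\phi^S(x)=\sin^2(\psi(x))\int_{[-1,1]^2}\{K_1'(z_1)K_2(z_2)\}^2\,dz+\cos^2(\psi(x))\int_{[-1,1]^2}\{K_1(z_1)K_2'(z_2)\}^2\,dz,$$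 $$V_\psi^S=\int_{-1}^1\int_{-1}^1\{K_1(z_1)K_2'(z_2)z_1-K_1'(z_1)K_2(z_2)z_2\}^2\,dz_1\,dz_2,\qquad V_\tau^S=\int_{[-1,1]^2}K(\mathbf z)^2\,d\mathbf z .$$ In particular the three coordinates are independent under the limit law, that is, the three estimators are asymptotically independent. -/

import Mathlib

open Real Set Filter Topology MeasureTheory ProbabilityTheory
open scoped Matrix

/-- The rotation matrix by the angle `ψ`. -/
noncomputable def rotMatrix (ψ : ℝ) : Matrix (Fin 2) (Fin 2) ℝ :=
  !![Real.cos ψ, Real.sin (-ψ); Real.sin ψ, Real.cos ψ]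

/-- The rotated difference kernel `K(z; ψ, h) = K(h⁻¹ R_{-ψ} z) / h²` with the product kernel
`K(z₁, z₂) = K₁(z₁) K₂(z₂)`. -/
noncomputable def rotKernel (K₁ K₂ : ℝ → ℝ) (z : Fin 2 → ℝ) (ψ h : ℝ) : ℝ :=
  K₁ ((h⁻¹ • (rotMatrix (-ψ) *ᵥ z)) 0) * K₂ ((h⁻¹ • (rotMatrix (-ψ) *ᵥ z)) 1) / h ^ 2

/-- The image function `m_φ(x, y) = m(x, y) + τ(x) 1_{[0, φ(x)]}(y)`. -/
noncomputable def jumpImage (m : ℝ × ℝ → ℝ) (τ φ : ℝ → ℝ) (x y : ℝ) : ℝ :=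
  m (x, y) + τ x * (Set.Icc 0 (φ x)).indicator (fun _ => (1 : ℝ)) y

/-- The observations `Y_{i₁,i₂} = m_φ(x_{i₁}, x_{i₂}) + ε_{i₁,i₂}` on the grid with coordinates
`ξ`. -/
noncomputable def observation {Ω : Type*} (m : ℝ × ℝ → ℝ) (τ φ : ℝ → ℝ) {n : ℕ} (ξ : Fin n → ℝ)
    (ε : Fin n × Fin n → Ω → ℝ) (i : Fin n × Fin n) (ω : Ω) : ℝ :=
  jumpImage m τ φ (ξ i.1) (ξ i.2) + ε i ω

/-- The contrast process (Priestley--Chao weights) for the data `Y` on the grid with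
coordinates `ξ`. -/
noncomputable def empContrast (K₁ K₂ : ℝ → ℝ) {n : ℕ} (ξ : Fin n → ℝ) (Y : Fin n × Fin n → ℝ)
    (z : Fin 2 → ℝ) (ψ h : ℝ) : ℝ :=
  ((n : ℝ) ^ 2)⁻¹ * ∑ i : Fin n × Fin n, Y i * rotKernel K₁ K₂ (z - ![ξ i.1, ξ i.2]) ψ h

/-- The deterministic contrast: the expectation of the contrast process. -/
noncomputable def detContrast {Ω : Type*} [MeasurableSpace Ω] (P : Measure Ω) (K₁ K₂ : ℝ → ℝ)
    {n : ℕ} (ξ : Fin n → ℝ) (Y : Fin n × Fin n → Ω → ℝ) (z : Fin 2 → ℝ) (ψ h : ℝ) : ℝ :=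
  ∫ ω, empContrast K₁ K₂ ξ (fun i => Y i ω) z ψ h ∂P

/-- The range of `(y, ψ)` over which contrasts are maximized. For `y` at distance at least `√2 h`
from `0` and `1`, all rotated kernel windows (squares with half-diagonal `√2 h`) stay inside the
image in the vertical direction. -/
noncomputable def searchRange (h : ℝ) : Set (ℝ × ℝ) :=
  Set.Icc (√2 * h) (1 - √2 * h) ×ˢ Set.Icc (-(π / 2)) (π / 2)

/-- `p` is a maximizer of `F` over `S`. -/
def IsArgmaxOn (F : ℝ × ℝ → ℝ) (S : Set (ℝ × ℝ)) (p : ℝ × ℝ) : Prop :=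
  p ∈ S ∧ IsMaxOn F S p

/-- A regular rectangular grid of design points in `[0,1]²`: for sample size `n`, the points are
`(x_{i₁}, x_{i₂})`, where `x_i` lies in the `i`-th of the `n` cells of `[0,1]` of equal length
(`i = 0, …, n - 1`); this includes `i / n`, `(i + 1 / 2) / n`, `(i + 1) / n`, `i / (n - 1)`. -/
def RegularDesign (ξ : (n : ℕ) → Fin n → ℝ) : Prop :=
  ∀ (n : ℕ) (i : Fin n), ξ n i ∈ Set.Icc ((i : ℝ) / n) (((i : ℝ) + 1) / n)

/-- The errors are centred, independent and identically distributed (with a law `ν` not depending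
on `n`), with variance `σ²` and finite fifth absolute moment. -/
structure ErrorAssumption {Ω : Type*} [MeasurableSpace Ω] (P : Measure Ω) (ν : Measure ℝ) (σ : ℝ)
    (ε : (n : ℕ) → Fin n × Fin n → Ω → ℝ) : Prop where
  indep : ∀ n, iIndepFun (ε n) P
  law : ∀ n i, HasLaw (ε n i) ν P
  mean : ∫ e, e ∂ν = 0
  variance : ∫ e, e ^ 2 ∂ν = σ ^ 2
  fifth_moment : Integrable (fun e => |e| ^ 5) ν

/-- `φ, τ ∈ C²[0,1]`, `m ∈ C²[0,1]²`, the jump-location curve `φ` takes values in `(0,1)` and the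
jump-height curve `τ` is positive. -/
structure SmoothnessAssumption (m : ℝ × ℝ → ℝ) (τ φ : ℝ → ℝ) : Prop where
  smooth_m : ContDiffOn ℝ 2 m (Set.Icc 0 1 ×ˢ Set.Icc 0 1)
  smooth_τ : ContDiffOn ℝ 2 τ (Set.Icc 0 1)
  smooth_φ : ContDiffOn ℝ 2 φ (Set.Icc 0 1)
  pos_τ : ∀ x ∈ Set.Icc (0 : ℝ) 1, 0 < τ x
  range_φ : ∀ x ∈ Set.Icc (0 : ℝ) 1, φ x ∈ Set.Ioo (0 : ℝ) 1

/-- For all large `n`, `C₁ (ln n)^η / n^{1/2} ≤ h_n ≤ C₂ / n^{1/3}` with `C₁, C₂ > 0`, `η > 1`. -/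
def BandwidthAssumption (h : ℕ → ℝ) : Prop :=
  ∃ C₁ C₂ η : ℝ, 0 < C₁ ∧ 0 < C₂ ∧ 1 < η ∧ ∀ᶠ n : ℕ in atTop,
    h n ∈ Set.Icc (C₁ * Real.log n ^ η / (n : ℝ) ^ (1 / 2 : ℝ)) (C₂ / (n : ℝ) ^ (1 / 3 : ℝ))

/-- The conditions on the kernel functions. `K₁` and `K₂` are three times continuously
differentiable on `[-1,1]` (one-sided at the end points) and vanish outside. -/
structure KernelAssumption (K₁ K₂ : ℝ → ℝ) : Prop where
  smooth₁ : ContDiffOn ℝ 3 K₁ (Set.Icc (-1) 1)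
  smooth₂ : ContDiffOn ℝ 3 K₂ (Set.Icc (-1) 1)
  supp₁ : ∀ x, x ∉ Set.Icc (-1 : ℝ) 1 → K₁ x = 0
  supp₂ : ∀ x, x ∉ Set.Icc (-1 : ℝ) 1 → K₂ x = 0
  even₁ : ∀ x, K₁ (-x) = K₁ x
  odd₂ : ∀ x, K₂ (-x) = -K₂ x
  pos₁ : ∀ x ∈ Set.Ioo (-1 : ℝ) 1, 0 < K₁ x
  integral₁ : ∫ x in (-1 : ℝ)..1, K₁ x = 1
  integral₂ : ∫ x in (0 : ℝ)..1, K₂ x = 1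
  deriv_pos₂ : 0 < deriv K₂ 0
  boundary₁ : ∀ j ≤ 2, iteratedDerivWithin j K₁ (Set.Icc (-1) 1) (-1) = 0 ∧
    iteratedDerivWithin j K₁ (Set.Icc (-1) 1) 1 = 0
  boundary₂ : ∀ j ≤ 2, iteratedDerivWithin j K₂ (Set.Icc (-1) 1) (-1) = 0 ∧
    iteratedDerivWithin j K₂ (Set.Icc (-1) 1) 1 = 0
  /-- The primitive of `K₂`, which equals `-1` at `0`, is of absolute value less than `1`
  elsewhere; given the other conditions,
  this holds in particular when `K₂ ≥ 0` on `[0,1]`. -/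
  primitive₂ : ∀ y ∈ Set.Icc (-1 : ℝ) 1, y ≠ 0 → |∫ t in (-1 : ℝ)..y, K₂ t| < 1

/-- The angle `ψ(x) = arctan φ'(x)` of the tangent of the jump-location curve. -/
noncomputable def slopeAngle (φ : ℝ → ℝ) (x : ℝ) : ℝ := Real.arctan (deriv φ x)

/-- `V_φ^H(x)`. -/
noncomputable def VHφ (K₂ τ φ : ℝ → ℝ) (x : ℝ) : ℝ :=
  τ x * Real.cos (slopeAngle φ x) ^ 2 * deriv K₂ 0

/-- `V_ψ^H(x)`. -/
noncomputable def VHψ (K₁ K₂ τ : ℝ → ℝ) (x : ℝ) : ℝ :=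
  τ x * deriv K₂ 0 * ∫ y in (-1 : ℝ)..1, y ^ 2 * K₁ y

/-- `V_φ^S(x)`. -/
noncomputable def VSφ (K₁ K₂ φ : ℝ → ℝ) (x : ℝ) : ℝ :=
  Real.sin (slopeAngle φ x) ^ 2 *
      (∫ z in Set.Icc (-1 : ℝ) 1 ×ˢ Set.Icc (-1 : ℝ) 1, (deriv K₁ z.1 * K₂ z.2) ^ 2) +
    Real.cos (slopeAngle φ x) ^ 2 *
      (∫ z in Set.Icc (-1 : ℝ) 1 ×ˢ Set.Icc (-1 : ℝ) 1, (K₁ z.1 * deriv K₂ z.2) ^ 2)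

/-- `V_ψ^S`. -/
noncomputable def VSψ (K₁ K₂ : ℝ → ℝ) : ℝ :=
  ∫ z₂ in (-1 : ℝ)..1, ∫ z₁ in (-1 : ℝ)..1,
    (K₁ z₁ * deriv K₂ z₂ * z₁ - deriv K₁ z₁ * K₂ z₂ * z₂) ^ 2

/-- `V_τ^S`. -/
noncomputable def VSτ (K₁ K₂ : ℝ → ℝ) : ℝ :=
  ∫ z in Set.Icc (-1 : ℝ) 1 ×ˢ Set.Icc (-1 : ℝ) 1, (K₁ z.1 * K₂ z.2) ^ 2

/-- The matrix `Σ(x)`. -/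
noncomputable def asympCov (K₁ K₂ τ φ : ℝ → ℝ) (x : ℝ) : Matrix (Fin 3) (Fin 3) ℝ :=
  Matrix.diagonal ![VSφ K₁ K₂ φ x / VHφ K₂ τ φ x ^ 2, VSψ K₁ K₂ / VHψ K₁ K₂ τ x ^ 2, VSτ K₁ K₂]

/-! The proof treats the estimators as a smooth M-estimator in the rescaled shift `w = (y - φ x) /
h` and the angle `ψ`. The image jumps, but every derivative falls on the kernel, so the contrast and
its derivatives up to order two are sums of data against continuous, compactly supported windows,
normalized by `(n h)⁻²` (`localSum`).

Deterministic part. A localized sum of the image is the integral of a step function and converges by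
dominated convergence (`tendsto_localSum`). In the limit the jump curve becomes a half-plane, and
the contrast becomes `τ x` times the average, under the density `K₁`, of integrals of `K₂` over
half-lines. Such an integral is at most 1, with equality only for `[0, ∞)`, so the limit has its
unique maximum at `w = 0`, `ψ = slopeAngle φ x` (`integral_jumpRegion_win_lt`); far from the curve
the limit is 0. A compactness argument makes this separation uniform (`exists_near_of_contrast_ge`).
At the true point the limiting Hessian is `diag(-VHφ, -VHψ)` (`hessian_WW`, `hessian_WP`,
`hessian_PP`).

Random part. On a block of unit length in `w`, noise sums are uniformly small outside an event of
probability `O((n h)⁻²)` (`exists_block_bound`). The whole search range needs about `1 / h` blocks,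
and `(n h)² h → ∞` pays for the union bound (`global_ulln`). Hence both maximizers are close to the
true point and are interior critical points (`exists_near_of_isArgmaxOn`), and the noisy Hessian is
close to its limit (`eventually_expansion`).

Newton step. The gradient of the deterministic contrast vanishes at `(wdet, ψdet)`, so the noisy
gradient there is pure noise, of order `1 / (n h)`. Since the noisy gradient vanishes at the
estimators, their deviations are this noise divided by `VHφ` and `VHψ`, up to `o(1 / (n h))`. The
gain in contrast from moving between the two points is quadratic in the deviations, so `τhat - τdet`
is asymptotically the noise of the contrast itself (`newton_scaled`, `tendsto_remainder`).

Limit law. The three noise sums at the deterministic points satisfy a joint central limit theorem,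
proved with characteristic functions (`tendstoInDistribution_sum`). The parity of `K₁` and `K₂`
makes the three windows orthogonal in `L²`, so the covariance is diagonal (`integral_comb_sq`). -/

/-! ### Kernels as `C²` functions on the whole line -/

/-- `k` is twice continuously differentiable with derivatives `k₁`, `k₂`, and all three functions
vanish outside `(-1,1)`. -/
structure CompactC2 (k k₁ k₂ : ℝ → ℝ) : Prop where
  hasDerivAt : ∀ x, HasDerivAt k (k₁ x) x
  hasDerivAt' : ∀ x, HasDerivAt k₁ (k₂ x) x
  continuous₂ : Continuous k₂
  supp : ∀ x, x ∉ Ioo (-1 : ℝ) 1 → k x = 0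
  supp₁ : ∀ x, x ∉ Ioo (-1 : ℝ) 1 → k₁ x = 0
  supp₂ : ∀ x, x ∉ Ioo (-1 : ℝ) 1 → k₂ x = 0

lemma CompactC2.continuous {k k₁ k₂ : ℝ → ℝ} (hk : CompactC2 k k₁ k₂) : Continuous k :=
  continuous_iff_continuousAt.2 fun x => (hk.hasDerivAt x).continuousAt

lemma CompactC2.continuous₁ {k k₁ k₂ : ℝ → ℝ} (hk : CompactC2 k k₁ k₂) : Continuous k₁ :=
  continuous_iff_continuousAt.2 fun x => (hk.hasDerivAt' x).continuousAt

lemma eq_zero_off_Ioo {g : ℝ → ℝ} (h0 : ∀ x, x ∉ Icc (-1 : ℝ) 1 → g x = 0) (hl : g (-1) = 0)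
    (hr : g 1 = 0) (x : ℝ) (hx : x ∉ Ioo (-1 : ℝ) 1) : g x = 0 := by
  by_cases h : x ∈ Icc (-1 : ℝ) 1
  · rcases eq_or_lt_of_le h.1 with h1 | h1
    · rw [← h1, hl]
    · rcases eq_or_lt_of_le h.2 with h2 | h2
      · rw [h2, hr]
      · exact absurd ⟨h1, h2⟩ hx
  · exact h0 x h

lemma isClosed_compl_Ioo_union : IsClosed (Ioo (-1 : ℝ) 1)ᶜ := isOpen_Ioo.isClosed_compl

lemma Icc_union_compl_Ioo : Icc (-1 : ℝ) 1 ∪ (Ioo (-1 : ℝ) 1)ᶜ = univ := by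
  ext x
  simp only [mem_union, mem_compl_iff, mem_univ, iff_true]
  by_cases h : x ∈ Ioo (-1 : ℝ) 1
  · exact Or.inl (Ioo_subset_Icc_self h)
  · exact Or.inr h

lemma continuous_of_zero_off_Ioo {g : ℝ → ℝ} (hg : ContinuousOn g (Icc (-1) 1))
    (h0 : ∀ x, x ∉ Ioo (-1 : ℝ) 1 → g x = 0) : Continuous g := by
  have h2 : ContinuousOn g (Ioo (-1 : ℝ) 1)ᶜ :=
    continuousOn_const.congr (f := fun _ => (0 : ℝ)) h0
  have := hg.union_of_isClosed h2 isClosed_Icc isClosed_compl_Ioo_union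
  rwa [Icc_union_compl_Ioo, continuousOn_univ] at this

/-- The line is the union of the closed sets `[-1,1]` and the complement of `(-1,1)`. At the end
points the two one-sided derivatives agree because both are 0. -/
lemma hasDerivAt_of_zero_off_Ioo {f g : ℝ → ℝ}
    (hf : ∀ x ∈ Icc (-1 : ℝ) 1, HasDerivWithinAt f (g x) (Icc (-1) 1) x)
    (hf0 : ∀ x, x ∉ Ioo (-1 : ℝ) 1 → f x = 0) (hg0 : ∀ x, x ∉ Ioo (-1 : ℝ) 1 → g x = 0) (x : ℝ) :
    HasDerivAt f (g x) x := by
  rw [← hasDerivWithinAt_univ, ← Icc_union_compl_Ioo]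
  have hc (hx : x ∉ Ioo (-1 : ℝ) 1) : HasDerivWithinAt f (g x) (Ioo (-1 : ℝ) 1)ᶜ x := by
    rw [hg0 x hx]
    exact (hasDerivWithinAt_const x _ (0 : ℝ)).congr hf0 (hf0 x hx)
  by_cases h1 : x ∈ Icc (-1 : ℝ) 1
  · by_cases h2 : x ∈ Ioo (-1 : ℝ) 1
    · exact ((hf x h1).hasDerivAt (Icc_mem_nhds h2.1 h2.2)).hasDerivWithinAt
    · exact (hf x h1).union (hc h2)
  · have h2 : x ∉ Ioo (-1 : ℝ) 1 := fun h => h1 (Ioo_subset_Icc_self h)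
    have h3 : (Icc (-1 : ℝ) 1)ᶜ ∈ 𝓝 x := isClosed_Icc.isOpen_compl.mem_nhds h1
    have h4 : (Ioo (-1 : ℝ) 1)ᶜ ∈ 𝓝 x :=
      mem_of_superset h3 (compl_subset_compl.2 Ioo_subset_Icc_self)
    exact ((hc h2).hasDerivAt h4).hasDerivWithinAt

/-- Vanishing of the derivatives of order 0, 1, 2 at `±1` is what lets the extension by zero be `C²`
across the end points. From here on one-sided derivatives are replaced by `deriv`. -/
lemma compactC2_of_contDiffOn {k : ℝ → ℝ} (hk : ContDiffOn ℝ 3 k (Icc (-1) 1))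
    (h0 : ∀ x, x ∉ Icc (-1 : ℝ) 1 → k x = 0)
    (hb : ∀ j ≤ 2, iteratedDerivWithin j k (Icc (-1) 1) (-1) = 0 ∧
      iteratedDerivWithin j k (Icc (-1) 1) 1 = 0) :
    CompactC2 k (deriv k) (deriv (deriv k)) := by
  set S : Set ℝ := Icc (-1) 1 with hS
  have hu : UniqueDiffOn ℝ S := uniqueDiffOn_Icc (by norm_num)
  set g₁ : ℝ → ℝ := S.indicator (derivWithin k S) with hg₁
  set g₂ : ℝ → ℝ := S.indicator (iteratedDerivWithin 2 k S) with hg₂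
  have hl : (-1 : ℝ) ∈ S := by simp [hS]
  have hr : (1 : ℝ) ∈ S := by simp [hS]
  have kz : ∀ x, x ∉ Ioo (-1 : ℝ) 1 → k x = 0 := by
    have := hb 0 (by norm_num)
    simp only [iteratedDerivWithin_zero] at this
    exact eq_zero_off_Ioo h0 this.1 this.2
  have g1z : ∀ x, x ∉ Ioo (-1 : ℝ) 1 → g₁ x = 0 := by
    have := hb 1 (by norm_num)
    simp only [iteratedDerivWithin_one] at this
    refine eq_zero_off_Ioo (fun x hx => indicator_of_notMem hx _) ?_ ?_
    · rw [hg₁, indicator_of_mem hl, this.1]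
    · rw [hg₁, indicator_of_mem hr, this.2]
  have g2z : ∀ x, x ∉ Ioo (-1 : ℝ) 1 → g₂ x = 0 := by
    have := hb 2 (by norm_num)
    refine eq_zero_off_Ioo (fun x hx => indicator_of_notMem hx _) ?_ ?_
    · rw [hg₂, indicator_of_mem hl, this.1]
    · rw [hg₂, indicator_of_mem hr, this.2]
  have d1 : ∀ x, HasDerivAt k (g₁ x) x := by
    refine hasDerivAt_of_zero_off_Ioo (fun x hx => ?_) kz g1z
    rw [hg₁, indicator_of_mem hx]
    exact ((hk.differentiableOn (by norm_num)) x hx).hasDerivWithinAt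
  have d2 : ∀ x, HasDerivAt g₁ (g₂ x) x := by
    refine hasDerivAt_of_zero_off_Ioo (fun x hx => ?_) g1z g2z
    rw [hg₂, indicator_of_mem hx]
    have hd : DifferentiableOn ℝ (iteratedDerivWithin 1 k S) S :=
      hk.differentiableOn_iteratedDerivWithin (by norm_num) hu
    have := (hd x hx).hasDerivWithinAt
    rw [← iteratedDerivWithin_succ] at this
    refine this.congr (fun y hy => ?_) ?_
    · rw [hg₁, indicator_of_mem hy, iteratedDerivWithin_one]
    · rw [hg₁, indicator_of_mem hx, iteratedDerivWithin_one]
  have c2 : Continuous g₂ := by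
    refine continuous_of_zero_off_Ioo ?_ g2z
    refine (hk.continuousOn_iteratedDerivWithin (m := 2) (by norm_num) hu).congr fun y hy => ?_
    rw [hg₂, indicator_of_mem hy]
  have e1 : deriv k = g₁ := funext fun x => (d1 x).deriv
  have e2 : deriv g₁ = g₂ := funext fun x => (d2 x).deriv
  rw [e1, e2]
  exact ⟨d1, d2, c2, kz, g1z, g2z⟩

/-! ### Parity and integrals of compactly supported functions on the line. -/

lemma deriv_odd_of_even {k : ℝ → ℝ} (hk : ∀ x, k (-x) = k x) (x : ℝ) :
    deriv k (-x) = -deriv k x := by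
  have h := deriv_comp_neg k x
  rw [show (fun x => k (-x)) = k from funext hk] at h
  linarith

lemma deriv_even_of_odd {k : ℝ → ℝ} (hk : ∀ x, k (-x) = -k x) (x : ℝ) :
    deriv k (-x) = deriv k x := by
  have h := deriv_comp_neg k x
  rw [show (fun x => k (-x)) = fun x => -k x from funext hk, deriv.fun_neg] at h
  linarith

lemma hasCompactSupport_of_zero_off_Ioo {g : ℝ → ℝ} (h0 : ∀ x, x ∉ Ioo (-1 : ℝ) 1 → g x = 0) :
    HasCompactSupport g :=
  HasCompactSupport.intro (isCompact_Icc (a := (-1 : ℝ)) (b := 1)) fun x hx =>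
    h0 x fun h => hx (Ioo_subset_Icc_self h)

lemma integrable_of_zero_off_Ioo {g : ℝ → ℝ} (hg : Continuous g)
    (h0 : ∀ x, x ∉ Ioo (-1 : ℝ) 1 → g x = 0) : Integrable g :=
  hg.integrable_of_hasCompactSupport (hasCompactSupport_of_zero_off_Ioo h0)

lemma integral_odd_eq_zero {g : ℝ → ℝ} (hg : ∀ x, g (-x) = -g x) : ∫ x, g x = 0 := by
  have h := integral_neg_eq_self g volume
  simp only [hg, integral_neg] at h
  linarith

lemma tendsto_zero_atTop_of_zero_off {g : ℝ → ℝ} (h0 : ∀ x, x ∉ Ioo (-1 : ℝ) 1 → g x = 0) :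
    Tendsto g atTop (𝓝 0) := by
  refine tendsto_const_nhds.congr' ?_
  filter_upwards [eventually_ge_atTop (1 : ℝ)] with x hx
  exact (h0 x fun h => absurd h.2 (not_lt.2 hx)).symm

lemma integral_eq_zero_of_hasDerivAt {f g : ℝ → ℝ} (hf : ∀ x, HasDerivAt f (g x) x)
    (hg : Continuous g) (hf0 : ∀ x, x ∉ Ioo (-1 : ℝ) 1 → f x = 0)
    (hg0 : ∀ x, x ∉ Ioo (-1 : ℝ) 1 → g x = 0) : ∫ x, g x = 0 := by
  have hfc : Continuous f := continuous_iff_continuousAt.2 fun x => (hf x).continuousAt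
  exact integral_eq_zero_of_hasDerivAt_of_integrable hf (integrable_of_zero_off_Ioo hg hg0)
    (integrable_of_zero_off_Ioo hfc hf0)

lemma setIntegral_Ioi_of_hasDerivAt {f g : ℝ → ℝ} (hf : ∀ x, HasDerivAt f (g x) x)
    (hg : Continuous g) (hf0 : ∀ x, x ∉ Ioo (-1 : ℝ) 1 → f x = 0)
    (hg0 : ∀ x, x ∉ Ioo (-1 : ℝ) 1 → g x = 0) : ∫ x in Ioi 0, g x = -f 0 := by
  rw [integral_Ioi_of_hasDerivAt_of_tendsto' (fun x _ => hf x)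
    (integrable_of_zero_off_Ioo hg hg0).integrableOn (tendsto_zero_atTop_of_zero_off hf0), zero_sub]

/-! ### Window functions in rotated coordinates -/

/-- The vector `R_{-ψ} a`. -/
noncomputable def rotArg (ψ : ℝ) (a : ℝ × ℝ) : ℝ × ℝ :=
  (cos ψ * a.1 + sin ψ * a.2, -sin ψ * a.1 + cos ψ * a.2)

/-- A jointly continuous function of an angle and of rotated coordinates which vanishes outside
`(-1,1)²`. -/
structure IsWindow (f : ℝ → ℝ × ℝ → ℝ) : Prop where
  continuous : Continuous (fun p : ℝ × (ℝ × ℝ) => f p.1 p.2)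
  supp : ∀ ψ v, ¬ (v.1 ∈ Ioo (-1 : ℝ) 1 ∧ v.2 ∈ Ioo (-1 : ℝ) 1) → f ψ v = 0

section windows
variable (k k₁ k₂ l l₁ l₂ : ℝ → ℝ)

/-- The product kernel. -/
def win (_ψ : ℝ) (v : ℝ × ℝ) : ℝ := k v.1 * l v.2
/-- The derivative of the rotated kernel in the vertical shift. -/
noncomputable def winW (ψ : ℝ) (v : ℝ × ℝ) : ℝ :=
  sin ψ * (k₁ v.1 * l v.2) + cos ψ * (k v.1 * l₁ v.2)
/-- The derivative of the rotated kernel in the angle. -/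
def winP (_ψ : ℝ) (v : ℝ × ℝ) : ℝ := k₁ v.1 * (v.2 * l v.2) - (v.1 * k v.1) * l₁ v.2
/-- The second derivative of the rotated kernel in the vertical shift. -/
noncomputable def winWW (ψ : ℝ) (v : ℝ × ℝ) : ℝ :=
  sin ψ ^ 2 * (k₂ v.1 * l v.2) + 2 * sin ψ * cos ψ * (k₁ v.1 * l₁ v.2)
    + cos ψ ^ 2 * (k v.1 * l₂ v.2)
/-- The mixed second derivative of the rotated kernel. -/
noncomputable def winWP (ψ : ℝ) (v : ℝ × ℝ) : ℝ :=
  cos ψ * (k₁ v.1 * l v.2) - sin ψ * (k v.1 * l₁ v.2)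
    + sin ψ * (k₂ v.1 * (v.2 * l v.2) - (v.1 * k₁ v.1) * l₁ v.2)
    + cos ψ * (k₁ v.1 * (v.2 * l₁ v.2) - (v.1 * k v.1) * l₂ v.2)
/-- The second derivative of the rotated kernel in the angle. -/
def winPP (_ψ : ℝ) (v : ℝ × ℝ) : ℝ :=
  k₂ v.1 * (v.2 ^ 2 * l v.2) - (v.1 * k₁ v.1) * l v.2 - 2 * ((v.1 * k₁ v.1) * (v.2 * l₁ v.2))
    - k v.1 * (v.2 * l₁ v.2) + (v.1 ^ 2 * k v.1) * l₂ v.2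

end windows

section windowFacts
variable {k k₁ k₂ l l₁ l₂ : ℝ → ℝ} (hk : CompactC2 k k₁ k₂) (hl : CompactC2 l l₁ l₂)
include hk hl

lemma isWindow_of_forall {f : ℝ → ℝ × ℝ → ℝ} (hf : Continuous (fun p : ℝ × (ℝ × ℝ) => f p.1 p.2))
    (h : ∀ ψ v, (k v.1 = 0 ∧ k₁ v.1 = 0 ∧ k₂ v.1 = 0) ∨ (l v.2 = 0 ∧ l₁ v.2 = 0 ∧ l₂ v.2 = 0) →
      f ψ v = 0) : IsWindow f := by
  refine ⟨hf, fun ψ v hv => h ψ v ?_⟩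
  by_cases h1 : v.1 ∈ Ioo (-1 : ℝ) 1
  · have h2 : v.2 ∉ Ioo (-1 : ℝ) 1 := fun h2 => hv ⟨h1, h2⟩
    exact Or.inr ⟨hl.supp _ h2, hl.supp₁ _ h2, hl.supp₂ _ h2⟩
  · exact Or.inl ⟨hk.supp _ h1, hk.supp₁ _ h1, hk.supp₂ _ h1⟩

lemma isWindow_win : IsWindow (win k l) := by
  have := hk.continuous
  have := hl.continuous
  refine isWindow_of_forall hk hl (by unfold win; fun_prop) fun ψ v h => ?_
  rcases h with ⟨h1, h2, h3⟩ | ⟨h1, h2, h3⟩ <;> simp [win, h1]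

lemma isWindow_winW : IsWindow (winW k k₁ l l₁) := by
  have := hk.continuous
  have := hl.continuous
  have := hk.continuous₁
  have := hl.continuous₁
  refine isWindow_of_forall hk hl (by unfold winW; fun_prop) fun ψ v h => ?_
  rcases h with ⟨h1, h2, h3⟩ | ⟨h1, h2, h3⟩ <;> simp [winW, h1, h2]

lemma isWindow_winP : IsWindow (winP k k₁ l l₁) := by
  have := hk.continuous
  have := hl.continuous
  have := hk.continuous₁
  have := hl.continuous₁
  refine isWindow_of_forall hk hl (by unfold winP; fun_prop) fun ψ v h => ?_
  rcases h with ⟨h1, h2, h3⟩ | ⟨h1, h2, h3⟩ <;> simp [winP, h1, h2]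

lemma isWindow_winWW : IsWindow (winWW k k₁ k₂ l l₁ l₂) := by
  have := hk.continuous
  have := hl.continuous
  have := hk.continuous₁
  have := hl.continuous₁
  have := hk.continuous₂
  have := hl.continuous₂
  refine isWindow_of_forall hk hl (by unfold winWW; fun_prop) fun ψ v h => ?_
  rcases h with ⟨h1, h2, h3⟩ | ⟨h1, h2, h3⟩ <;> simp [winWW, h1, h2, h3]

lemma isWindow_winWP : IsWindow (winWP k k₁ k₂ l l₁ l₂) := by
  have := hk.continuous
  have := hl.continuous
  have := hk.continuous₁
  have := hl.continuous₁
  have := hk.continuous₂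
  have := hl.continuous₂
  refine isWindow_of_forall hk hl (by unfold winWP; fun_prop) fun ψ v h => ?_
  rcases h with ⟨h1, h2, h3⟩ | ⟨h1, h2, h3⟩ <;> simp [winWP, h1, h2, h3]

lemma isWindow_winPP : IsWindow (winPP k k₁ k₂ l l₁ l₂) := by
  have := hk.continuous
  have := hl.continuous
  have := hk.continuous₁
  have := hl.continuous₁
  have := hk.continuous₂
  have := hl.continuous₂
  refine isWindow_of_forall hk hl (by unfold winPP; fun_prop) fun ψ v h => ?_
  rcases h with ⟨h1, h2, h3⟩ | ⟨h1, h2, h3⟩ <;> simp [winPP, h1, h2, h3]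

end windowFacts

/-! ### Derivatives of window functions along lines in (shift, angle). -/

section pathDerivatives
variable {k k₁ k₂ l l₁ l₂ : ℝ → ℝ} (hk : CompactC2 k k₁ k₂) (hl : CompactC2 l l₁ l₂)

lemma hasDerivAt_rotArg_fst (a : ℝ × ℝ) (w ψ α β t : ℝ) :
    HasDerivAt (fun t => (rotArg (ψ + t * β) (a.1, a.2 + (w + t * α))).1)
      (β * (rotArg (ψ + t * β) (a.1, a.2 + (w + t * α))).2 + α * sin (ψ + t * β)) t := by
  have h1 : HasDerivAt (fun t : ℝ => ψ + t * β) β t := by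
    simpa using ((hasDerivAt_id t).mul_const β).const_add ψ
  have h2 : HasDerivAt (fun t : ℝ => a.2 + (w + t * α)) α t := by
    simpa using (((hasDerivAt_id t).mul_const α).const_add w).const_add a.2
  have h := (h1.cos.mul_const a.1).add (h1.sin.mul h2)
  refine h.congr_deriv ?_
  simp only [rotArg]
  ring

lemma hasDerivAt_rotArg_snd (a : ℝ × ℝ) (w ψ α β t : ℝ) :
    HasDerivAt (fun t => (rotArg (ψ + t * β) (a.1, a.2 + (w + t * α))).2)
      (-β * (rotArg (ψ + t * β) (a.1, a.2 + (w + t * α))).1 + α * cos (ψ + t * β)) t := by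
  have h1 : HasDerivAt (fun t : ℝ => ψ + t * β) β t := by
    simpa using ((hasDerivAt_id t).mul_const β).const_add ψ
  have h2 : HasDerivAt (fun t : ℝ => a.2 + (w + t * α)) α t := by
    simpa using (((hasDerivAt_id t).mul_const α).const_add w).const_add a.2
  have h := (h1.sin.neg.mul_const a.1).add (h1.cos.mul h2)
  refine h.congr_deriv ?_
  simp only [rotArg]
  ring

/-- `f` has derivatives `p` in the vertical shift and `q` in the angle. -/
def HasPathDeriv (f p q : ℝ → ℝ × ℝ → ℝ) : Prop :=
  ∀ (a : ℝ × ℝ) (w ψ α β t : ℝ),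
    HasDerivAt (fun t => f (ψ + t * β) (rotArg (ψ + t * β) (a.1, a.2 + (w + t * α))))
      (α * p (ψ + t * β) (rotArg (ψ + t * β) (a.1, a.2 + (w + t * α)))
        + β * q (ψ + t * β) (rotArg (ψ + t * β) (a.1, a.2 + (w + t * α)))) t

include hk hl in
-- In rotated coordinates `v`, a vertical shift moves `v` in the direction `(sin ψ, cos ψ)` and a
-- change of angle moves it in the direction `(v.2, -v.1)`. The formulas for the derivative windows
-- are the chain rule for these two directions.
lemma hasPathDeriv_win : HasPathDeriv (win k l) (winW k k₁ l l₁) (winP k k₁ l l₁) := by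
  intro a w ψ α β t
  have hA := hasDerivAt_rotArg_fst a w ψ α β t
  have hB := hasDerivAt_rotArg_snd a w ψ α β t
  have h1 := (hk.hasDerivAt _).comp t hA
  have h2 := (hl.hasDerivAt _).comp t hB
  refine (h1.mul h2).congr_deriv ?_
  simp only [winW, winP, Function.comp]
  ring

include hk hl in
lemma hasPathDeriv_winW :
    HasPathDeriv (winW k k₁ l l₁) (winWW k k₁ k₂ l l₁ l₂) (winWP k k₁ k₂ l l₁ l₂) := by
  intro a w ψ α β t
  have hA := hasDerivAt_rotArg_fst a w ψ α β t
  have hB := hasDerivAt_rotArg_snd a w ψ α β t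
  have h0 : HasDerivAt (fun t : ℝ => ψ + t * β) β t := by
    simpa using ((hasDerivAt_id t).mul_const β).const_add ψ
  have h1 := (hk.hasDerivAt _).comp t hA
  have h2 := (hl.hasDerivAt _).comp t hB
  have h3 := (hk.hasDerivAt' _).comp t hA
  have h4 := (hl.hasDerivAt' _).comp t hB
  refine ((h0.sin.mul (h3.mul h2)).add (h0.cos.mul (h1.mul h4))).congr_deriv ?_
  simp only [winWW, winWP, Function.comp, Pi.mul_apply]
  ring

include hk hl in
lemma hasPathDeriv_winP :
    HasPathDeriv (winP k k₁ l l₁) (winWP k k₁ k₂ l l₁ l₂) (winPP k k₁ k₂ l l₁ l₂) := by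
  intro a w ψ α β t
  have hA := hasDerivAt_rotArg_fst a w ψ α β t
  have hB := hasDerivAt_rotArg_snd a w ψ α β t
  have h1 := (hk.hasDerivAt _).comp t hA
  have h2 := (hl.hasDerivAt _).comp t hB
  have h3 := (hk.hasDerivAt' _).comp t hA
  have h4 := (hl.hasDerivAt' _).comp t hB
  refine ((h3.mul (hB.mul h2)).sub ((hA.mul h1).mul h4)).congr_deriv ?_
  simp only [winPP, winWP, Function.comp, Pi.mul_apply]
  ring

end pathDerivatives

/-! ### Localized sums -/

/-- The weighted sum of the data `Y` with the window function `f`, as a function of the rescaled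
vertical shift `w` from the centre `z` and of the angle `ψ`. -/
noncomputable def localSum {n : ℕ} (ξ : Fin n → ℝ) (h : ℝ) (z : ℝ × ℝ) (Y : Fin n × Fin n → ℝ)
    (f : ℝ → ℝ × ℝ → ℝ) (w ψ : ℝ) : ℝ :=
  ((n * h) ^ 2)⁻¹ *
    ∑ i, Y i * f ψ (rotArg ψ ((z.1 - ξ i.1) / h, (z.2 - ξ i.2) / h + w))

lemma HasPathDeriv.localSum {f p q : ℝ → ℝ × ℝ → ℝ} (hf : HasPathDeriv f p q) {n : ℕ}
    (ξ : Fin n → ℝ) (h : ℝ) (z : ℝ × ℝ) (Y : Fin n × Fin n → ℝ) (w ψ α β t : ℝ) :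
    HasDerivAt (fun t => localSum ξ h z Y f (w + t * α) (ψ + t * β))
      (α * localSum ξ h z Y p (w + t * α) (ψ + t * β)
        + β * localSum ξ h z Y q (w + t * α) (ψ + t * β)) t := by
  unfold _root_.localSum
  have := HasDerivAt.fun_sum (u := Finset.univ) fun (i : Fin n × Fin n) _ =>
    (hf ((z.1 - ξ i.1) / h, (z.2 - ξ i.2) / h) w ψ α β t).const_mul (Y i)
  refine (this.const_mul (((n * h) ^ 2)⁻¹)).congr_deriv ?_
  simp only [Finset.mul_sum, ← Finset.sum_add_distrib]
  exact Finset.sum_congr rfl fun i _ => by ring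

lemma localSum_add {n : ℕ} (ξ : Fin n → ℝ) (h : ℝ) (z : ℝ × ℝ) (Y Z : Fin n × Fin n → ℝ)
    (f : ℝ → ℝ × ℝ → ℝ) (w ψ : ℝ) :
    localSum ξ h z (fun i => Y i + Z i) f w ψ = localSum ξ h z Y f w ψ + localSum ξ h z Z f w ψ := by
  simp only [localSum, add_mul, Finset.sum_add_distrib, mul_add]

/-- The reference height `y₀` is free; it will be `φ x`. The factors `n⁻²` and `h⁻²` combine into
`(n h)⁻²`, the area of a grid cell in local coordinates. -/
lemma empContrast_eq_localSum (K₁ K₂ : ℝ → ℝ) {n : ℕ} (ξ : Fin n → ℝ) (Y : Fin n × Fin n → ℝ)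
    (x y y₀ ψ : ℝ) {h : ℝ} (hh : h ≠ 0) :
    empContrast K₁ K₂ ξ Y ![x, y] ψ h
      = localSum ξ h (x, y₀) Y (win K₁ K₂) ((y - y₀) / h) ψ := by
  unfold empContrast localSum
  rw [Finset.mul_sum, Finset.mul_sum]
  refine Finset.sum_congr rfl fun i _ => ?_
  have e : (y₀ - ξ i.2) / h + (y - y₀) / h = (y - ξ i.2) / h := by field_simp; ring
  have e0 : (h⁻¹ • (rotMatrix (-ψ) *ᵥ (![x, y] - ![ξ i.1, ξ i.2]))) 0
      = cos ψ * ((x - ξ i.1) / h) + sin ψ * ((y - ξ i.2) / h) := by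
    simp [rotMatrix]
    ring
  have e1 : (h⁻¹ • (rotMatrix (-ψ) *ᵥ (![x, y] - ![ξ i.1, ξ i.2]))) 1
      = -sin ψ * ((x - ξ i.1) / h) + cos ψ * ((y - ξ i.2) / h) := by
    simp [rotMatrix]
    ring
  simp only [rotKernel, e, e0, e1, win, rotArg]
  rw [mul_pow, mul_inv]
  field_simp

/-! ### Riemann sums over the design as integrals of step functions -/

/-- The `i`-th grid cell in the local coordinate `t = (z - u) / h`. -/
def localCell (n : ℕ) (h z : ℝ) (i : Fin n) : Set ℝ :=
  Ioc ((z - (i + 1) / n) / h) ((z - i / n) / h)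

lemma mem_localCell {n : ℕ} {h z : ℝ} (hh : 0 < h) {i : Fin n} {t : ℝ} :
    t ∈ localCell n h z i ↔ (i : ℝ) / n ≤ z - h * t ∧ z - h * t < (i + 1) / n := by
  rw [localCell, mem_Ioc, div_lt_iff₀ hh, le_div_iff₀ hh]
  constructor <;> rintro ⟨h1, h2⟩ <;> constructor <;> linarith

lemma localCell_unique {n : ℕ} {h z : ℝ} (hh : 0 < h) {i j : Fin n} {t : ℝ}
    (hi : t ∈ localCell n h z i) (hj : t ∈ localCell n h z j) : i = j := by
  have hn : (0 : ℝ) < n := by exact_mod_cast i.pos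
  rw [mem_localCell hh, div_le_iff₀ hn, lt_div_iff₀ hn] at hi hj
  have h1 : (i : ℝ) < j + 1 := by linarith
  have h2 : (j : ℝ) < i + 1 := by linarith
  norm_cast at h1 h2
  exact Fin.ext (by omega)

lemma exists_localCell {n : ℕ} (hn : 0 < n) {h z t : ℝ} (hh : 0 < h)
    (ht : z - h * t ∈ Ioo (0 : ℝ) 1) : ∃ i, t ∈ localCell n h z i := by
  have hn' : (0 : ℝ) < n := by exact_mod_cast hn
  have h0 : 0 ≤ n * (z - h * t) := mul_nonneg hn'.le ht.1.le
  have h1 : ⌊n * (z - h * t)⌋₊ < n := by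
    rw [Nat.floor_lt h0]
    nlinarith [ht.2]
  refine ⟨⟨_, h1⟩, ?_⟩
  rw [mem_localCell hh, div_le_iff₀ hn', lt_div_iff₀ hn']
  exact ⟨by simpa [mul_comm] using Nat.floor_le h0,
    by simpa [mul_comm] using Nat.lt_floor_add_one (n * (z - h * t))⟩

lemma volume_real_localCell {n : ℕ} {h z : ℝ} (hh : 0 < h) (i : Fin n) :
    volume.real (localCell n h z i) = (n * h)⁻¹ := by
  have hn : (0 : ℝ) < n := by exact_mod_cast i.pos
  rw [localCell, Real.volume_real_Ioc_of_le]
  · field_simp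
    ring
  · gcongr
    linarith

lemma abs_sub_le_of_mem_localCell {n : ℕ} {h z t : ℝ} (hh : 0 < h) {i : Fin n} {x : ℝ}
    (hx : x ∈ Icc ((i : ℝ) / n) ((i + 1) / n)) (ht : t ∈ localCell n h z i) :
    |(z - x) / h - t| ≤ (n * h)⁻¹ := by
  have hn : (0 : ℝ) < n := by exact_mod_cast i.pos
  rw [mem_localCell hh] at ht
  have e : (z - x) / h - t = (z - h * t - x) / h := by field_simp; ring
  rw [e, abs_div, abs_of_pos hh, div_le_iff₀ hh]
  have e2 : (n * h)⁻¹ * h = ((i : ℝ) + 1) / n - i / n := by field_simp; ring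
  rw [e2, abs_le]
  constructor <;> linarith [hx.1, hx.2, ht.1, ht.2]

/-- The step function whose integral is the localized sum. -/
noncomputable def stepFun {n : ℕ} (h : ℝ) (z : ℝ × ℝ) (c : Fin n × Fin n → ℝ) (a : ℝ × ℝ) : ℝ :=
  ∑ i, (localCell n h z.1 i.1 ×ˢ localCell n h z.2 i.2).indicator (fun _ => c i) a

lemma measurableSet_localCell_prod {n : ℕ} (h : ℝ) (z : ℝ × ℝ) (i : Fin n × Fin n) :
    MeasurableSet (localCell n h z.1 i.1 ×ˢ localCell n h z.2 i.2) :=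
  measurableSet_Ioc.prod measurableSet_Ioc

lemma measurable_stepFun {n : ℕ} (h : ℝ) (z : ℝ × ℝ) (c : Fin n × Fin n → ℝ) :
    Measurable (stepFun h z c) :=
  Finset.measurable_sum _ fun i _ =>
    measurable_const.indicator (measurableSet_localCell_prod h z i)

lemma integral_stepFun {n : ℕ} {h : ℝ} (hh : 0 < h) (z : ℝ × ℝ) (c : Fin n × Fin n → ℝ) :
    ∫ a, stepFun h z c a = ((n * h) ^ 2)⁻¹ * ∑ i, c i := by
  have hfin (i : Fin n × Fin n) :
      volume (localCell n h z.1 i.1 ×ˢ localCell n h z.2 i.2) ≠ ⊤ := by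
    rw [Measure.volume_eq_prod, Measure.prod_prod]
    exact ENNReal.mul_ne_top measure_Ioc_lt_top.ne measure_Ioc_lt_top.ne
  unfold stepFun
  rw [integral_finsetSum]
  · rw [Finset.mul_sum]
    refine Finset.sum_congr rfl fun i _ => ?_
    rw [integral_indicator_const _ (measurableSet_localCell_prod h z i), Measure.volume_eq_prod,
      measureReal_prod_prod, volume_real_localCell hh, volume_real_localCell hh, smul_eq_mul,
      ← mul_inv, sq]
  · intro i _
    exact (integrable_indicator_iff (measurableSet_localCell_prod h z i)).2
      (integrableOn_const (hfin i))

lemma stepFun_eq_of_mem {n : ℕ} {h : ℝ} (hh : 0 < h) {z : ℝ × ℝ} (c : Fin n × Fin n → ℝ)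
    {a : ℝ × ℝ} {i : Fin n × Fin n} (hi : a.1 ∈ localCell n h z.1 i.1)
    (hj : a.2 ∈ localCell n h z.2 i.2) : stepFun h z c a = c i := by
  unfold stepFun
  rw [Finset.sum_eq_single i, indicator_of_mem (show a ∈ _ ×ˢ _ from ⟨hi, hj⟩)]
  · intro j _ hji
    refine indicator_of_notMem (fun hm => hji ?_) _
    exact Prod.ext (localCell_unique hh hm.1 hi) (localCell_unique hh hm.2 hj)
  · simp

lemma stepFun_eq_zero {n : ℕ} {h : ℝ} {z : ℝ × ℝ} (c : Fin n × Fin n → ℝ) {a : ℝ × ℝ}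
    (ha : ∀ i : Fin n × Fin n, ¬ (a.1 ∈ localCell n h z.1 i.1 ∧ a.2 ∈ localCell n h z.2 i.2)) :
    stepFun h z c a = 0 :=
  Finset.sum_eq_zero fun i _ => indicator_of_notMem (fun hm => ha i ⟨hm.1, hm.2⟩) _

lemma norm_sub_le_of_mem_localCell {n : ℕ} {h : ℝ} (hh : 0 < h) {ξ : Fin n → ℝ}
    (hξ : ∀ i : Fin n, ξ i ∈ Icc ((i : ℝ) / n) ((i + 1) / n)) {z a : ℝ × ℝ} {i : Fin n × Fin n}
    (hi : a.1 ∈ localCell n h z.1 i.1) (hj : a.2 ∈ localCell n h z.2 i.2) :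
    ‖((z.1 - ξ i.1) / h, (z.2 - ξ i.2) / h) - a‖ ≤ (n * h)⁻¹ :=
  max_le (abs_sub_le_of_mem_localCell hh (hξ _) hi) (abs_sub_le_of_mem_localCell hh (hξ _) hj)


/-! ### Supports and bounds of windows in unrotated coordinates. -/

lemma rotArg_sq (ψ : ℝ) (a : ℝ × ℝ) :
    (rotArg ψ a).1 ^ 2 + (rotArg ψ a).2 ^ 2 = a.1 ^ 2 + a.2 ^ 2 := by
  simp only [rotArg]
  linear_combination (a.1 ^ 2 + a.2 ^ 2) * sin_sq_add_cos_sq ψ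

lemma continuous_rotArg : Continuous fun p : ℝ × (ℝ × ℝ) => rotArg p.1 p.2 := by
  unfold rotArg
  fun_prop

namespace IsWindow
variable {f : ℝ → ℝ × ℝ → ℝ} (hf : IsWindow f)
include hf

lemma continuous_rot : Continuous fun p : ℝ × (ℝ × ℝ) => f p.1 (rotArg p.1 p.2) :=
  hf.continuous.comp (continuous_fst.prodMk continuous_rotArg)

/-- A rotated square `(-1,1)²` lies in the open disc of radius `√2`, whatever the angle. This
matches the margin `√2 h` in `searchRange`. -/
lemma sq_add_sq_lt {ψ : ℝ} {a : ℝ × ℝ} (h : f ψ (rotArg ψ a) ≠ 0) : a.1 ^ 2 + a.2 ^ 2 < 2 := by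
  by_contra hc
  refine h (hf.supp _ _ fun hv => hc ?_)
  rw [← rotArg_sq ψ a]
  have h1 : (rotArg ψ a).1 ^ 2 < 1 := by
    rw [sq_lt_one_iff_abs_lt_one, abs_lt]; exact hv.1
  have h2 : (rotArg ψ a).2 ^ 2 < 1 := by
    rw [sq_lt_one_iff_abs_lt_one, abs_lt]; exact hv.2
  linarith

lemma norm_le_two {ψ : ℝ} {a : ℝ × ℝ} (h : f ψ (rotArg ψ a) ≠ 0) : ‖a‖ ≤ 2 := by
  have := hf.sq_add_sq_lt h
  refine max_le ?_ ?_
  · exact abs_le_of_sq_le_sq (by nlinarith [sq_nonneg a.2]) (by norm_num)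
  · exact abs_le_of_sq_le_sq (by nlinarith [sq_nonneg a.1]) (by norm_num)

lemma exists_bound (ψ₁ ψ₂ : ℝ) : ∃ M, 0 ≤ M ∧ ∀ ψ ∈ Icc ψ₁ ψ₂, ∀ v, |f ψ v| ≤ M := by
  obtain ⟨M, hM⟩ := ((isCompact_Icc (a := ψ₁) (b := ψ₂)).prod
    ((isCompact_Icc (a := (-1 : ℝ)) (b := 1)).prod
      (isCompact_Icc (a := (-1 : ℝ)) (b := 1)))).exists_bound_of_continuousOn
        hf.continuous.continuousOn
  refine ⟨max M 0, le_max_right _ _, fun ψ hψ v => ?_⟩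
  by_cases h : v.1 ∈ Ioo (-1 : ℝ) 1 ∧ v.2 ∈ Ioo (-1 : ℝ) 1
  · exact (hM (ψ, v) ⟨hψ, Ioo_subset_Icc_self h.1, Ioo_subset_Icc_self h.2⟩).trans (le_max_left _ _)
  · rw [hf.supp _ _ h, abs_zero]
    exact le_max_right _ _

end IsWindow

/-! ### Convergence of localized sums to integrals. -/

open Classical in
/-- The grid point, in local coordinates, of the cell that contains `a`. -/
noncomputable def cellPoint {n : ℕ} (ξ : Fin n → ℝ) (h : ℝ) (z a : ℝ × ℝ) : ℝ × ℝ :=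
  if H : ∃ i : Fin n × Fin n, a.1 ∈ localCell n h z.1 i.1 ∧ a.2 ∈ localCell n h z.2 i.2 then
    ((z.1 - ξ H.choose.1) / h, (z.2 - ξ H.choose.2) / h)
  -- This default keeps the displacement bound below true for points outside every cell.
  else a

lemma norm_cellPoint_sub_le {n : ℕ} {h : ℝ} (hh : 0 < h) {ξ : Fin n → ℝ}
    (hξ : ∀ i : Fin n, ξ i ∈ Icc ((i : ℝ) / n) ((i + 1) / n)) (z a : ℝ × ℝ) :
    ‖cellPoint ξ h z a - a‖ ≤ (n * h)⁻¹ := by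
  unfold cellPoint
  split_ifs with H
  · exact norm_sub_le_of_mem_localCell hh hξ H.choose_spec.1 H.choose_spec.2
  · rw [sub_self, norm_zero]
    positivity

lemma RegularDesign.mem_Icc {ξ : (n : ℕ) → Fin n → ℝ} (hξ : RegularDesign ξ) {n : ℕ} (i : Fin n) :
    ξ n i ∈ Icc (0 : ℝ) 1 := by
  have hn : (0 : ℝ) < n := by exact_mod_cast i.pos
  have h := hξ n i
  refine ⟨le_trans (by positivity) h.1, h.2.trans ?_⟩
  rw [div_le_one hn]
  exact_mod_cast i.isLt

/-- Dominated convergence for localized Riemann sums. -/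
theorem tendsto_localSum {ι : Type*} {L : Filter ι} [L.IsCountablyGenerated]
    {ξ : (n : ℕ) → Fin n → ℝ} (hξ : RegularDesign ξ) {N : ι → ℕ} {H w ψ : ι → ℝ} {x : ℝ × ℝ}
    {g : ι → ℝ × ℝ → ℝ} {γ : ℝ × ℝ → ℝ} {C ψ₀ : ℝ} {f : ℝ → ℝ × ℝ → ℝ} (hf : IsWindow f)
    (hH : ∀ᶠ k in L, 0 < H k) (hNH : Tendsto (fun k => N k * H k) L atTop)
    (hψ : Tendsto ψ L (𝓝 ψ₀))
    (hbd : ∀ k, ∀ p : ℝ × ℝ, p.1 ∈ Icc (0 : ℝ) 1 → p.2 ∈ Icc (0 : ℝ) 1 → |g k p| ≤ C)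
    (hin : ∀ a : ℝ × ℝ, a.1 ^ 2 + a.2 ^ 2 < 2 → ∀ᶠ k in L, x.1 - H k * a.1 ∈ Ioo (0 : ℝ) 1 ∧
      x.2 + H k * w k - H k * a.2 ∈ Ioo (0 : ℝ) 1)
    (hg : ∀ᵐ a : ℝ × ℝ, ∀ b : ι → ℝ × ℝ, Tendsto b L (𝓝 a) →
      (∀ᶠ k in L, x.1 - H k * (b k).1 ∈ Icc (0 : ℝ) 1 ∧
        x.2 + H k * w k - H k * (b k).2 ∈ Icc (0 : ℝ) 1) →
      Tendsto (fun k => g k (x.1 - H k * (b k).1, x.2 + H k * w k - H k * (b k).2)) L (𝓝 (γ a))) :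
    Tendsto (fun k => localSum (ξ (N k)) (H k) x (fun i => g k (ξ (N k) i.1, ξ (N k) i.2)) f
      (w k) (ψ k)) L (𝓝 (∫ a, γ a * f ψ₀ (rotArg ψ₀ a))) := by
  set z : ι → ℝ × ℝ := fun k => (x.1, x.2 + H k * w k) with hz
  set c : (k : ι) → Fin (N k) × Fin (N k) → ℝ := fun k i =>
    g k (ξ (N k) i.1, ξ (N k) i.2) * f (ψ k) (rotArg (ψ k)
      (((z k).1 - ξ (N k) i.1) / H k, ((z k).2 - ξ (N k) i.2) / H k)) with hc
  set T : ι → ℝ × ℝ → ℝ × ℝ := fun k a => cellPoint (ξ (N k)) (H k) (z k) a with hT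
  have hNHinv : Tendsto (fun k => (N k * H k)⁻¹) L (𝓝 0) := tendsto_inv_atTop_zero.comp hNH
  obtain ⟨M, hM0, hM⟩ := hf.exists_bound (ψ₀ - 1) (ψ₀ + 1)
  have hψM : ∀ᶠ k in L, ψ k ∈ Icc (ψ₀ - 1) (ψ₀ + 1) :=
    hψ (Icc_mem_nhds (by linarith) (by linarith))
  have hTlim (a : ℝ × ℝ) : Tendsto (fun k => T k a) L (𝓝 a) := by
    rw [tendsto_iff_norm_sub_tendsto_zero]
    refine squeeze_zero' (Eventually.of_forall fun k => norm_nonneg _) ?_ hNHinv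
    filter_upwards [hH] with k hk
    exact norm_cellPoint_sub_le hk (hξ (N k)) _ _
  have hval (k : ι) (hk : 0 < H k) (a : ℝ × ℝ)
      (he : ∃ i : Fin (N k) × Fin (N k), a.1 ∈ localCell (N k) (H k) (z k).1 i.1 ∧
        a.2 ∈ localCell (N k) (H k) (z k).2 i.2) :
      x.1 - H k * (T k a).1 ∈ Icc (0 : ℝ) 1 ∧ x.2 + H k * w k - H k * (T k a).2 ∈ Icc (0 : ℝ) 1 ∧
      stepFun (H k) (z k) (c k) a =
        g k (x.1 - H k * (T k a).1, x.2 + H k * w k - H k * (T k a).2) *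
          f (ψ k) (rotArg (ψ k) (T k a)) := by
    have e1 : T k a = (((z k).1 - ξ (N k) he.choose.1) / H k,
        ((z k).2 - ξ (N k) he.choose.2) / H k) := by
      rw [hT]; simp only [cellPoint, dif_pos he]
    have e2 : x.1 - H k * (T k a).1 = ξ (N k) he.choose.1 := by
      rw [e1]; simp only [z]; field_simp; ring
    have e3 : x.2 + H k * w k - H k * (T k a).2 = ξ (N k) he.choose.2 := by
      rw [e1]; simp only [z]; field_simp; ring
    rw [e2, e3]
    refine ⟨hξ.mem_Icc _, hξ.mem_Icc _, ?_⟩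
    rw [stepFun_eq_of_mem hk (c k) he.choose_spec.1 he.choose_spec.2, e1]
  -- This bound serves twice: it gives the dominating function, and it gives pointwise convergence
  -- to 0 where the limiting window vanishes, without asking whether `a` lies in a cell.
  have hC : ∀ k, ∀ a, 0 < H k → |stepFun (H k) (z k) (c k) a| ≤
      |C| * |f (ψ k) (rotArg (ψ k) (T k a))| := by
    intro k a hk
    by_cases he : ∃ i : Fin (N k) × Fin (N k), a.1 ∈ localCell (N k) (H k) (z k).1 i.1 ∧
        a.2 ∈ localCell (N k) (H k) (z k).2 i.2
    · obtain ⟨h1, h2, h3⟩ := hval k hk a he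
      rw [h3, abs_mul]
      exact mul_le_mul_of_nonneg_right ((hbd k (_, _) h1 h2).trans (le_abs_self C)) (abs_nonneg _)
    · rw [stepFun_eq_zero (c k) (by simpa only [not_exists] using he), abs_zero]
      positivity
  have hrewrite : ∀ᶠ k in L, ∫ a, stepFun (H k) (z k) (c k) a =
      localSum (ξ (N k)) (H k) x (fun i => g k (ξ (N k) i.1, ξ (N k) i.2)) f (w k) (ψ k) := by
    filter_upwards [hH] with k hk
    rw [integral_stepFun hk, localSum]
    congr 1
    refine Finset.sum_congr rfl fun i _ => ?_
    have e : (x.2 - ξ (N k) i.2) / H k + w k = ((z k).2 - ξ (N k) i.2) / H k := by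
      rw [hz]; field_simp; ring
    rw [e, hc]
  refine Tendsto.congr' hrewrite ?_
  -- The radius 3 is the window radius 2 plus a displacement to the grid point that is eventually
  -- less than 1.
  refine tendsto_integral_filter_of_dominated_convergence
    ((Metric.closedBall (0 : ℝ × ℝ) 3).indicator fun _ => |C| * M)
    (Eventually.of_forall fun k => (measurable_stepFun _ _ _).aestronglyMeasurable) ?_ ?_ ?_
  · filter_upwards [hH, hψM, hNHinv.eventually (gt_mem_nhds one_pos)] with k hk hkψ hk1
    refine Eventually.of_forall fun a => ?_
    by_cases ha : a ∈ Metric.closedBall (0 : ℝ × ℝ) 3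
    · rw [indicator_of_mem ha]
      refine (hC k a hk).trans ?_
      gcongr
      exact hM _ hkψ _
    · rw [indicator_of_notMem ha]
      have h0 : f (ψ k) (rotArg (ψ k) (T k a)) = 0 := by
        by_contra h
        have h2 := hf.norm_le_two h
        have h3 : ‖T k a - a‖ ≤ _ := norm_cellPoint_sub_le hk (hξ (N k)) (z k) a
        refine ha (mem_closedBall_zero_iff.2 ?_)
        have := norm_sub_norm_le a (T k a)
        rw [norm_sub_rev] at this
        linarith
      have := hC k a hk
      rwa [h0, abs_zero, mul_zero] at this
  · exact (integrable_indicator_iff Metric.isClosed_closedBall.measurableSet).2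
      (integrableOn_const (isCompact_closedBall _ _).measure_lt_top.ne)
  · filter_upwards [hg] with a ha
    have hfl : Tendsto (fun k => f (ψ k) (rotArg (ψ k) (T k a))) L (𝓝 (f ψ₀ (rotArg ψ₀ a))) :=
      (hf.continuous_rot.tendsto (ψ₀, a)).comp (hψ.prodMk_nhds (hTlim a))
    by_cases h0 : f ψ₀ (rotArg ψ₀ a) = 0
    · rw [h0, mul_zero]
      refine squeeze_zero_norm' (a := fun k => |C| * |f (ψ k) (rotArg (ψ k) (T k a))|) ?_ ?_
      · filter_upwards [hH] with k hk using hC k a hk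
      · rw [h0] at hfl
        simpa using hfl.abs.const_mul |C|
    -- A nonzero limiting window forces `a` into the disc of radius `√2`, where `hin` places the
    -- point inside the image and hence in a cell.
    · have hex : ∀ᶠ k in L, ∃ i : Fin (N k) × Fin (N k),
          a.1 ∈ localCell (N k) (H k) (z k).1 i.1 ∧ a.2 ∈ localCell (N k) (H k) (z k).2 i.2 := by
        filter_upwards [hH, hin a (hf.sq_add_sq_lt h0), hNH.eventually_gt_atTop 0] with k hk hk2 hk3
        have hN : 0 < N k := by
          rcases Nat.eq_zero_or_pos (N k) with h | h
          · simp [h] at hk3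
          · exact h
        obtain ⟨i, hi⟩ := exists_localCell hN hk hk2.1
        obtain ⟨j, hj⟩ := exists_localCell hN hk hk2.2
        exact ⟨(i, j), hi, hj⟩
      have hgl := ha (fun k => T k a) (hTlim a) (by
        filter_upwards [hH, hex] with k hk hke
        obtain ⟨h1, h2, -⟩ := hval k hk a hke
        exact ⟨h1, h2⟩)
      refine (hgl.mul hfl).congr' ?_
      filter_upwards [hH, hex] with k hk hke
      exact (hval k hk a hke).2.2.symm

/-! ### Rotation invariance of the integral -/

/-- Under the identification of the plane with `ℂ` this map is multiplication by `exp (-iψ)`, a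
linear isometry. -/
lemma measurePreserving_rotArg (ψ : ℝ) : MeasurePreserving (rotArg ψ) := by
  have h1 := Complex.volume_preserving_equiv_real_prod
  have h2 : MeasurePreserving (rotation (Circle.exp (-ψ))) :=
    (rotation (Circle.exp (-ψ))).measurePreserving
  have h3 := (h1.comp h2).comp (h1.symm _)
  convert h3 using 1
  funext a
  have e : (Complex.measurableEquivRealProd.symm a : ℂ) = ⟨a.1, a.2⟩ := rfl
  simp only [Function.comp, e, rotation_apply, Circle.coe_exp]
  rw [Complex.measurableEquivRealProd_apply]
  refine Prod.ext ?_ ?_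
  · simp [rotArg, Complex.exp_re, Complex.exp_im]
  · simp [rotArg, Complex.exp_re, Complex.exp_im]
    ring

/-- The inverse of `rotArg ψ`. -/
noncomputable def rotInv (ψ : ℝ) (v : ℝ × ℝ) : ℝ × ℝ :=
  (cos ψ * v.1 - sin ψ * v.2, sin ψ * v.1 + cos ψ * v.2)

lemma rotInv_rotArg (ψ : ℝ) (a : ℝ × ℝ) : rotInv ψ (rotArg ψ a) = a := by
  have h := sin_sq_add_cos_sq ψ
  refine Prod.ext ?_ ?_
  · simp only [rotInv, rotArg]; linear_combination a.1 * h
  · simp only [rotInv, rotArg]; linear_combination a.2 * h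

lemma rotArg_rotInv (ψ : ℝ) (a : ℝ × ℝ) : rotArg ψ (rotInv ψ a) = a := by
  have h := sin_sq_add_cos_sq ψ
  refine Prod.ext ?_ ?_
  · simp only [rotInv, rotArg]; linear_combination a.1 * h
  · simp only [rotInv, rotArg]; linear_combination a.2 * h

lemma integral_comp_rotArg (ψ : ℝ) (γ F : ℝ × ℝ → ℝ) :
    ∫ a, γ a * F (rotArg ψ a) = ∫ v, γ (rotInv ψ v) * F v := by
  have hme : MeasurableEmbedding (rotArg ψ) := by
    have hc : Continuous (rotArg ψ) := by unfold rotArg; fun_prop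
    have hc' : Continuous (rotInv ψ) := by unfold rotInv; fun_prop
    let e : (ℝ × ℝ) ≃ₜ (ℝ × ℝ) := ⟨⟨rotArg ψ, rotInv ψ, rotInv_rotArg ψ, rotArg_rotInv ψ⟩, hc, hc'⟩
    exact e.measurableEmbedding
  have h := (measurePreserving_rotArg ψ).integral_comp hme fun v => γ (rotInv ψ v) * F v
  simpa only [rotInv_rotArg] using h

/-! ### Moments and weighted sums of the errors -/

section errors
variable {Ω : Type*} [MeasurableSpace Ω] {P : Measure Ω} [IsProbabilityMeasure P]
  {ν : Measure ℝ} {σ : ℝ} {ε : (n : ℕ) → Fin n × Fin n → Ω → ℝ}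

lemma ErrorAssumption.isProbabilityMeasure (hε : ErrorAssumption P ν σ ε) :
    IsProbabilityMeasure ν :=
  (hε.law 1 (0, 0)).isProbabilityMeasure_iff.1 inferInstance

lemma ErrorAssumption.integrable_sq (hε : ErrorAssumption P ν σ ε) :
    Integrable (fun e => e ^ 2) ν := by
  have := hε.isProbabilityMeasure
  refine ((integrable_const (1 : ℝ)).add hε.fifth_moment).mono' (by fun_prop) ?_
  refine Eventually.of_forall fun e => ?_
  have h0 := abs_nonneg e
  simp only [Pi.add_apply, norm_pow, Real.norm_eq_abs]
  rcases le_total |e| 1 with h | h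
  · have : |e| ^ 2 ≤ 1 := pow_le_one₀ h0 h
    have : 0 ≤ |e| ^ 5 := by positivity
    linarith
  · have : |e| ^ 2 ≤ |e| ^ 5 := pow_le_pow_right₀ h (by norm_num)
    linarith

lemma ErrorAssumption.memLp_two (hε : ErrorAssumption P ν σ ε) : MemLp (id : ℝ → ℝ) 2 ν :=
  (memLp_two_iff_integrable_sq (by fun_prop)).2 hε.integrable_sq

lemma ErrorAssumption.integrable (hε : ErrorAssumption P ν σ ε) : Integrable (fun e => e) ν := by
  have := hε.isProbabilityMeasure
  exact hε.memLp_two.integrable one_le_two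

omit [IsProbabilityMeasure P] in
lemma ErrorAssumption.aemeasurable (hε : ErrorAssumption P ν σ ε) (n : ℕ) (i : Fin n × Fin n) :
    AEMeasurable (ε n i) P := (hε.law n i).aemeasurable

lemma ErrorAssumption.integrable_error (hε : ErrorAssumption P ν σ ε) (n : ℕ)
    (i : Fin n × Fin n) : Integrable (ε n i) P := by
  have h := hε.integrable
  rw [← (hε.law n i).map_eq] at h
  exact h.comp_aemeasurable (hε.aemeasurable n i)

omit [IsProbabilityMeasure P] in
lemma ErrorAssumption.integral_error (hε : ErrorAssumption P ν σ ε) (n : ℕ)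
    (i : Fin n × Fin n) : ∫ ω, ε n i ω ∂P = 0 := by
  rw [(hε.law n i).integral_eq, hε.mean]

/-- Chebyshev's inequality for weighted sums of centred functions of the errors. -/
lemma ErrorAssumption.meas_weighted_sum_le (hε : ErrorAssumption P ν σ ε) {g : ℝ → ℝ}
    (hg : Measurable g) (hg2 : MemLp g 2 ν) (hg0 : ∫ e, g e ∂ν = 0) {n : ℕ}
    (c : Fin n × Fin n → ℝ) {s : ℝ} (hs : 0 < s) :
    P {ω | s ≤ |∑ i, c i * g (ε n i ω)|} ≤
      ENNReal.ofReal ((∫ e, g e ^ 2 ∂ν) * (∑ i, c i ^ 2) / s ^ 2) := by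
  have hp := hε.isProbabilityMeasure
  have hgL (i : Fin n × Fin n) : MemLp (fun ω => g (ε n i ω)) 2 P := by
    have h := hg2
    rw [← (hε.law n i).map_eq] at h
    exact h.comp_of_map (hε.aemeasurable n i)
  have hgm (i : Fin n × Fin n) : ∫ ω, g (ε n i ω) ∂P = 0 := by
    rw [← hg0, ← (hε.law n i).map_eq, integral_map (hε.aemeasurable n i) (by fun_prop)]
  have hgv (i : Fin n × Fin n) : ProbabilityTheory.variance (fun ω => g (ε n i ω)) P = ∫ e, g e ^ 2 ∂ν := by
    rw [variance_of_integral_eq_zero (hgL i).aemeasurable (hgm i), ← (hε.law n i).map_eq,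
      integral_map (hε.aemeasurable n i) (by fun_prop)]
  have hcL (i : Fin n × Fin n) : MemLp (fun ω => c i * g (ε n i ω)) 2 P := (hgL i).const_mul _
  have hsum : MemLp (fun ω => ∑ i, c i * g (ε n i ω)) 2 P := memLp_finsetSum _ fun i _ => hcL i
  have hmean : ∫ ω, ∑ i, c i * g (ε n i ω) ∂P = 0 := by
    rw [integral_finsetSum _ fun i _ => (hcL i).integrable one_le_two]
    exact Finset.sum_eq_zero fun i _ => by rw [integral_const_mul, hgm, mul_zero]
  have hind : iIndepFun (fun i ω => c i * g (ε n i ω)) P :=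
    (hε.indep n).comp (fun i e => c i * g e) fun i => by fun_prop
  have hvar : ProbabilityTheory.variance (fun ω => ∑ i, c i * g (ε n i ω)) P = (∫ e, g e ^ 2 ∂ν) * ∑ i, c i ^ 2 := by
    have h := IndepFun.variance_sum (s := Finset.univ) (X := fun i ω => c i * g (ε n i ω)) (μ := P)
      (fun i _ => hcL i) fun i _ j _ hij => hind.indepFun hij
    rw [show (∑ i, fun ω => c i * g (ε n i ω)) = fun ω => ∑ i, c i * g (ε n i ω) by
      ext ω; simp] at h
    rw [h, Finset.mul_sum]
    refine Finset.sum_congr rfl fun i _ => ?_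
    rw [variance_const_mul, hgv, mul_comm]
  have h := meas_ge_le_variance_div_sq hsum hs
  rwa [hvar, hmean, show {ω | s ≤ |∑ i, c i * g (ε n i ω) - 0|}
    = {ω | s ≤ |∑ i, c i * g (ε n i ω)|} by simp only [sub_zero]] at h

end errors

/-! ### Counting design points in a window -/

/-- The condition on `a` and `b` makes the right side nonnegative, which is needed when the interval
contains no integer. -/
lemma card_fin_mem_Icc_le (n : ℕ) {a b : ℝ} (hab : a ≤ b + 1) :
    ((Finset.univ.filter fun i : Fin n => a ≤ (i : ℝ) ∧ (i : ℝ) ≤ b).card : ℝ) ≤ b - a + 1 := by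
  have h1 : (Finset.univ.filter fun i : Fin n => a ≤ (i : ℝ) ∧ (i : ℝ) ≤ b).card
      ≤ (Finset.Icc ⌈a⌉ ⌊b⌋).card := by
    refine Finset.card_le_card_of_injOn (fun i : Fin n => ((i : ℕ) : ℤ)) ?_ ?_
    · intro i hi
      simp only [Finset.coe_filter, Finset.mem_univ, true_and, mem_ofPred_eq] at hi
      simp only [Finset.coe_Icc, mem_Icc]
      exact ⟨Int.ceil_le.2 (by exact_mod_cast hi.1), Int.le_floor.2 (by exact_mod_cast hi.2)⟩
    · intro i _ j _ hij
      exact Fin.ext (Int.ofNat_inj.1 hij)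
  rw [Int.card_Icc] at h1
  have h2 : ((Finset.univ.filter fun i : Fin n => a ≤ (i : ℝ) ∧ (i : ℝ) ≤ b).card : ℝ)
      ≤ ((⌊b⌋ + 1 - ⌈a⌉).toNat : ℝ) := by exact_mod_cast h1
  refine h2.trans ?_
  have h3 : ((⌊b⌋ + 1 - ⌈a⌉).toNat : ℝ) = ((max (⌊b⌋ + 1 - ⌈a⌉) 0 : ℤ) : ℝ) := by
    rw [← Int.toNat_eq_max]; norm_cast
  rw [h3]
  push_cast
  refine max_le ?_ (by linarith)
  linarith [Int.floor_le b, Int.le_ceil a]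

/-- The admissible indices lie in an interval of length `2 R n h + 1`; the 1 accounts for the
unknown position of the design point in its cell. They number at most `2 R n h + 2`, and `1 ≤ n h`
absorbs the constant. -/
lemma card_window_le {n : ℕ} {ξ : Fin n → ℝ}
    (hξ : ∀ i : Fin n, ξ i ∈ Icc ((i : ℝ) / n) ((i + 1) / n)) {h : ℝ} (hh : 0 < h)
    (h1 : 1 ≤ n * h) (z w : ℝ) {R : ℝ} (hR : 0 ≤ R) :
    ((Finset.univ.filter fun i : Fin n => |(z - ξ i) / h + w| ≤ R).card : ℝ)
      ≤ (2 * R + 2) * (n * h) := by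
  have hn : (0 : ℝ) < n := by
    rcases Nat.eq_zero_or_pos n with h0 | h0
    · simp [h0] at h1; linarith
    · exact_mod_cast h0
  have hsub : (Finset.univ.filter fun i : Fin n => |(z - ξ i) / h + w| ≤ R) ⊆
      Finset.univ.filter fun i : Fin n =>
        n * (z + h * w - h * R) - 1 ≤ (i : ℝ) ∧ (i : ℝ) ≤ n * (z + h * w + h * R) := by
    intro i hi
    simp only [Finset.mem_filter, Finset.mem_univ, true_and] at hi ⊢
    have e : (z - ξ i) / h + w = (z + h * w - ξ i) / h := by field_simp; ring
    rw [e, abs_div, abs_of_pos hh, div_le_iff₀ hh, abs_le] at hi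
    have h2 := hξ i
    rw [mem_Icc, div_le_iff₀ hn, le_div_iff₀ hn] at h2
    constructor <;> nlinarith
  have hnn : 0 ≤ n * h * R := by positivity
  refine (Nat.cast_le.2 (Finset.card_le_card hsub)).trans
    ((card_fin_mem_Icc_le n (by nlinarith)).trans ?_)
  nlinarith

lemma card_window_prod_le {n : ℕ} {ξ : Fin n → ℝ}
    (hξ : ∀ i : Fin n, ξ i ∈ Icc ((i : ℝ) / n) ((i + 1) / n)) {h : ℝ} (hh : 0 < h)
    (h1 : 1 ≤ n * h) (z : ℝ × ℝ) (w : ℝ) :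
    ((Finset.univ.filter fun i : Fin n × Fin n =>
      |(z.1 - ξ i.1) / h| ≤ 3 ∧ |(z.2 - ξ i.2) / h + w| ≤ 3).card : ℝ) ≤ 64 * (n * h) ^ 2 := by
  have e : (Finset.univ.filter fun i : Fin n × Fin n =>
      |(z.1 - ξ i.1) / h| ≤ 3 ∧ |(z.2 - ξ i.2) / h + w| ≤ 3) =
      (Finset.univ.filter fun i : Fin n => |(z.1 - ξ i) / h + 0| ≤ 3) ×ˢ
        Finset.univ.filter fun i : Fin n => |(z.2 - ξ i) / h + w| ≤ 3 := by
    ext i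
    simp
  rw [e, Finset.card_product]
  push_cast
  have a1 := card_window_le hξ hh h1 z.1 0 (R := 3) (by norm_num)
  have a2 := card_window_le hξ hh h1 z.2 w (R := 3) (by norm_num)
  calc _ ≤ ((2 * 3 + 2) * (n * h)) * ((2 * 3 + 2) * (n * h)) := by gcongr
    _ = _ := by ring

/-! ### Uniform law of large numbers on blocks -/

section block
variable {Ω : Type*} [MeasurableSpace Ω] {P : Measure Ω} [IsProbabilityMeasure P]
  {ν : Measure ℝ} {σ : ℝ} {ε : (n : ℕ) → Fin n × Fin n → Ω → ℝ} {ξ : (n : ℕ) → Fin n → ℝ}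

/-- One set of grid points, of radius 3 = 2 + 1 around the base shift `w₀`, serves all windows whose
shift is within distance 1 of `w₀`. -/
lemma IsWindow.window_of_ne_zero {f : ℝ → ℝ × ℝ → ℝ} (hf : IsWindow f) {ψ w w₀ : ℝ} {a : ℝ × ℝ}
    (hw : |w - w₀| ≤ 1) (h : f ψ (rotArg ψ (a.1, a.2 + w)) ≠ 0) :
    |a.1| ≤ 3 ∧ |a.2 + w₀| ≤ 3 := by
  have h2 := hf.norm_le_two h
  have h3 : |a.1| ≤ 2 := (le_max_left _ _).trans h2
  have h4 : |a.2 + w| ≤ 2 := (le_max_right _ _).trans h2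
  refine ⟨by linarith, ?_⟩
  rw [abs_le] at hw h4 ⊢
  constructor <;> linarith [h4.1, h4.2, hw.1, hw.2]

lemma IsWindow.sum_sq_le {f : ℝ → ℝ × ℝ → ℝ} (hf : IsWindow f) (hξ : RegularDesign ξ) {n : ℕ}
    {h : ℝ} (hh : 0 < h) (h1 : 1 ≤ n * h) (z : ℝ × ℝ) (w ψ : ℝ) {M : ℝ}
    (hM : ∀ v, |f ψ v| ≤ M) :
    ∑ i : Fin n × Fin n,
      f ψ (rotArg ψ ((z.1 - ξ n i.1) / h, (z.2 - ξ n i.2) / h + w)) ^ 2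
        ≤ 64 * (n * h) ^ 2 * M ^ 2 := by
  set S := Finset.univ.filter fun i : Fin n × Fin n =>
      |(z.1 - ξ n i.1) / h| ≤ 3 ∧ |(z.2 - ξ n i.2) / h + w| ≤ 3 with hS
  rw [← Finset.sum_subset (Finset.subset_univ S)]
  · refine (Finset.sum_le_card_nsmul S _ (M ^ 2) fun i _ => ?_).trans ?_
    · exact sq_le_sq' (by linarith [(abs_le.1 (hM (rotArg ψ
        ((z.1 - ξ n i.1) / h, (z.2 - ξ n i.2) / h + w)))).1]) (le_of_abs_le (hM _))
    · rw [nsmul_eq_mul]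
      gcongr
      exact card_window_prod_le (hξ n) hh h1 z w
  · intro i _ hi
    by_contra hne
    refine hi ?_
    simp only [hS, Finset.mem_filter, Finset.mem_univ, true_and]
    exact hf.window_of_ne_zero (w := w) (a := ((z.1 - ξ n i.1) / h, (z.2 - ξ n i.2) / h))
      (by rw [sub_self, abs_zero]; exact zero_le_one) fun h0 => hne (by rw [h0]; ring)

/-- Chebyshev's inequality for localized sums of the errors. -/
lemma ErrorAssumption.meas_localSum_le (hε : ErrorAssumption P ν σ ε) (hξ : RegularDesign ξ)
    {f : ℝ → ℝ × ℝ → ℝ} (hf : IsWindow f) {n : ℕ}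
    {h : ℝ} (hh : 0 < h) (h1 : 1 ≤ n * h) (z : ℝ × ℝ) (w ψ : ℝ) {M s : ℝ}
    (hM : ∀ v, |f ψ v| ≤ M) (hs : 0 < s) :
    P {ω | s ≤ |localSum (ξ n) h z (fun i => ε n i ω) f w ψ|} ≤
      ENNReal.ofReal (σ ^ 2 * (64 * M ^ 2) / s ^ 2 / (n * h) ^ 2) := by
  have hnh : 0 < n * h := by linarith
  have hc := hε.meas_weighted_sum_le measurable_id hε.memLp_two hε.mean (n := n)
    (fun i => f ψ (rotArg ψ ((z.1 - ξ n i.1) / h, (z.2 - ξ n i.2) / h + w)))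
    (s := s * (n * h) ^ 2) (by positivity)
  refine (measure_mono fun ω hω => ?_).trans (hc.trans (ENNReal.ofReal_le_ofReal ?_))
  · simp only [mem_ofPred_eq, localSum, abs_mul, abs_inv, abs_of_pos (pow_pos hnh 2)] at hω ⊢
    rw [inv_mul_eq_div, le_div_iff₀ (by positivity)] at hω
    simpa only [id, mul_comm] using hω
  · have := hf.sum_sq_le hξ hh h1 z w ψ hM
    simp only [id, hε.variance]
    calc _ ≤ σ ^ 2 * (64 * (n * h) ^ 2 * M ^ 2) / (s * (n * h) ^ 2) ^ 2 := by gcongr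
      _ = _ := by field_simp

/-- The localized sums of the errors are uniformly small on blocks of unit length, up to an event
whose probability is of the order `(n h)⁻²`. -/
theorem ErrorAssumption.exists_block_bound (hε : ErrorAssumption P ν σ ε) (hξ : RegularDesign ξ)
    {f : ℝ → ℝ × ℝ → ℝ} (hf : IsWindow f) {s : ℝ} (hs : 0 < s) :
    ∃ C, 0 ≤ C ∧ ∀ (n : ℕ) (h : ℝ) (_ : 0 < h) (_ : 1 ≤ n * h) (z : ℝ × ℝ) (w₀ : ℝ),
      P {ω | ∃ w ∈ Icc w₀ (w₀ + 1), ∃ ψ ∈ Icc (-(π / 2)) (π / 2),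
        s < |localSum (ξ n) h z (fun i => ε n i ω) f w ψ|} ≤ ENNReal.ofReal (C / (n * h) ^ 2) := by
  have hp := hε.isProbabilityMeasure
  obtain ⟨M, hM0, hM⟩ := hf.exists_bound (-(π / 2)) (π / 2)
  set m₁ := ∫ e, |e| ∂ν with hm₁
  set v₁ := ∫ e, (|e| - m₁) ^ 2 ∂ν with hv₁
  have hm0 : 0 ≤ m₁ := integral_nonneg fun e => abs_nonneg e
  have hv0 : 0 ≤ v₁ := integral_nonneg fun e => sq_nonneg _
  -- `B (n h)²` will bound the sum of `|ε|` over the block: at most `64 (n h)²` points with mean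
  -- `m₁`, plus a deviation of at most `(n h)²`.
  set B := 64 * m₁ + 1 with hB
  have hB0 : 0 < B := by positivity
  -- A modulus `s / (2 B)` makes the oscillation of the noise sum over a `δ`-ball at most `s / 2`.
  -- The radius 4 is the window radius 3 plus the length of the block.
  obtain ⟨δ, hδ0, hδ⟩ : ∃ δ > 0, ∀ ψ ∈ Icc (-(π / 2)) (π / 2), ∀ ψ' ∈ Icc (-(π / 2)) (π / 2),
      ∀ a a' : ℝ × ℝ, ‖a‖ ≤ 4 → ‖a'‖ ≤ 4 → |ψ - ψ'| < δ → ‖a - a'‖ < δ →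
        |f ψ (rotArg ψ a) - f ψ' (rotArg ψ' a')| ≤ s / (2 * B) := by
    have hK : IsCompact (Icc (-(π / 2)) (π / 2) ×ˢ Metric.closedBall (0 : ℝ × ℝ) 4) :=
      isCompact_Icc.prod (isCompact_closedBall _ _)
    have huc := hK.uniformContinuousOn_of_continuous hf.continuous_rot.continuousOn
    obtain ⟨δ, hδ0, hδ⟩ := Metric.uniformContinuousOn_iff_le.1 huc (s / (2 * B)) (by positivity)
    refine ⟨δ, hδ0, fun ψ hψ ψ' hψ' a a' ha ha' h1 h2 => ?_⟩
    refine hδ (ψ, a) ⟨hψ, mem_closedBall_zero_iff.2 ha⟩ (ψ', a')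
      ⟨hψ', mem_closedBall_zero_iff.2 ha'⟩ ?_
    rw [Prod.dist_eq, dist_eq_norm, dist_eq_norm]
    exact max_le h1.le h2.le
  -- The finite net lives in the offset from `w₀`, so its cardinality depends on neither `n` nor the
  -- block. Chebyshev's inequality is applied at each net point and once more to the sum of `|ε|`.
  obtain ⟨t, htsub, htfin, htcov⟩ := ((isCompact_Icc (a := (0 : ℝ)) (b := 1)).prod
    (isCompact_Icc (a := -(π / 2)) (b := π / 2))).finite_cover_balls hδ0
  lift t to Finset (ℝ × ℝ) using htfin
  set C₁ := σ ^ 2 * (64 * M ^ 2) / (s / 2) ^ 2 with hC₁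
  refine ⟨t.card * C₁ + v₁ * 64, by positivity, fun n h hh h1 z w₀ => ?_⟩
  have hnh : 0 < n * h := by linarith
  set W := Finset.univ.filter fun i : Fin n × Fin n =>
      |(z.1 - ξ n i.1) / h| ≤ 3 ∧ |(z.2 - ξ n i.2) / h + w₀| ≤ 3 with hW
  have hWc : (W.card : ℝ) ≤ 64 * (n * h) ^ 2 := card_window_prod_le (hξ n) hh h1 z w₀
  set E₀ : Set Ω := {ω | (n * h) ^ 2 ≤
    |∑ i, (if i ∈ W then 1 else 0 : ℝ) * (|ε n i ω| - m₁)|} with hE₀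
  set E : ℝ × ℝ → Set Ω := fun p =>
    {ω | s / 2 ≤ |localSum (ξ n) h z (fun i => ε n i ω) f (w₀ + p.1) p.2|} with hE
  have hPE₀ : P E₀ ≤ ENNReal.ofReal (v₁ * 64 / (n * h) ^ 2) := by
    have habs : MemLp (fun e : ℝ => |e|) 2 ν := hε.memLp_two.abs
    have := hε.meas_weighted_sum_le (g := fun e => |e| - m₁) (by fun_prop)
      (habs.sub (memLp_const _)) (by
        rw [integral_sub (habs.integrable one_le_two) (integrable_const _)]; simp [hm₁])
      (n := n) (fun i => if i ∈ W then 1 else 0) (s := (n * h) ^ 2) (by positivity)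
    refine this.trans (ENNReal.ofReal_le_ofReal ?_)
    have e : ∑ i, (if i ∈ W then 1 else 0 : ℝ) ^ 2 = W.card := by simp
    rw [e]
    calc _ ≤ v₁ * (64 * (n * h) ^ 2) / ((n * h) ^ 2) ^ 2 := by gcongr
      _ = _ := by field_simp
  have hPE (p : ℝ × ℝ) (hp : p ∈ t) : P (E p) ≤ ENNReal.ofReal (C₁ / (n * h) ^ 2) :=
    hε.meas_localSum_le hξ hf hh h1 z _ _ (hM _ (htsub hp).2) (half_pos hs)
  have hsub : {ω | ∃ w ∈ Icc w₀ (w₀ + 1), ∃ ψ ∈ Icc (-(π / 2)) (π / 2),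
      s < |localSum (ξ n) h z (fun i => ε n i ω) f w ψ|} ⊆ (⋃ p ∈ t, E p) ∪ E₀ := by
    rintro ω ⟨w, hw, ψ, hψ, hlt⟩
    by_contra hω
    simp only [mem_union, mem_iUnion, not_or, not_exists] at hω
    have hmem : (w - w₀, ψ) ∈ Icc (0 : ℝ) 1 ×ˢ Icc (-(π / 2)) (π / 2) :=
      ⟨⟨by linarith [hw.1], by linarith [hw.2]⟩, hψ⟩
    obtain ⟨p, hpt, hpd⟩ := mem_iUnion₂.1 (htcov hmem)
    have hEp := hω.1 p hpt
    simp only [hE, mem_ofPred_eq, not_le] at hEp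
    have hE0 := hω.2
    simp only [hE₀, mem_ofPred_eq, not_le] at hE0
    rw [Metric.mem_ball, Prod.dist_eq, max_lt_iff, Real.dist_eq, Real.dist_eq] at hpd
    have hp1 := (htsub hpt).1
    have hp2 := (htsub hpt).2
    have hT : ∑ i ∈ W, |ε n i ω| ≤ B * (n * h) ^ 2 := by
      have e : ∑ i, (if i ∈ W then 1 else 0 : ℝ) * (|ε n i ω| - m₁)
          = ∑ i ∈ W, |ε n i ω| - W.card * m₁ := by
        simp only [ite_mul, one_mul, zero_mul, Finset.sum_ite_mem, Finset.univ_inter,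
          Finset.sum_sub_distrib, Finset.sum_const, nsmul_eq_mul]
      rw [e] at hE0
      have := lt_of_abs_lt hE0
      have : W.card * m₁ ≤ 64 * (n * h) ^ 2 * m₁ := by gcongr
      rw [hB]; linarith
    have hterm : ∀ i : Fin n × Fin n,
        |ε n i ω * f ψ (rotArg ψ ((z.1 - ξ n i.1) / h, (z.2 - ξ n i.2) / h + w)) -
          ε n i ω * f p.2 (rotArg p.2 ((z.1 - ξ n i.1) / h, (z.2 - ξ n i.2) / h + (w₀ + p.1)))|
        ≤ if i ∈ W then |ε n i ω| * (s / (2 * B)) else 0 := by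
      intro i
      split_ifs with hi
      · simp only [hW, Finset.mem_filter, Finset.mem_univ, true_and, abs_le] at hi
        rw [← mul_sub, abs_mul]
        gcongr
        refine hδ ψ hψ p.2 hp2 _ _ ?_ ?_ hpd.2 ?_
        · refine max_le ?_ ?_ <;> simp only [Real.norm_eq_abs, abs_le] <;> constructor <;>
            linarith [hi.1.1, hi.1.2, hi.2.1, hi.2.2, hw.1, hw.2]
        · refine max_le ?_ ?_ <;> simp only [Real.norm_eq_abs, abs_le] <;> constructor <;>
            linarith [hi.1.1, hi.1.2, hi.2.1, hi.2.2, hp1.1, hp1.2]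
        · refine max_lt ?_ ?_
          · simpa using hδ0
          · simp only [Real.norm_eq_abs, Prod.snd_sub]
            convert hpd.1 using 2
            ring
      · have z1 : f ψ (rotArg ψ ((z.1 - ξ n i.1) / h, (z.2 - ξ n i.2) / h + w)) = 0 := by
          by_contra hne
          refine hi ?_
          simp only [hW, Finset.mem_filter, Finset.mem_univ, true_and]
          exact hf.window_of_ne_zero (a := ((z.1 - ξ n i.1) / h, (z.2 - ξ n i.2) / h))
            (abs_le.2 ⟨by linarith [hw.1], by linarith [hw.2]⟩) hne
        have z2 : f p.2 (rotArg p.2 ((z.1 - ξ n i.1) / h, (z.2 - ξ n i.2) / h + (w₀ + p.1))) = 0 := by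
          by_contra hne
          refine hi ?_
          simp only [hW, Finset.mem_filter, Finset.mem_univ, true_and]
          exact hf.window_of_ne_zero (a := ((z.1 - ξ n i.1) / h, (z.2 - ξ n i.2) / h))
            (abs_le.2 ⟨by linarith [hp1.1], by linarith [hp1.2]⟩) hne
        rw [z1, z2]; simp
    have hdiff : |localSum (ξ n) h z (fun i => ε n i ω) f w ψ -
        localSum (ξ n) h z (fun i => ε n i ω) f (w₀ + p.1) p.2| ≤ s / 2 := by
      unfold localSum
      rw [← mul_sub, ← Finset.sum_sub_distrib, abs_mul, abs_inv, abs_of_pos (pow_pos hnh 2),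
        inv_mul_le_iff₀ (by positivity)]
      refine (Finset.abs_sum_le_sum_abs _ _).trans ((Finset.sum_le_sum fun i _ => hterm i).trans ?_)
      rw [Finset.sum_ite_mem, Finset.univ_inter, ← Finset.sum_mul]
      calc _ ≤ B * (n * h) ^ 2 * (s / (2 * B)) := by gcongr
        _ = _ := by field_simp
    have := abs_sub_abs_le_abs_sub (localSum (ξ n) h z (fun i => ε n i ω) f w ψ)
      (localSum (ξ n) h z (fun i => ε n i ω) f (w₀ + p.1) p.2)
    linarith
  calc _ ≤ P ((⋃ p ∈ t, E p) ∪ E₀) := measure_mono hsub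
    _ ≤ P (⋃ p ∈ t, E p) + P E₀ := measure_union_le _ _
    _ ≤ ∑ p ∈ t, P (E p) + P E₀ := by gcongr; exact measure_biUnion_finset_le _ _
    _ ≤ ∑ p ∈ t, ENNReal.ofReal (C₁ / (n * h) ^ 2) + ENNReal.ofReal (v₁ * 64 / (n * h) ^ 2) := by
        gcongr with p hp
        exact hPE p hp
    _ = ENNReal.ofReal ((t.card * C₁ + v₁ * 64) / (n * h) ^ 2) := by
        rw [Finset.sum_const, nsmul_eq_mul, add_div, ENNReal.ofReal_add (by positivity)
          (by positivity), mul_div_assoc (t.card : ℝ) C₁,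
          ENNReal.ofReal_mul (Nat.cast_nonneg t.card), ENNReal.ofReal_natCast]

end block

/-! ### A central limit theorem for weighted sums of the errors -/

/-- Telescoping: the factors are exchanged one at a time, and all the others have norm at most 1. -/
lemma norm_prod_sub_prod_le {ι : Type*} (s : Finset ι) (a b : ι → ℂ) (ha : ∀ i, ‖a i‖ ≤ 1)
    (hb : ∀ i, ‖b i‖ ≤ 1) : ‖∏ i ∈ s, a i - ∏ i ∈ s, b i‖ ≤ ∑ i ∈ s, ‖a i - b i‖ := by
  classical
  induction s using Finset.induction_on with
  | empty => simp
  | insert j s hj ih =>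
    rw [Finset.prod_insert hj, Finset.prod_insert hj, Finset.sum_insert hj]
    have e : a j * ∏ i ∈ s, a i - b j * ∏ i ∈ s, b i =
        (a j - b j) * ∏ i ∈ s, a i + b j * (∏ i ∈ s, a i - ∏ i ∈ s, b i) := by ring
    have hp : ‖∏ i ∈ s, a i‖ ≤ 1 := by
      rw [norm_prod]
      exact Finset.prod_le_one (fun i _ => norm_nonneg _) fun i _ => ha i
    rw [e]
    refine (norm_add_le _ _).trans ?_
    rw [norm_mul, norm_mul]
    have h1 : ‖a j - b j‖ * ‖∏ i ∈ s, a i‖ ≤ ‖a j - b j‖ * 1 := by gcongr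
    have h2 : ‖b j‖ * ‖∏ i ∈ s, a i - ∏ i ∈ s, b i‖ ≤ 1 * ‖∏ i ∈ s, a i - ∏ i ∈ s, b i‖ := by
      gcongr
      exact hb j
    linarith

/-- Both functions have the second-order expansion `1 - σ² t² / 2 + o(t²)` at 0. -/
lemma charFun_sub_exp_isLittleO {ν : Measure ℝ} [IsProbabilityMeasure ν] {σ : ℝ}
    (h2 : MemLp id 2 ν) (h0 : ∫ e, e ∂ν = 0) (hσ : ∫ e, e ^ 2 ∂ν = σ ^ 2) :
    (fun t : ℝ => charFun ν t - Complex.exp (-(σ ^ 2 * t ^ 2 / 2 : ℝ))) =o[𝓝 0]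
      fun t : ℝ => t ^ 2 := by
  have h1 : (fun t : ℝ => charFun ν t - (1 - (σ ^ 2 * t ^ 2 / 2 : ℝ) : ℂ)) =o[𝓝 0]
      fun t : ℝ => t ^ 2 := by
    have hT := taylor_isLittleO_univ (x₀ := 0) (n := 2) (contDiff_charFun (μ := ν) (n := 2) h2)
    have e (t : ℝ) : taylorWithinEval (charFun ν) 2 univ 0 t
        = (1 - (σ ^ 2 * t ^ 2 / 2 : ℝ) : ℂ) := by
      rw [taylorWithinEval_charFun_zero h2]
      simp only [Finset.sum_range_succ, Finset.range_zero, Finset.sum_empty, pow_zero, pow_one, hσ,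
        h0, Nat.factorial]
      rw [mul_pow, Complex.I_sq]
      simp
      ring
    simpa only [e, sub_zero] using hT
  have h3 : (fun t : ℝ => Complex.exp (-(σ ^ 2 * t ^ 2 / 2 : ℝ)) - (1 - (σ ^ 2 * t ^ 2 / 2 : ℝ) : ℂ))
      =o[𝓝 0] fun t : ℝ => t ^ 2 := by
    have hd : HasDerivAt (fun s : ℝ => Complex.exp (-(σ ^ 2 / 2 : ℝ) * s)) (-(σ ^ 2 / 2 : ℝ)) 0 := by
      have h : HasDerivAt (fun s : ℝ => ((-(σ ^ 2 / 2 : ℝ) : ℂ)) * (s : ℂ)) (-(σ ^ 2 / 2 : ℝ)) 0 := by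
        exact ((Complex.ofRealCLM.hasDerivAt (x := (0 : ℝ))).const_mul
          (-(σ ^ 2 / 2 : ℝ) : ℂ)).congr_deriv (by simp)
      simpa using h.cexp
    rw [hasDerivAt_iff_isLittleO] at hd
    have ht : Tendsto (fun t : ℝ => t ^ 2) (𝓝 0) (𝓝 0) := by
      simpa using (continuous_pow 2).tendsto (0 : ℝ)
    have := hd.comp_tendsto ht
    simp only [Function.comp_def, sub_zero] at this
    refine this.congr_left fun t => ?_
    simp
    ring_nf
  exact (h1.sub h3).congr_left fun t => by ring

section clt
variable {Ω : Type*} [MeasurableSpace Ω] {P : Measure Ω} [IsProbabilityMeasure P]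
  {ν : Measure ℝ} {σ : ℝ} {ε : (n : ℕ) → Fin n × Fin n → Ω → ℝ}
  {E : Type*} [NormedAddCommGroup E] [InnerProductSpace ℝ E] [FiniteDimensional ℝ E]
  [MeasurableSpace E] [BorelSpace E]

omit [IsProbabilityMeasure P] in
lemma ErrorAssumption.charFun_sum (hε : ErrorAssumption P ν σ ε) {n : ℕ} (c : Fin n × Fin n → E)
    (t : E) : charFun (P.map fun ω => ∑ i, ε n i ω • c i) t = ∏ i, charFun ν (inner ℝ (c i) t) := by
  have hind : iIndepFun (fun i ω => ε n i ω • c i) P :=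
    (hε.indep n).comp (fun i e => e • c i) fun i => by fun_prop
  have hm (i : Fin n × Fin n) : AEMeasurable (fun ω => ε n i ω • c i) P :=
    (hε.aemeasurable n i).smul_const _
  rw [hind.charFun_map_fun_sum_eq_prod hm, Finset.prod_apply]
  refine Finset.prod_congr rfl fun i _ => ?_
  rw [charFun_apply, charFun_apply_real, integral_map (hm i) (by fun_prop), ← (hε.law n i).map_eq,
    integral_map (hε.aemeasurable n i) (by fun_prop)]
  refine integral_congr_ae (Eventually.of_forall fun ω => ?_)
  simp only [real_inner_smul_left]
  push_cast
  congr 1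
  ring

/-- The central limit theorem for weighted sums of the errors. -/
theorem ErrorAssumption.tendstoInDistribution_sum (hε : ErrorAssumption P ν σ ε)
    (c : (n : ℕ) → Fin n × Fin n → E) {b : ℕ → ℝ} (hb : Tendsto b atTop (𝓝 0))
    (hcb : ∀ᶠ n in atTop, ∀ i, ‖c n i‖ ≤ b n) {Q : E → ℝ}
    (hQ : ∀ t, Tendsto (fun n => ∑ i, inner ℝ (c n i) t ^ 2) atTop (𝓝 (Q t)))
    {μ : Measure E} [IsProbabilityMeasure μ]
    (hμ : ∀ t, charFun μ t = Complex.exp (-(σ ^ 2 * Q t / 2 : ℝ))) :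
    TendstoInDistribution (fun n ω => ∑ i, ε n i ω • c n i) atTop id (fun _ => P) μ where
  forall_aemeasurable n := by
    have := hε.aemeasurable n
    fun_prop
  tendsto := by
    have hp := hε.isProbabilityMeasure
    refine ProbabilityMeasure.tendsto_iff_tendsto_charFun.2 fun t => ?_
    simp only [ProbabilityMeasure.coe_mk, Measure.map_id, hμ, hε.charFun_sum]
    have h1 : Tendsto (fun n => Complex.exp (-(σ ^ 2 * (∑ i, inner ℝ (c n i) t ^ 2) / 2 : ℝ)))
        atTop (𝓝 (Complex.exp (-(σ ^ 2 * Q t / 2 : ℝ)))) := by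
      have : Continuous fun q : ℝ => Complex.exp (-(σ ^ 2 * q / 2 : ℝ)) := by fun_prop
      exact (this.tendsto _).comp (hQ t)
    -- It suffices to compare the product of characteristic functions with the Gaussian product of
    -- the same variance. The weights are uniformly small, so each factor contributes at most `δ /
    -- (2 D)` times its squared weight, and `D` bounds the sum of the squares.
    refine (tendsto_iff_of_dist ?_).2 h1
    have hLO := charFun_sub_exp_isLittleO hε.memLp_two hε.mean hε.variance
    rw [Metric.tendsto_atTop]
    intro δ hδ
    set D := |Q t| + 1 with hD
    have hD0 : 0 < D := by positivity
    have hev := hLO.def (c := δ / (2 * D)) (by positivity)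
    obtain ⟨r, hr, hr2⟩ := Metric.eventually_nhds_iff.1 hev
    have hbt : Tendsto (fun n => b n * ‖t‖) atTop (𝓝 0) := by simpa using hb.mul_const ‖t‖
    have hfin := (((hQ t).eventually (gt_mem_nhds (show Q t < D by
      rw [hD]; linarith [le_abs_self (Q t)]))).and (hcb.and (hbt.eventually (gt_mem_nhds hr))))
    obtain ⟨n₀, hn₀⟩ := eventually_atTop.1 hfin
    refine ⟨n₀, fun n hn => ?_⟩
    obtain ⟨hq, hc, hbn⟩ := hn₀ n hn
    rw [Real.dist_eq, sub_zero, abs_of_nonneg dist_nonneg, dist_eq_norm]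
    have e : Complex.exp (-(σ ^ 2 * (∑ i, inner ℝ (c n i) t ^ 2) / 2 : ℝ)) =
        ∏ i, Complex.exp (-(σ ^ 2 * inner ℝ (c n i) t ^ 2 / 2 : ℝ)) := by
      rw [← Complex.exp_sum]
      congr 1
      push_cast
      rw [Finset.sum_neg_distrib, Finset.mul_sum, Finset.sum_div]
    rw [e]
    have hterm (i : Fin n × Fin n) : ‖charFun ν (inner ℝ (c n i) t) -
        Complex.exp (-(σ ^ 2 * inner ℝ (c n i) t ^ 2 / 2 : ℝ))‖ ≤
          δ / (2 * D) * inner ℝ (c n i) t ^ 2 := by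
      have hlt : dist (inner ℝ (c n i) t) 0 < r := by
        rw [Real.dist_eq, sub_zero]
        refine (abs_real_inner_le_norm _ _).trans_lt (lt_of_le_of_lt ?_ hbn)
        gcongr
        exact hc i
      have := hr2 hlt
      rwa [Real.norm_of_nonneg (sq_nonneg _)] at this
    have hexp (i : Fin n × Fin n) :
        ‖Complex.exp (-(σ ^ 2 * inner ℝ (c n i) t ^ 2 / 2 : ℝ))‖ ≤ 1 := by
      rw [← Complex.ofReal_neg, Complex.norm_exp_ofReal, Real.exp_le_one_iff]
      have : 0 ≤ σ ^ 2 * inner ℝ (c n i) t ^ 2 / 2 := by positivity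
      linarith
    calc _ ≤ ∑ i, ‖charFun ν (inner ℝ (c n i) t) -
        Complex.exp (-(σ ^ 2 * inner ℝ (c n i) t ^ 2 / 2 : ℝ))‖ :=
          norm_prod_sub_prod_le _ _ _ (fun i => norm_charFun_le_one _) hexp
      _ ≤ ∑ i, δ / (2 * D) * inner ℝ (c n i) t ^ 2 := Finset.sum_le_sum fun i _ => hterm i
      _ = δ / (2 * D) * ∑ i, inner ℝ (c n i) t ^ 2 := by rw [Finset.mul_sum]
      _ ≤ δ / (2 * D) * D := by gcongr
      _ < δ := by field_simp; linarith

end clt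

/-! ### Consequences of the bandwidth condition -/

/-- For `n ≥ 3` the logarithmic factor is at least 1, so `h ≥ C₁ / √n`. This gives `n h ≥ C₁ √n` and
`n² h³ ≥ C₁³ √n`; the latter is what the union bound over `O(1 / h)` blocks requires. -/
lemma BandwidthAssumption.asymptotics {h : ℕ → ℝ} (hb : BandwidthAssumption h) :
    (∀ᶠ n in atTop, 0 < h n) ∧ Tendsto h atTop (𝓝 0) ∧ Tendsto (fun n => n * h n) atTop atTop ∧
      Tendsto (fun n => (n * h n) ^ 2 * h n) atTop atTop := by
  obtain ⟨C₁, C₂, η, hC₁, hC₂, hη, hev⟩ := hb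
  have hlow : ∀ᶠ n : ℕ in atTop, 0 < (n : ℝ) ∧ C₁ / (n : ℝ) ^ (1 / 2 : ℝ) ≤ h n := by
    filter_upwards [hev, eventually_ge_atTop 3] with n hn hn3
    have hn3' : (3 : ℝ) ≤ n := by exact_mod_cast hn3
    refine ⟨by linarith, le_trans ?_ hn.1⟩
    have hlog : 1 ≤ Real.log n := by
      rw [Real.le_log_iff_exp_le (by linarith)]
      linarith [Real.exp_one_lt_d9]
    have : 1 ≤ Real.log n ^ η := Real.one_le_rpow hlog (by linarith)
    gcongr
    nlinarith
  have hpow (n : ℕ) (hn : 0 < (n : ℝ)) : (n : ℝ) ^ (1 / 2 : ℝ) = √n := by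
    rw [Real.sqrt_eq_rpow]
  have hsq : Tendsto (fun n : ℕ => √(n : ℝ)) atTop atTop :=
    Real.tendsto_sqrt_atTop.comp tendsto_natCast_atTop_atTop
  refine ⟨?_, ?_, ?_, ?_⟩
  · filter_upwards [hlow] with n hn
    have := hn.1
    exact lt_of_lt_of_le (by positivity) hn.2
  · have h1 : Tendsto (fun n : ℕ => C₂ / (n : ℝ) ^ (1 / 3 : ℝ)) atTop (𝓝 0) :=
      ((tendsto_rpow_atTop (by norm_num)).comp tendsto_natCast_atTop_atTop).const_div_atTop C₂
    refine squeeze_zero' ?_ (hev.mono fun n hn => hn.2) h1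
    filter_upwards [hlow] with n hn
    have := hn.1
    exact le_trans (by positivity) hn.2
  · refine tendsto_atTop_mono' _ ?_ (hsq.const_mul_atTop hC₁)
    filter_upwards [hlow] with n hn
    have h0 := hn.1
    have h1 := hn.2
    rw [hpow n h0] at h1
    have h2 : 0 < √(n : ℝ) := Real.sqrt_pos.2 h0
    rw [div_le_iff₀ h2] at h1
    nlinarith [Real.mul_self_sqrt h0.le]
  · refine tendsto_atTop_mono' _ ?_ (hsq.const_mul_atTop (pow_pos hC₁ 3))
    filter_upwards [hlow] with n hn
    have h0 := hn.1
    have h1 := hn.2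
    rw [hpow n h0] at h1
    have h2 : 0 < √(n : ℝ) := Real.sqrt_pos.2 h0
    have h3 : (C₁ / √(n : ℝ)) ^ 3 ≤ h n ^ 3 := by gcongr
    have e : (n : ℝ) ^ 2 * (C₁ / √(n : ℝ)) ^ 3 = C₁ ^ 3 * √(n : ℝ) := by
      have : (n : ℝ) = √n ^ 2 := (Real.sq_sqrt h0.le).symm
      rw [div_pow]
      nth_rewrite 1 [this]
      field_simp
    calc _ = (n : ℝ) ^ 2 * (C₁ / √(n : ℝ)) ^ 3 := e.symm
      _ ≤ (n : ℝ) ^ 2 * h n ^ 3 := by gcongr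
      _ = _ := by ring

/-! ### Limits of the deterministic contrast and of its derivatives -/

section det
variable {m : ℝ × ℝ → ℝ} {τ φ : ℝ → ℝ} {x : ℝ}

lemma SmoothnessAssumption.exists_bound (hs : SmoothnessAssumption m τ φ) :
    ∃ C, ∀ p : ℝ × ℝ, p.1 ∈ Icc (0 : ℝ) 1 → p.2 ∈ Icc (0 : ℝ) 1 → |jumpImage m τ φ p.1 p.2| ≤ C := by
  obtain ⟨C₁, h₁⟩ := ((isCompact_Icc (a := (0 : ℝ)) (b := 1)).prod
    (isCompact_Icc (a := (0 : ℝ)) (b := 1))).exists_bound_of_continuousOn hs.smooth_m.continuousOn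
  obtain ⟨C₂, h₂⟩ := (isCompact_Icc (a := (0 : ℝ)) (b := 1)).exists_bound_of_continuousOn
    hs.smooth_τ.continuousOn
  refine ⟨C₁ + C₂, fun p hp1 hp2 => (abs_add_le _ _).trans (add_le_add (h₁ p ⟨hp1, hp2⟩) ?_)⟩
  rw [abs_mul]
  refine le_trans (mul_le_of_le_one_right (abs_nonneg _) ?_) (h₂ p.1 hp1)
  unfold indicator
  split_ifs <;> simp

lemma SmoothnessAssumption.hasDerivAt (hs : SmoothnessAssumption m τ φ) (hx : x ∈ Ioo (0 : ℝ) 1) :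
    HasDerivAt φ (deriv φ x) x :=
  ((hs.smooth_φ.contDiffAt (Icc_mem_nhds hx.1 hx.2)).differentiableAt (by norm_num)).hasDerivAt

variable {ι : Type*} {L : Filter ι}

/-- In local coordinates the curve straightens to its tangent. The sign comes from the convention
that the local coordinate `b` stands for the point `x - H b`. -/
lemma tendsto_slope_local (hs : SmoothnessAssumption m τ φ) (hx : x ∈ Ioo (0 : ℝ) 1) {H : ι → ℝ}
    (hH : ∀ᶠ k in L, 0 < H k) (hH0 : Tendsto H L (𝓝 0)) {b : ι → ℝ} {a : ℝ}
    (hb : Tendsto b L (𝓝 a)) :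
    Tendsto (fun k => (φ (x - H k * b k) - φ x) / H k) L (𝓝 (-deriv φ x * a)) := by
  have hd := hs.hasDerivAt hx
  rw [hasDerivAt_iff_isLittleO] at hd
  have hp : Tendsto (fun k => x - H k * b k) L (𝓝 x) := by
    simpa using (hH0.mul hb).const_sub x
  have h1 := hd.comp_tendsto hp
  have h2 : (fun k => x - H k * b k - x) =O[L] H := by
    have := (Asymptotics.isBigO_refl H L).mul (hb.isBigO_one ℝ)
    simpa using this
  have h3 := (h1.trans_isBigO h2).tendsto_div_nhds_zero
  have h4 := h3.add (hb.const_mul (-deriv φ x))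
  rw [zero_add] at h4
  refine h4.congr' ?_
  filter_upwards [hH] with k hk
  simp only [Function.comp, smul_eq_mul]
  field_simp
  ring

variable [L.IsCountablyGenerated] {ξ : (n : ℕ) → Fin n → ℝ} {h : ℕ → ℝ}

/-- The limit of localized sums of the image, for a given limit `J` of the jump indicator in local
coordinates. -/
lemma tendsto_localSum_jumpImage (hs : SmoothnessAssumption m τ φ) (hx : x ∈ Ioo (0 : ℝ) 1)
    (hξ : RegularDesign ξ) (hb : BandwidthAssumption h) {N : ι → ℕ} (hN : Tendsto N L atTop)
    {w ψ : ι → ℝ} {ψ₀ y : ℝ} (hψ : Tendsto ψ L (𝓝 ψ₀))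
    (hy : Tendsto (fun k => φ x + h (N k) * w k) L (𝓝 y)) (hy01 : y ∈ Icc (0 : ℝ) 1)
    (hin : ∀ a : ℝ × ℝ, a.1 ^ 2 + a.2 ^ 2 < 2 → ∀ᶠ k in L,
      φ x + h (N k) * w k - h (N k) * a.2 ∈ Ioo (0 : ℝ) 1)
    {J : ℝ × ℝ → ℝ}
    (hJ : ∀ᵐ a : ℝ × ℝ, ∀ b : ι → ℝ × ℝ, Tendsto b L (𝓝 a) → ∀ᶠ k in L,
      (if w k - (b k).2 ≤ (φ (x - h (N k) * (b k).1) - φ x) / h (N k) then 1 else 0) = J a)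
    {f : ℝ → ℝ × ℝ → ℝ} (hf : IsWindow f) :
    Tendsto (fun k => localSum (ξ (N k)) (h (N k)) (x, φ x)
      (fun i => jumpImage m τ φ (ξ (N k) i.1) (ξ (N k) i.2)) f (w k) (ψ k)) L
      (𝓝 (∫ a, (m (x, y) + τ x * J a) * f ψ₀ (rotArg ψ₀ a))) := by
  obtain ⟨hpos, h0, hnh, -⟩ := hb.asymptotics
  have hH := hN.eventually hpos
  have hH0 := h0.comp hN
  obtain ⟨C, hC⟩ := hs.exists_bound
  refine tendsto_localSum (g := fun _ p => jumpImage m τ φ p.1 p.2) hξ hf hH (hnh.comp hN) hψ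
    (fun _ p hp1 hp2 => hC p hp1 hp2) ?_ ?_
  · intro a ha
    have h1 : Tendsto (fun k => x - h (N k) * a.1) L (𝓝 x) := by
      simpa using (hH0.mul_const a.1).const_sub x
    filter_upwards [h1 (Ioo_mem_nhds hx.1 hx.2), hin a ha] with k hk1 hk2 using ⟨hk1, hk2⟩
  · filter_upwards [hJ] with a ha b hba hbox
    have hb1 : Tendsto (fun k => (b k).1) L (𝓝 a.1) := (continuous_fst.tendsto a).comp hba
    have hb2 : Tendsto (fun k => (b k).2) L (𝓝 a.2) := (continuous_snd.tendsto a).comp hba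
    have hp1 : Tendsto (fun k => x - h (N k) * (b k).1) L (𝓝 x) := by
      simpa using (hH0.mul hb1).const_sub x
    have hp2 : Tendsto (fun k => φ x + h (N k) * w k - h (N k) * (b k).2) L (𝓝 y) := by
      simpa using hy.sub (hH0.mul hb2)
    have hmc : ContinuousWithinAt m (Icc 0 1 ×ˢ Icc 0 1) (x, y) :=
      hs.smooth_m.continuousOn (x, y) ⟨Ioo_subset_Icc_self hx, hy01⟩
    have hml := hmc.tendsto.comp (tendsto_nhdsWithin_iff.2 ⟨hp1.prodMk_nhds hp2,
      hbox.mono fun k hk => ⟨hk.1, hk.2⟩⟩)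
    have hτc : ContinuousAt τ x :=
      hs.smooth_τ.continuousOn.continuousAt (Icc_mem_nhds hx.1 hx.2)
    have hτl := hτc.tendsto.comp hp1
    refine Tendsto.congr' ?_ (hml.add (hτl.mul_const (J a)))
    filter_upwards [hbox, ha b hba, hH] with k hk hJk hhk
    simp only [Function.comp, jumpImage]
    rw [← hJk]
    congr 2
    by_cases hle : w k - (b k).2 ≤ (φ (x - h (N k) * (b k).1) - φ x) / h (N k)
    · rw [if_pos hle, indicator_of_mem]
      rw [le_div_iff₀ hhk] at hle
      exact ⟨hk.2.1, by linarith⟩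
    · rw [if_neg hle, indicator_of_notMem]
      rw [le_div_iff₀ hhk] at hle
      exact fun hm => hle (by linarith [hm.2])

/-- Off the limiting jump line the indicators are eventually constant; the line itself is a null set
because each vertical section is a point. -/
lemma ae_off_line (c w : ℝ) : ∀ᵐ a : ℝ × ℝ, w - a.2 ≠ c * a.1 := by
  rw [ae_iff]
  simp only [ne_eq, not_not]
  have hm : MeasurableSet {a : ℝ × ℝ | w - a.2 = c * a.1} :=
    measurableSet_eq_fun (by fun_prop) (by fun_prop)
  rw [Measure.volume_eq_prod, Measure.measure_prod_null hm]
  refine Eventually.of_forall fun t => ?_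
  have : (Prod.mk t ⁻¹' {a : ℝ × ℝ | w - a.2 = c * a.1}) ⊆ {w - c * t} := by
    intro u hu
    simp only [mem_preimage, mem_ofPred_eq] at hu
    rw [mem_singleton_iff]
    linarith
  exact measure_mono_null this (by simp)

/-- The limiting half-plane on which the image jumps, in rotated local coordinates. -/
def jumpRegion (c δ w : ℝ) : Set (ℝ × ℝ) := {v | w * c ≤ sin δ * v.1 + cos δ * v.2}

lemma measurableSet_jumpRegion (c δ w : ℝ) : MeasurableSet (jumpRegion c δ w) :=
  measurableSet_le (by fun_prop) (by fun_prop)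

/-- Multiplying by `cos (slopeAngle φ x) > 0` turns the slope into a sine and a cosine, and the
addition formulas leave only the angular error `ψ - slopeAngle φ x`. -/
lemma rotInv_mem_jumpRegion (w ψ : ℝ) (v : ℝ × ℝ) :
    w - (rotInv ψ v).2 ≤ -deriv φ x * (rotInv ψ v).1 ↔
      v ∈ jumpRegion (cos (slopeAngle φ x)) (ψ - slopeAngle φ x) w := by
  have hc : 0 < cos (slopeAngle φ x) := Real.cos_arctan_pos _
  have ht : deriv φ x = sin (slopeAngle φ x) / cos (slopeAngle φ x) := by
    rw [← Real.tan_eq_sin_div_cos, slopeAngle, Real.tan_arctan]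
  rw [jumpRegion, mem_ofPred_eq, sin_sub, cos_sub, ht]
  simp only [rotInv]
  rw [sub_le_iff_le_add, ← mul_le_mul_iff_left₀ hc]
  refine ⟨fun hle => hle.trans_eq ?_, fun hle => hle.trans_eq ?_⟩ <;> field_simp <;> ring

/-- The limit of localized sums of the image at a bounded rescaled shift. -/
lemma tendsto_localSum_of_tendsto (hs : SmoothnessAssumption m τ φ) (hx : x ∈ Ioo (0 : ℝ) 1)
    (hξ : RegularDesign ξ) (hb : BandwidthAssumption h) {N : ι → ℕ} (hN : Tendsto N L atTop)
    {w ψ : ι → ℝ} {ψ₀ w₀ : ℝ} (hψ : Tendsto ψ L (𝓝 ψ₀)) (hw : Tendsto w L (𝓝 w₀))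
    {f : ℝ → ℝ × ℝ → ℝ} (hf : IsWindow f) :
    Tendsto (fun k => localSum (ξ (N k)) (h (N k)) (x, φ x)
      (fun i => jumpImage m τ φ (ξ (N k) i.1) (ξ (N k) i.2)) f (w k) (ψ k)) L
      (𝓝 (∫ v, (m (x, φ x) + τ x * (jumpRegion (cos (slopeAngle φ x)) (ψ₀ - slopeAngle φ x)
        w₀).indicator (fun _ => 1) v) * f ψ₀ v)) := by
  obtain ⟨hpos, h0, hnh, -⟩ := hb.asymptotics
  have hH := hN.eventually hpos
  have hH0 := h0.comp hN
  have hφ01 := hs.range_φ x (Ioo_subset_Icc_self hx)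
  have hy : Tendsto (fun k => φ x + h (N k) * w k) L (𝓝 (φ x)) := by
    simpa using (hH0.mul hw).const_add (φ x)
  set J : ℝ × ℝ → ℝ := fun a => if w₀ - a.2 ≤ -deriv φ x * a.1 then 1 else 0 with hJ
  have := tendsto_localSum_jumpImage hs hx hξ hb hN hψ hy (Ioo_subset_Icc_self hφ01)
    (J := J) ?_ ?_ hf
  · rw [integral_comp_rotArg ψ₀ (fun a => m (x, φ x) + τ x * J a) (f ψ₀)] at this
    convert this using 6 with v
    have hiff := rotInv_mem_jumpRegion (φ := φ) (x := x) w₀ ψ₀ v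
    by_cases hv : v ∈ jumpRegion (cos (slopeAngle φ x)) (ψ₀ - slopeAngle φ x) w₀
    · rw [indicator_of_mem hv, hJ]; simp only; rw [if_pos (hiff.2 hv)]
    · rw [indicator_of_notMem hv, hJ]; simp only; rw [if_neg (mt hiff.1 hv)]
  · intro a _
    have h1 : Tendsto (fun k => φ x + h (N k) * w k - h (N k) * a.2) L (𝓝 (φ x)) := by
      simpa using hy.sub (hH0.mul_const a.2)
    exact h1 (Ioo_mem_nhds hφ01.1 hφ01.2)
  · filter_upwards [ae_off_line (-deriv φ x) w₀] with a ha b hba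
    have hb1 : Tendsto (fun k => (b k).1) L (𝓝 a.1) := (continuous_fst.tendsto a).comp hba
    have hb2 : Tendsto (fun k => (b k).2) L (𝓝 a.2) := (continuous_snd.tendsto a).comp hba
    have hsl := tendsto_slope_local hs hx hH hH0 hb1
    rcases lt_or_gt_of_ne ha with hlt | hgt
    · filter_upwards [(hw.sub hb2).eventually_lt hsl hlt] with k hk
      rw [if_pos hk.le, hJ]; simp only; rw [if_pos hlt.le]
    · filter_upwards [hsl.eventually_lt (hw.sub hb2) hgt] with k hk
      rw [if_neg hk.not_ge, hJ]; simp only; rw [if_neg hgt.not_ge]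

/-- Localized sums of the image tend to zero away from the jump, for windows with vanishing
integral. -/
lemma tendsto_localSum_of_tendsto_infty (hs : SmoothnessAssumption m τ φ) (hx : x ∈ Ioo (0 : ℝ) 1)
    (hξ : RegularDesign ξ) (hb : BandwidthAssumption h) {N : ι → ℕ} (hN : Tendsto N L atTop)
    {w ψ : ι → ℝ} {ψ₀ y : ℝ} (hψ : Tendsto ψ L (𝓝 ψ₀))
    (hy : Tendsto (fun k => φ x + h (N k) * w k) L (𝓝 y)) (hy01 : y ∈ Icc (0 : ℝ) 1)
    (hrange : ∀ᶠ k in L, φ x + h (N k) * w k ∈ Icc (√2 * h (N k)) (1 - √2 * h (N k)))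
    (hw : Tendsto w L atTop ∨ Tendsto w L atBot) {f : ℝ → ℝ × ℝ → ℝ} (hf : IsWindow f)
    (hf0 : ∫ v, f ψ₀ v = 0) :
    Tendsto (fun k => localSum (ξ (N k)) (h (N k)) (x, φ x)
      (fun i => jumpImage m τ φ (ξ (N k) i.1) (ξ (N k) i.2)) f (w k) (ψ k)) L (𝓝 0) := by
  obtain ⟨hpos, h0, hnh, -⟩ := hb.asymptotics
  have hH := hN.eventually hpos
  have hH0 := h0.comp hN
  have key (J : ℝ) (hJ : ∀ a : ℝ × ℝ, ∀ b : ι → ℝ × ℝ, Tendsto b L (𝓝 a) → ∀ᶠ k in L,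
      (if w k - (b k).2 ≤ (φ (x - h (N k) * (b k).1) - φ x) / h (N k) then 1 else 0) = J) :
      Tendsto (fun k => localSum (ξ (N k)) (h (N k)) (x, φ x)
        (fun i => jumpImage m τ φ (ξ (N k) i.1) (ξ (N k) i.2)) f (w k) (ψ k)) L (𝓝 0) := by
    have := tendsto_localSum_jumpImage hs hx hξ hb hN hψ hy hy01 (J := fun _ => J) ?_
      (Eventually.of_forall fun a b hba => hJ a b hba) hf
    · rw [integral_comp_rotArg ψ₀ (fun a => m (x, y) + τ x * J) (f ψ₀), integral_const_mul, hf0,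
        mul_zero] at this
      exact this
    -- The margin `√2 h` keeps the window strictly inside the image even when `y` tends to 0 or 1.
    · intro a ha
      have h2 : |a.2| < √2 := Real.lt_sqrt_of_sq_lt (by rw [sq_abs]; nlinarith [sq_nonneg a.1])
      rw [abs_lt] at h2
      filter_upwards [hrange, hH] with k hk hhk
      constructor <;> nlinarith [hk.1, hk.2, h2.1, h2.2]
  rcases hw with hw | hw
  · refine key 0 fun a b hba => ?_
    have hsl := tendsto_slope_local hs hx hH hH0 ((continuous_fst.tendsto a).comp hba)
    have hb2 : Tendsto (fun k => (b k).2) L (𝓝 a.2) := (continuous_snd.tendsto a).comp hba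
    have hd := hw.atTop_add ((hsl.add hb2).neg)
    filter_upwards [hd.eventually_gt_atTop 0] with k hk
    simp only [Function.comp] at hk
    rw [if_neg (by linarith)]
  · refine key 1 fun a b hba => ?_
    have hsl := tendsto_slope_local hs hx hH hH0 ((continuous_fst.tendsto a).comp hba)
    have hb2 : Tendsto (fun k => (b k).2) L (𝓝 a.2) := (continuous_snd.tendsto a).comp hba
    have hd := hw.atBot_add ((hsl.add hb2).neg)
    filter_upwards [hd.eventually_lt_atBot 0] with k hk
    simp only [Function.comp] at hk
    rw [if_pos (by linarith)]

end det

/-! ### Algebra and integrability of window functions -/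

namespace IsWindow
variable {f g : ℝ → ℝ × ℝ → ℝ}

lemma add (hf : IsWindow f) (hg : IsWindow g) : IsWindow fun ψ v => f ψ v + g ψ v :=
  ⟨hf.continuous.add hg.continuous, fun ψ v h => by rw [hf.supp ψ v h, hg.supp ψ v h, add_zero]⟩

lemma mul (hf : IsWindow f) (hg : IsWindow g) : IsWindow fun ψ v => f ψ v * g ψ v :=
  ⟨hf.continuous.mul hg.continuous, fun ψ v h => by rw [hf.supp ψ v h, zero_mul]⟩

lemma const_mul (hf : IsWindow f) (c : ℝ) : IsWindow fun ψ v => c * f ψ v :=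
  ⟨hf.continuous.const_mul c, fun ψ v h => by rw [hf.supp ψ v h, mul_zero]⟩

lemma sq (hf : IsWindow f) : IsWindow fun ψ v => f ψ v ^ 2 := by
  simpa only [_root_.sq] using hf.mul hf

lemma integrable (hf : IsWindow f) (ψ : ℝ) : Integrable (f ψ) := by
  have hc : Continuous (f ψ) := hf.continuous.comp (by fun_prop : Continuous fun v => (ψ, v))
  refine hc.integrable_of_hasCompactSupport (HasCompactSupport.intro
    ((isCompact_Icc (a := (-1 : ℝ)) (b := 1)).prod (isCompact_Icc (a := (-1 : ℝ)) (b := 1)))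
      fun v hv => hf.supp ψ v fun h => hv ⟨Ioo_subset_Icc_self h.1, Ioo_subset_Icc_self h.2⟩)

end IsWindow

lemma integral_prod_mul_eq (a b : ℝ → ℝ) : ∫ v : ℝ × ℝ, a v.1 * b v.2 = (∫ s, a s) * ∫ t, b t := by
  rw [Measure.volume_eq_prod, integral_prod_mul]

/-! ### Facts from the kernel assumption -/

namespace KernelAssumption
variable {K₁ K₂ : ℝ → ℝ} (hK : KernelAssumption K₁ K₂)
include hK

lemma c2₁ : CompactC2 K₁ (deriv K₁) (deriv (deriv K₁)) :=
  compactC2_of_contDiffOn hK.smooth₁ hK.supp₁ hK.boundary₁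

lemma c2₂ : CompactC2 K₂ (deriv K₂) (deriv (deriv K₂)) :=
  compactC2_of_contDiffOn hK.smooth₂ hK.supp₂ hK.boundary₂

lemma integral₁' : ∫ s, K₁ s = 1 := by
  rw [← hK.integral₁, intervalIntegral.integral_of_le (by norm_num), ← integral_Icc_eq_integral_Ioc,
    setIntegral_eq_integral_of_forall_compl_eq_zero fun x hx => hK.supp₁ x hx]

lemma integral₂_zero : ∫ s, K₂ s = 0 := integral_odd_eq_zero hK.odd₂

lemma integrable₁ : Integrable K₁ := integrable_of_zero_off_Ioo hK.c2₁.continuous hK.c2₁.supp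

lemma integrable₂ : Integrable K₂ := integrable_of_zero_off_Ioo hK.c2₂.continuous hK.c2₂.supp

lemma setIntegral_Iic_eq {b : ℝ} (hb : -1 ≤ b) : ∫ t in Iic b, K₂ t = ∫ t in (-1 : ℝ)..b, K₂ t := by
  rw [intervalIntegral.integral_of_le hb]
  have h0 : ∀ t ∈ Iic b \ Ioc (-1) b, K₂ t = 0 := fun t ht =>
    hK.c2₂.supp t fun h => ht.2 ⟨h.1, ht.1⟩
  exact setIntegral_eq_of_subset_of_forall_sdiff_eq_zero measurableSet_Iic Ioc_subset_Iic_self h0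

lemma setIntegral_Iic_zero : ∫ t in Iic (0 : ℝ), K₂ t = -1 := by
  have h1 : ∫ t in Ioi (0 : ℝ), K₂ t = 1 := by
    rw [← hK.integral₂, intervalIntegral.integral_of_le zero_le_one]
    refine setIntegral_eq_of_subset_of_forall_sdiff_eq_zero measurableSet_Ioi Ioc_subset_Ioi_self
      fun t ht => hK.c2₂.supp t fun h => ht.2 ⟨ht.1, h.2.le⟩
  have h2 := integral_add_compl (measurableSet_Iic (a := (0 : ℝ))) hK.integrable₂
  rw [compl_Iic, h1, hK.integral₂_zero] at h2
  linarith

/-- Outside `[-1,1]` the integral is 0, either trivially or because `K₂` is odd; inside it is the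
primitive. -/
lemma abs_setIntegral_Iic_lt {b : ℝ} (hb : b ≠ 0) : |∫ t in Iic b, K₂ t| < 1 := by
  rcases lt_or_ge b (-1) with h1 | h1
  · have h0 : ∀ t ∈ Iic b, K₂ t = 0 := fun t ht =>
      hK.c2₂.supp t fun h => absurd h.1 (not_lt.2 (le_trans ht h1.le))
    rw [setIntegral_eq_zero_of_forall_eq_zero h0]
    simp
  · rcases le_or_gt b 1 with h2 | h2
    · rw [hK.setIntegral_Iic_eq h1]
      exact hK.primitive₂ b ⟨h1, h2⟩ hb
    · have h0 : ∀ t, t ∉ Iic b → K₂ t = 0 := fun t ht =>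
        hK.c2₂.supp t fun h => ht (h.2.le.trans h2.le)
      rw [setIntegral_eq_integral_of_forall_compl_eq_zero h0, hK.integral₂_zero]
      simp

lemma setIntegral_Ici_eq (b : ℝ) : ∫ t in Ici b, K₂ t = -∫ t in Iic b, K₂ t := by
  have h2 := integral_add_compl (measurableSet_Iic (a := b)) hK.integrable₂
  rw [compl_Iic, hK.integral₂_zero] at h2
  rw [integral_Ici_eq_integral_Ioi]
  linarith

/-- Integrals of `K₂` over half-lines are at most `1`. -/
lemma setIntegral_halfLine_le (A C : ℝ) : ∫ t in {t | A ≤ C * t}, K₂ t ≤ 1 ∧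
    (A ≠ 0 ∨ C ≤ 0 → ∫ t in {t | A ≤ C * t}, K₂ t < 1) := by
  rcases lt_trichotomy C 0 with hC | hC | hC
  · have e : {t | A ≤ C * t} = Iic (A / C) := by
      ext t; rw [mem_ofPred_eq, mem_Iic, le_div_iff_of_neg hC, mul_comm]
    rw [e]
    have : ∫ t in Iic (A / C), K₂ t < 1 := by
      by_cases hb : A / C = 0
      · rw [hb, hK.setIntegral_Iic_zero]; norm_num
      · exact lt_of_abs_lt (hK.abs_setIntegral_Iic_lt hb)
    exact ⟨this.le, fun _ => this⟩
  · have : ∫ t in {t | A ≤ C * t}, K₂ t < 1 := by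
      rw [hC]
      by_cases hA : A ≤ 0
      · simp [hA, hK.integral₂_zero]
      · simp [hA]
    exact ⟨this.le, fun _ => this⟩
  · have e : {t | A ≤ C * t} = Ici (A / C) := by
      ext t; rw [mem_ofPred_eq, mem_Ici, div_le_iff₀ hC, mul_comm]
    rw [e, hK.setIntegral_Ici_eq]
    by_cases hb : A / C = 0
    · have hA : A = 0 := by
        rcases div_eq_zero_iff.1 hb with h | h
        · exact h
        · exact absurd h hC.ne'
      rw [hb, hK.setIntegral_Iic_zero]
      refine ⟨by norm_num, fun h => ?_⟩
      rcases h with h | h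
      · exact absurd hA h
      · exact absurd hC (not_lt.2 h)
    · have := neg_lt_of_abs_lt (hK.abs_setIntegral_Iic_lt hb)
      exact ⟨by linarith, fun _ => by linarith⟩

/-- By Fubini, the vertical sections of the half-plane are half-lines, the whole line or empty. -/
lemma integral_jumpRegion_win (c δ w ψ : ℝ) :
    Integrable (fun s => K₁ s * ∫ t in {t | w * c - sin δ * s ≤ cos δ * t}, K₂ t) ∧
    ∫ v, (jumpRegion c δ w).indicator (fun _ => 1) v * win K₁ K₂ ψ v =
      ∫ s, K₁ s * ∫ t in {t | w * c - sin δ * s ≤ cos δ * t}, K₂ t := by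
  have hi : Integrable (fun v => (jumpRegion c δ w).indicator (fun _ => 1) v * win K₁ K₂ ψ v) := by
    have := ((isWindow_win hK.c2₁ hK.c2₂).integrable ψ).indicator (measurableSet_jumpRegion c δ w)
    refine this.congr (Eventually.of_forall fun v => ?_)
    simp only [indicator]
    split_ifs <;> simp
  rw [Measure.volume_eq_prod] at hi ⊢
  have e (s : ℝ) : ∫ t, (jumpRegion c δ w).indicator (fun _ => (1 : ℝ)) (s, t) *
      win K₁ K₂ ψ (s, t) = K₁ s * ∫ t in {t | w * c - sin δ * s ≤ cos δ * t}, K₂ t := by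
    have hm : MeasurableSet {t | w * c - sin δ * s ≤ cos δ * t} :=
      measurableSet_le (by fun_prop) (by fun_prop)
    rw [← integral_indicator hm, ← integral_const_mul]
    refine integral_congr_ae (Eventually.of_forall fun t => ?_)
    have hiff : (s, t) ∈ jumpRegion c δ w ↔ t ∈ {t | w * c - sin δ * s ≤ cos δ * t} := by
      simp only [jumpRegion, mem_ofPred_eq, sub_le_iff_le_add']
    beta_reduce
    by_cases h : (s, t) ∈ jumpRegion c δ w
    · rw [indicator_of_mem h, indicator_of_mem (hiff.1 h), one_mul, win]
    · rw [indicator_of_notMem h, indicator_of_notMem (mt hiff.2 h), zero_mul, mul_zero]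
  have h1 := hi.integral_prod_left
  have h2 := integral_prod _ hi
  simp only [e] at h1 h2
  exact ⟨h1, h2⟩

/-- The limiting contrast is strictly below its maximum except at the true parameters. -/
lemma integral_jumpRegion_win_lt {c δ w ψ : ℝ} (hc : 0 < c) (hδ : -π < δ) (hδ' : δ < π)
    (hne : w ≠ 0 ∨ δ ≠ 0) :
    ∫ v, (jumpRegion c δ w).indicator (fun _ => 1) v * win K₁ K₂ ψ v < 1 := by
  obtain ⟨hi, he⟩ := hK.integral_jumpRegion_win c δ w ψ
  rw [he, ← sub_pos, ← hK.integral₁', ← integral_sub hK.integrable₁ hi]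
  set F : ℝ → ℝ := fun s => K₁ s - K₁ s * ∫ t in {t | w * c - sin δ * s ≤ cos δ * t}, K₂ t with hF
  have hFe (s : ℝ) : F s = K₁ s * (1 - ∫ t in {t | w * c - sin δ * s ≤ cos δ * t}, K₂ t) := by
    rw [hF]; ring
  have hK0 (s : ℝ) : 0 ≤ K₁ s := by
    by_cases hs : s ∈ Ioo (-1 : ℝ) 1
    · exact (hK.pos₁ s hs).le
    · rw [hK.c2₁.supp s hs]
  have hF0 : 0 ≤ F := fun s => by
    rw [hFe, Pi.zero_apply]
    exact mul_nonneg (hK0 s)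
      (sub_nonneg.2 (hK.setIntegral_halfLine_le (w * c - sin δ * s) (cos δ)).1)
  rw [integral_pos_iff_support_of_nonneg hF0 (hK.integrable₁.sub hi)]
  -- Equality in the half-line bound at `s` needs `w c = s sin δ` and `cos δ > 0`. If `sin δ ≠ 0`
  -- this fails except at one `s`. If `sin δ = 0` then `δ = 0`, so `w ≠ 0` and it fails everywhere;
  -- the removed point is then 0 and harmless.
  have hsub : Ioo (-1 : ℝ) 1 \ {w * c / sin δ} ⊆ Function.support F := by
    intro s hs
    rw [Function.mem_support, hFe]
    have h2 : w * c - sin δ * s ≠ 0 ∨ cos δ ≤ 0 := by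
      by_cases hsin : sin δ = 0
      · have hδ0 : δ = 0 := (sin_eq_zero_iff_of_lt_of_lt hδ hδ').1 hsin
        have hw : w ≠ 0 := by
          rcases hne with h | h
          · exact h
          · exact absurd hδ0 h
        left
        rw [hsin, zero_mul, sub_zero]
        exact mul_ne_zero hw hc.ne'
      · left
        intro h0
        refine hs.2 ?_
        rw [mem_singleton_iff, eq_div_iff hsin]
        linarith
    exact mul_ne_zero (hK.pos₁ s hs.1).ne' (sub_ne_zero.2
      ((hK.setIntegral_halfLine_le (w * c - sin δ * s) (cos δ)).2 h2).ne')
  refine lt_of_lt_of_le ?_ (measure_mono hsub)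
  rw [measure_sdiff_null (by simp), Real.volume_Ioo]
  norm_num

lemma integral_win (ψ : ℝ) : ∫ v, win K₁ K₂ ψ v = 0 := by
  unfold win
  rw [integral_prod_mul_eq, hK.integral₂_zero, mul_zero]

lemma integral_jumpRegion_win_zero (c ψ : ℝ) :
    ∫ v, (jumpRegion c 0 0).indicator (fun _ => 1) v * win K₁ K₂ ψ v = 1 := by
  rw [(hK.integral_jumpRegion_win c 0 0 ψ).2]
  have e : {t : ℝ | (0 : ℝ) ≤ t} = Ici 0 := rfl
  simp [e, hK.setIntegral_Ici_eq, hK.setIntegral_Iic_zero, hK.integral₁']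

/-- The limiting contrast in terms of the jump region. -/
lemma integral_image_win (m₀ t c δ w ψ : ℝ) :
    ∫ v, (m₀ + t * (jumpRegion c δ w).indicator (fun _ => 1) v) * win K₁ K₂ ψ v =
      t * ∫ v, (jumpRegion c δ w).indicator (fun _ => 1) v * win K₁ K₂ ψ v := by
  have hw := isWindow_win hK.c2₁ hK.c2₂
  have hi : Integrable (fun v => (jumpRegion c δ w).indicator (fun _ => 1) v * win K₁ K₂ ψ v) := by
    have := (hw.integrable ψ).indicator (measurableSet_jumpRegion c δ w)
    refine this.congr (Eventually.of_forall fun v => ?_)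
    simp only [indicator]
    split_ifs <;> simp
  have e (v : ℝ × ℝ) : (m₀ + t * (jumpRegion c δ w).indicator (fun _ => 1) v) * win K₁ K₂ ψ v =
      m₀ * win K₁ K₂ ψ v +
        t * ((jumpRegion c δ w).indicator (fun _ => 1) v * win K₁ K₂ ψ v) := by ring
  simp only [e]
  rw [integral_add ((hw.integrable ψ).const_mul m₀) (hi.const_mul t), integral_const_mul,
    integral_const_mul, hK.integral_win, mul_zero, zero_add]

end KernelAssumption

/-! ### Hessian and covariance integrals -/

/-- `F` is integrable with integral `I`. -/
def HasInt (F : ℝ × ℝ → ℝ) (I : ℝ) : Prop := Integrable F ∧ ∫ v, F v = I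

namespace HasInt
variable {F G : ℝ × ℝ → ℝ} {I J : ℝ}

lemma add (hF : HasInt F I) (hG : HasInt G J) : HasInt (fun v => F v + G v) (I + J) :=
  ⟨hF.1.add hG.1, by rw [integral_add hF.1 hG.1, hF.2, hG.2]⟩

lemma sub (hF : HasInt F I) (hG : HasInt G J) : HasInt (fun v => F v - G v) (I - J) :=
  ⟨hF.1.sub hG.1, by rw [integral_sub hF.1 hG.1, hF.2, hG.2]⟩

lemma const_mul (hF : HasInt F I) (c : ℝ) : HasInt (fun v => c * F v) (c * I) :=
  ⟨hF.1.const_mul c, by rw [integral_const_mul, hF.2]⟩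

lemma congr (hF : HasInt F I) (h : ∀ v, F v = G v) (hI : I = J) : HasInt G J := by
  rw [← hI, ← show F = G from funext h]
  exact hF

lemma prod_mul {a b : ℝ → ℝ} (ha : Integrable a) (hb : Integrable b) :
    HasInt (fun v => a v.1 * b v.2) ((∫ s, a s) * ∫ t, b t) :=
  ⟨ha.mul_prod hb, integral_prod_mul_eq a b⟩

lemma prod_mul_of_odd_left {a b : ℝ → ℝ} (ha : Integrable a) (hb : Integrable b)
    (h : ∀ s, a (-s) = -a s) : HasInt (fun v => a v.1 * b v.2) 0 :=
  (prod_mul ha hb).congr (fun _ => rfl) (by rw [integral_odd_eq_zero h, zero_mul])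

/-- Integral of a product function against a step function of the second coordinate. -/
lemma jump_prod_mul (m₀ t c : ℝ) {a b : ℝ → ℝ} (ha : Integrable a) (hb : Integrable b) :
    HasInt (fun v => (m₀ + t * (jumpRegion c 0 0).indicator (fun _ => 1) v) * (a v.1 * b v.2))
      ((∫ s, a s) * (m₀ * (∫ u, b u) + t * ∫ u in Ioi 0, b u)) := by
  have hb' : Integrable ((Ici (0 : ℝ)).indicator b) := hb.indicator measurableSet_Ici
  have h := ((prod_mul ha hb).const_mul m₀).add ((prod_mul ha hb').const_mul t)
  refine h.congr (fun v => ?_) ?_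
  · have hiff : v ∈ jumpRegion c 0 0 ↔ v.2 ∈ Ici (0 : ℝ) := by
      simp [jumpRegion]
    by_cases hv : v ∈ jumpRegion c 0 0
    · rw [indicator_of_mem hv, indicator_of_mem (hiff.1 hv)]; ring
    · rw [indicator_of_notMem hv, indicator_of_notMem (mt hiff.2 hv)]; ring
  · rw [integral_indicator measurableSet_Ici, integral_Ici_eq_integral_Ioi]
    ring

end HasInt

lemma CompactC2.integrable_mul {k k₁ k₂ : ℝ → ℝ} (hk : CompactC2 k k₁ k₂) {a : ℝ → ℝ}
    (ha : Continuous a) : Integrable (fun s => a s * k s) ∧ Integrable (fun s => a s * k₁ s) ∧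
      Integrable (fun s => a s * k₂ s) :=
  ⟨integrable_of_zero_off_Ioo (ha.mul hk.continuous) fun s hs => by rw [hk.supp s hs, mul_zero],
    integrable_of_zero_off_Ioo (ha.mul hk.continuous₁) fun s hs => by rw [hk.supp₁ s hs, mul_zero],
    integrable_of_zero_off_Ioo (ha.mul hk.continuous₂) fun s hs => by rw [hk.supp₂ s hs, mul_zero]⟩

namespace KernelAssumption
variable {K₁ K₂ : ℝ → ℝ} (hK : KernelAssumption K₁ K₂)
include hK

/-- At the true point the half-plane is `v.2 ≥ 0`, so all integrals factor. The terms with `K₁'` or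
`K₁''` integrate to 0, and `K₁ K₂''` leaves the boundary value `-K₂'(0)`. -/
lemma hessian_WW (m₀ t c ψ : ℝ) :
    ∫ v, (m₀ + t * (jumpRegion c 0 0).indicator (fun _ => 1) v) *
      winWW K₁ (deriv K₁) (deriv (deriv K₁)) K₂ (deriv K₂) (deriv (deriv K₂)) ψ v =
        -(t * cos ψ ^ 2 * deriv K₂ 0) := by
  have hk := hK.c2₁
  have hl := hK.c2₂
  obtain ⟨ik, ik1, ik2⟩ := hk.integrable_mul (a := fun _ => 1) continuous_const
  obtain ⟨il, il1, il2⟩ := hl.integrable_mul (a := fun _ => 1) continuous_const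
  simp only [one_mul] at ik ik1 ik2 il il1 il2
  have e1 : ∫ s, deriv K₁ s = 0 :=
    integral_eq_zero_of_hasDerivAt hk.hasDerivAt hk.continuous₁ hk.supp hk.supp₁
  have e2 : ∫ s, deriv (deriv K₁) s = 0 :=
    integral_eq_zero_of_hasDerivAt hk.hasDerivAt' hk.continuous₂ hk.supp₁ hk.supp₂
  have e3 : ∫ s, deriv (deriv K₂) s = 0 :=
    integral_eq_zero_of_hasDerivAt hl.hasDerivAt' hl.continuous₂ hl.supp₁ hl.supp₂
  have e4 : ∫ s in Ioi 0, deriv (deriv K₂) s = -deriv K₂ 0 :=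
    setIntegral_Ioi_of_hasDerivAt hl.hasDerivAt' hl.continuous₂ hl.supp₁ hl.supp₂
  have h := (((HasInt.jump_prod_mul m₀ t c ik2 il).const_mul (sin ψ ^ 2)).add
    ((HasInt.jump_prod_mul m₀ t c ik1 il1).const_mul (2 * sin ψ * cos ψ))).add
    ((HasInt.jump_prod_mul m₀ t c ik il2).const_mul (cos ψ ^ 2))
  refine (h.congr (fun v => ?_) ?_).2
  · simp only [winWW]; ring
  · rw [e1, e2, e3, e4, hK.integral₁']; ring

lemma integral_mul_deriv₁ : ∫ s, s * deriv K₁ s = -1 := by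
  have hk := hK.c2₁
  have ik := hK.integrable₁
  obtain ⟨-, isk1, -⟩ := hk.integrable_mul (a := fun s => s) continuous_id
  have h : ∫ s, (K₁ s + s * deriv K₁ s) = 0 := by
    refine integral_eq_zero_of_hasDerivAt (f := fun s => s * K₁ s) (fun s => ?_)
      (hk.continuous.add (continuous_id.mul hk.continuous₁))
      (fun s hs => by rw [hk.supp s hs, mul_zero])
      (fun s hs => by rw [hk.supp s hs, hk.supp₁ s hs]; ring)
    exact ((hasDerivAt_id s).mul (hk.hasDerivAt s)).congr_deriv (by simp)
  rw [integral_add ik isk1, hK.integral₁'] at h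
  linarith

/-- Terms with `K₁'`, `K₁''` or `s K₁` integrate to 0 in the first coordinate. The two remaining
multiples of `K₂'` cancel because `∫ K₁ = 1` and `∫ s K₁' = -1`. -/
lemma hessian_WP (m₀ t c ψ : ℝ) :
    ∫ v, (m₀ + t * (jumpRegion c 0 0).indicator (fun _ => 1) v) *
      winWP K₁ (deriv K₁) (deriv (deriv K₁)) K₂ (deriv K₂) (deriv (deriv K₂)) ψ v = 0 := by
  have hk := hK.c2₁
  have hl := hK.c2₂
  obtain ⟨ik, ik1, ik2⟩ := hk.integrable_mul (a := fun _ => 1) continuous_const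
  obtain ⟨il, il1, il2⟩ := hl.integrable_mul (a := fun _ => 1) continuous_const
  obtain ⟨isk, isk1, -⟩ := hk.integrable_mul (a := fun s => s) continuous_id
  obtain ⟨iul, iul1, -⟩ := hl.integrable_mul (a := fun s => s) continuous_id
  simp only [one_mul] at ik ik1 ik2 il il1 il2
  have e1 : ∫ s, deriv K₁ s = 0 :=
    integral_eq_zero_of_hasDerivAt hk.hasDerivAt hk.continuous₁ hk.supp hk.supp₁
  have e2 : ∫ s, deriv (deriv K₁) s = 0 :=
    integral_eq_zero_of_hasDerivAt hk.hasDerivAt' hk.continuous₂ hk.supp₁ hk.supp₂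
  have e3 : ∫ s, s * K₁ s = 0 := integral_odd_eq_zero fun s => by rw [hK.even₁]; ring
  have e4 := hK.integral_mul_deriv₁
  have h := ((((HasInt.jump_prod_mul m₀ t c ik1 il).const_mul (cos ψ)).sub
    ((HasInt.jump_prod_mul m₀ t c ik il1).const_mul (sin ψ))).add
    (((HasInt.jump_prod_mul m₀ t c ik2 iul).sub
      (HasInt.jump_prod_mul m₀ t c isk1 il1)).const_mul (sin ψ))).add
    (((HasInt.jump_prod_mul m₀ t c ik1 iul1).sub
      (HasInt.jump_prod_mul m₀ t c isk il2)).const_mul (cos ψ))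
  refine (h.congr (fun v => ?_) ?_).2
  · simp only [winWP]; ring
  · rw [e1, e2, e3, e4, hK.integral₁']; ring

/-- The middle terms are regrouped so that each has a factor that is an exact derivative, `(u K₂)'`
or `(s K₁)'`; the former also integrates to 0 over the half-line. Only `s² K₁ K₂''` survives. -/
lemma hessian_PP (m₀ t c ψ : ℝ) :
    ∫ v, (m₀ + t * (jumpRegion c 0 0).indicator (fun _ => 1) v) *
      winPP K₁ (deriv K₁) (deriv (deriv K₁)) K₂ (deriv K₂) (deriv (deriv K₂)) ψ v =
        -(t * deriv K₂ 0 * ∫ y in (-1 : ℝ)..1, y ^ 2 * K₁ y) := by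
  have hk := hK.c2₁
  have hl := hK.c2₂
  obtain ⟨ik, ik1, ik2⟩ := hk.integrable_mul (a := fun _ => 1) continuous_const
  obtain ⟨il, il1, il2⟩ := hl.integrable_mul (a := fun _ => 1) continuous_const
  obtain ⟨isk, isk1, -⟩ := hk.integrable_mul (a := fun s => s) continuous_id
  obtain ⟨iul, iul1, -⟩ := hl.integrable_mul (a := fun s => s) continuous_id
  obtain ⟨issk, -, -⟩ := hk.integrable_mul (a := fun s => s ^ 2) (continuous_pow 2)
  obtain ⟨iuul, -, -⟩ := hl.integrable_mul (a := fun s => s ^ 2) (continuous_pow 2)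
  simp only [one_mul] at ik ik1 ik2 il il1 il2
  have e2 : ∫ s, deriv (deriv K₁) s = 0 :=
    integral_eq_zero_of_hasDerivAt hk.hasDerivAt' hk.continuous₂ hk.supp₁ hk.supp₂
  have e4 := hK.integral_mul_deriv₁
  have e5 : ∫ s, deriv (deriv K₂) s = 0 :=
    integral_eq_zero_of_hasDerivAt hl.hasDerivAt' hl.continuous₂ hl.supp₁ hl.supp₂
  have e6 : ∫ s in Ioi 0, deriv (deriv K₂) s = -deriv K₂ 0 :=
    setIntegral_Ioi_of_hasDerivAt hl.hasDerivAt' hl.continuous₂ hl.supp₁ hl.supp₂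
  have e7 : ∫ s, s ^ 2 * K₁ s = ∫ y in (-1 : ℝ)..1, y ^ 2 * K₁ y := by
    rw [intervalIntegral.integral_of_le (by norm_num), ← integral_Icc_eq_integral_Ioc]
    have h0 : ∀ s, s ∉ Icc (-1 : ℝ) 1 → s ^ 2 * K₁ s = 0 := fun s hs => by
      rw [hK.supp₁ s hs, mul_zero]
    rw [setIntegral_eq_integral_of_forall_compl_eq_zero h0]
  have hd (s : ℝ) : HasDerivAt (fun s => s * K₂ s) (K₂ s + s * deriv K₂ s) s := by
    exact ((hasDerivAt_id s).mul (hl.hasDerivAt s)).congr_deriv (by simp)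
  have hcont : Continuous fun s => K₂ s + s * deriv K₂ s :=
    hl.continuous.add (continuous_id.mul hl.continuous₁)
  have hz1 : ∀ s, s ∉ Ioo (-1 : ℝ) 1 → s * K₂ s = 0 := fun s hs => by rw [hl.supp s hs, mul_zero]
  have hz2 : ∀ s, s ∉ Ioo (-1 : ℝ) 1 → K₂ s + s * deriv K₂ s = 0 := fun s hs => by
    rw [hl.supp s hs, hl.supp₁ s hs]; ring
  have e8 : ∫ s, (K₂ s + s * deriv K₂ s) = 0 := integral_eq_zero_of_hasDerivAt hd hcont hz1 hz2
  have e9 : ∫ s in Ioi 0, (K₂ s + s * deriv K₂ s) = 0 := by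
    rw [setIntegral_Ioi_of_hasDerivAt hd hcont hz1 hz2]; simp
  have hA := (HasInt.jump_prod_mul m₀ t c ik2 iuul)
  have hB := (HasInt.jump_prod_mul m₀ t c isk1 (il.add iul1))
  have hB' := (HasInt.jump_prod_mul m₀ t c (isk1.add ik) iul1)
  have hC := (HasInt.jump_prod_mul m₀ t c issk il2)
  have h := ((hA.sub hB).sub hB').add hC
  refine (h.congr (fun v => ?_) ?_).2
  · simp only [winPP, Pi.add_apply]; ring
  · simp only [Pi.add_apply]
    rw [e2, e4, e5, e6, e7, e8, e9, integral_add isk1 ik, e4, hK.integral₁']; ring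

/-- The asymptotic variance of linear combinations of the score and the contrast. -/
lemma integral_comb_sq (φ : ℝ → ℝ) (x α β γ : ℝ) :
    ∫ v, (α * winW K₁ (deriv K₁) K₂ (deriv K₂) (slopeAngle φ x) v
      + β * winP K₁ (deriv K₁) K₂ (deriv K₂) (slopeAngle φ x) v
      + γ * win K₁ K₂ (slopeAngle φ x) v) ^ 2 =
    α ^ 2 * VSφ K₁ K₂ φ x + β ^ 2 * VSψ K₁ K₂ + γ ^ 2 * VSτ K₁ K₂ := by
  have hk := hK.c2₁
  have hl := hK.c2₂
  have ok1 := deriv_odd_of_even hK.even₁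
  have ol1 := deriv_even_of_odd hK.odd₂
  set ψ := slopeAngle φ x with hψ
  have hW := isWindow_winW hk hl
  have hP := isWindow_winP hk hl
  have h0 := isWindow_win hk hl
  have hset {F : ℝ × ℝ → ℝ} (hF : ∀ v : ℝ × ℝ, ¬ (v.1 ∈ Ioo (-1 : ℝ) 1 ∧ v.2 ∈ Ioo (-1 : ℝ) 1) →
      F v = 0) : ∫ v in Icc (-1 : ℝ) 1 ×ˢ Icc (-1 : ℝ) 1, F v = ∫ v, F v :=
    setIntegral_eq_integral_of_forall_compl_eq_zero fun v hv => hF v fun h =>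
      hv ⟨Ioo_subset_Icc_self h.1, Ioo_subset_Icc_self h.2⟩
  -- squares
  have w1 : IsWindow (win (deriv K₁) K₂) := isWindow_of_forall hk hl
    (by have := hk.continuous₁; have := hl.continuous; unfold win; fun_prop) fun ψ v h => by
      rcases h with ⟨h1, h2, h3⟩ | ⟨h1, h2, h3⟩ <;> simp [win, h1, h2]
  have w2 : IsWindow (win K₁ (deriv K₂)) := isWindow_of_forall hk hl
    (by have := hk.continuous; have := hl.continuous₁; unfold win; fun_prop) fun ψ v h => by
      rcases h with ⟨h1, h2, h3⟩ | ⟨h1, h2, h3⟩ <;> simp [win, h1, h2]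
  have s1 : HasInt (fun v => win (deriv K₁) K₂ ψ v ^ 2)
      (∫ z in Icc (-1 : ℝ) 1 ×ˢ Icc (-1 : ℝ) 1, (deriv K₁ z.1 * K₂ z.2) ^ 2) :=
    ⟨w1.sq.integrable ψ, (hset (w1.sq.supp ψ)).symm⟩
  have s2 : HasInt (fun v => win K₁ (deriv K₂) ψ v ^ 2)
      (∫ z in Icc (-1 : ℝ) 1 ×ˢ Icc (-1 : ℝ) 1, (K₁ z.1 * deriv K₂ z.2) ^ 2) :=
    ⟨w2.sq.integrable ψ, (hset (w2.sq.supp ψ)).symm⟩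
  have s3 : HasInt (fun v => win K₁ K₂ ψ v ^ 2) (VSτ K₁ K₂) :=
    ⟨h0.sq.integrable ψ, (hset (h0.sq.supp ψ)).symm⟩
  have hint {a b : ℝ → ℝ} (ha : Continuous a) (hb : Continuous b)
      (ha0 : ∀ s, s ∉ Ioo (-1 : ℝ) 1 → a s = 0) : Integrable fun s => a s * b s :=
    integrable_of_zero_off_Ioo (ha.mul hb) fun s hs => by rw [ha0 s hs, zero_mul]
  have x12 : HasInt (fun v => win (deriv K₁) K₂ ψ v * win K₁ (deriv K₂) ψ v) 0 :=
    (HasInt.prod_mul_of_odd_left (hint hk.continuous₁ hk.continuous hk.supp₁)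
      (hint hl.continuous hl.continuous₁ hl.supp)
      (fun s => by rw [ok1, hK.even₁]; ring)).congr (fun v => by simp only [win]; ring) rfl
  have sW : HasInt (fun v => winW K₁ (deriv K₁) K₂ (deriv K₂) ψ v ^ 2) (VSφ K₁ K₂ φ x) :=
    (((s1.const_mul (sin ψ ^ 2)).add (s2.const_mul (cos ψ ^ 2))).add
      (x12.const_mul (2 * sin ψ * cos ψ))).congr
      (fun v => by simp only [win, winW]; ring) (by rw [VSφ, ← hψ]; ring)
  have sP : HasInt (fun v => winP K₁ (deriv K₁) K₂ (deriv K₂) ψ v ^ 2) (VSψ K₁ K₂) := by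
    refine ⟨hP.sq.integrable ψ, ?_⟩
    have hi := hP.sq.integrable ψ
    rw [Measure.volume_eq_prod] at hi ⊢
    rw [integral_prod_symm _ hi, VSψ]
    have hin (z₂ : ℝ) : ∫ z₁ in (-1 : ℝ)..1,
        (K₁ z₁ * deriv K₂ z₂ * z₁ - deriv K₁ z₁ * K₂ z₂ * z₂) ^ 2 =
        ∫ z₁, winP K₁ (deriv K₁) K₂ (deriv K₂) ψ (z₁, z₂) ^ 2 := by
      have hz : ∀ z₁, z₁ ∉ Icc (-1 : ℝ) 1 →
          winP K₁ (deriv K₁) K₂ (deriv K₂) ψ (z₁, z₂) ^ 2 = 0 := fun z₁ hz₁ =>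
        hP.sq.supp ψ (z₁, z₂) fun h => hz₁ (Ioo_subset_Icc_self h.1)
      rw [← setIntegral_eq_integral_of_forall_compl_eq_zero hz,
        intervalIntegral.integral_of_le (by norm_num), ← integral_Icc_eq_integral_Ioc]
      refine integral_congr_ae (Eventually.of_forall fun z₁ => ?_)
      simp only [winP]
      ring
    simp only [hin]
    have hz : ∀ z₂, z₂ ∉ Icc (-1 : ℝ) 1 →
        ∫ z₁, winP K₁ (deriv K₁) K₂ (deriv K₂) ψ (z₁, z₂) ^ 2 = 0 := fun z₂ hz₂ =>
      integral_eq_zero_of_ae (Eventually.of_forall fun z₁ =>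
        hP.sq.supp ψ (z₁, z₂) fun h => hz₂ (Ioo_subset_Icc_self h.2))
    rw [← setIntegral_eq_integral_of_forall_compl_eq_zero hz,
      intervalIntegral.integral_of_le (by norm_num), ← integral_Icc_eq_integral_Ioc]
  -- cross terms
  have hrefl {F : ℝ × ℝ → ℝ} (hF : Integrable F) (h : ∀ v, F (-v) = -F v) : HasInt F 0 := by
    refine ⟨hF, ?_⟩
    have := integral_neg_eq_self F volume
    simp only [h, integral_neg] at this
    linarith
  -- Under `v ↦ -v`, `winW` is even while `winP` and `win` are odd, which settles the two products
  -- with `winW`. The product of `winP` and `win` is even, and there oddness in the first coordinate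
  -- alone is used.
  have xWP : HasInt (fun v => winW K₁ (deriv K₁) K₂ (deriv K₂) ψ v *
      winP K₁ (deriv K₁) K₂ (deriv K₂) ψ v) 0 :=
    hrefl ((hW.mul hP).integrable ψ) fun v => by
      simp only [winW, winP, Prod.fst_neg, Prod.snd_neg, ok1, ol1, hK.even₁, hK.odd₂]; ring
  have xW0 : HasInt (fun v => winW K₁ (deriv K₁) K₂ (deriv K₂) ψ v * win K₁ K₂ ψ v) 0 :=
    hrefl ((hW.mul h0).integrable ψ) fun v => by
      simp only [winW, win, Prod.fst_neg, Prod.snd_neg, ok1, ol1, hK.even₁, hK.odd₂]; ring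
  have xP0 : HasInt (fun v => winP K₁ (deriv K₁) K₂ (deriv K₂) ψ v * win K₁ K₂ ψ v) 0 := by
    have c1 : Continuous fun u => u * K₂ u := continuous_id.mul hl.continuous
    have c2 : Continuous fun s => s * K₁ s := continuous_id.mul hk.continuous
    have y1 := HasInt.prod_mul_of_odd_left (hint hk.continuous₁ hk.continuous hk.supp₁)
      (hint hl.continuous c1 hl.supp) (fun s => by rw [ok1, hK.even₁]; ring)
    have y2 := HasInt.prod_mul_of_odd_left (hint hk.continuous c2 hk.supp)
      (hint hl.continuous hl.continuous₁ hl.supp) (fun s => by rw [hK.even₁]; ring)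
    exact (y1.sub y2).congr (fun v => by simp only [winP, win]; ring) (sub_zero 0)
  have htot := ((((sW.const_mul (α ^ 2)).add (sP.const_mul (β ^ 2))).add
    (s3.const_mul (γ ^ 2))).add (((xWP.const_mul (2 * α * β)).add
      (xW0.const_mul (2 * α * γ))).add (xP0.const_mul (2 * β * γ))))
  exact (htot.congr (fun v => by ring) (by ring)).2

end KernelAssumption

/-! ### Events with probability tending to one -/

section highProb
variable {Ω : Type*} [MeasurableSpace Ω]

/-- The events `E n` hold with (outer) probability tending to one. -/
def WithHighProb (P : Measure Ω) (E : ℕ → Ω → Prop) : Prop :=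
  Tendsto (fun n => P {ω | ¬ E n ω}) atTop (𝓝 0)

variable {P : Measure Ω} {E F : ℕ → Ω → Prop}

lemma WithHighProb.and (hE : WithHighProb P E) (hF : WithHighProb P F) :
    WithHighProb P fun n ω => E n ω ∧ F n ω := by
  have h := hE.add hF
  rw [add_zero] at h
  refine tendsto_of_tendsto_of_tendsto_of_le_of_le tendsto_const_nhds h (fun _ => zero_le)
    fun n => (measure_mono fun ω hω => ?_).trans (measure_union_le _ _)
  by_cases h1 : E n ω
  · exact Or.inr fun h2 => hω ⟨h1, h2⟩
  · exact Or.inl h1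

lemma WithHighProb.mono (hE : WithHighProb P E) (h : ∀ᶠ n in atTop, ∀ᵐ ω ∂P, E n ω → F n ω) :
    WithHighProb P F := by
  refine tendsto_of_tendsto_of_tendsto_of_le_of_le' tendsto_const_nhds hE
    (Eventually.of_forall fun _ => zero_le) ?_
  filter_upwards [h] with n hn
  refine measure_mono_ae ?_
  filter_upwards [hn] with ω hω hF hE
  exact hF (hω hE)

lemma WithHighProb.of_le {a : ℕ → ℝ}
    (hE : ∀ᶠ n in atTop, P {ω | ¬ E n ω} ≤ ENNReal.ofReal (a n)) (ha : Tendsto a atTop (𝓝 0)) : WithHighProb P E := by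
  refine tendsto_of_tendsto_of_tendsto_of_le_of_le' tendsto_const_nhds ?_
    (Eventually.of_forall fun _ => zero_le) hE
  simpa using ENNReal.tendsto_ofReal ha

end highProb

/-! ### Uniform laws of large numbers -/

section ulln
variable {Ω : Type*} [MeasurableSpace Ω] {P : Measure Ω} [IsProbabilityMeasure P]
  {ν : Measure ℝ} {σ : ℝ} {ε : (n : ℕ) → Fin n × Fin n → Ω → ℝ} {ξ : (n : ℕ) → Fin n → ℝ}
  {h : ℕ → ℝ} {f : ℝ → ℝ × ℝ → ℝ}

/-- A single block covers these shifts. This version controls the noise in the Hessian. -/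
lemma ErrorAssumption.local_ulln (hε : ErrorAssumption P ν σ ε) (hξ : RegularDesign ξ)
    (hb : BandwidthAssumption h) (hf : IsWindow f) (z : ℝ × ℝ) {s : ℝ} (hs : 0 < s) :
    WithHighProb P fun n ω => ∀ w ∈ Icc (-(1 / 2) : ℝ) (1 / 2), ∀ ψ ∈ Icc (-(π / 2)) (π / 2),
      |localSum (ξ n) (h n) z (fun i => ε n i ω) f w ψ| ≤ s := by
  obtain ⟨hpos, -, hnh, -⟩ := hb.asymptotics
  obtain ⟨C, hC0, hC⟩ := hε.exists_block_bound hξ hf hs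
  refine WithHighProb.of_le (a := fun n => C / (n * h n) ^ 2) ?_
    (((tendsto_pow_atTop two_ne_zero).comp hnh).const_div_atTop C)
  filter_upwards [hpos, hnh.eventually_ge_atTop 1] with n hn hn1
  refine (measure_mono fun ω hω => ?_).trans (hC n (h n) hn hn1 z (-(1 / 2)))
  simp only [mem_ofPred_eq, not_forall, not_le] at hω ⊢
  obtain ⟨w, hw, ψ, hψ, hlt⟩ := hω
  exact ⟨w, ⟨hw.1, by linarith [hw.2]⟩, ψ, hψ, hlt⟩

/-- As `y` runs through `[0,1]` the shift runs through an interval of length `1 / h`, covered by at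
most `2 / h` unit blocks. This version controls the contrast itself and yields consistency. -/
lemma ErrorAssumption.global_ulln (hε : ErrorAssumption P ν σ ε) (hξ : RegularDesign ξ)
    (hb : BandwidthAssumption h) (hf : IsWindow f) (x y₀ : ℝ) {s : ℝ} (hs : 0 < s) :
    WithHighProb P fun n ω => ∀ y ∈ Icc (0 : ℝ) 1, ∀ ψ ∈ Icc (-(π / 2)) (π / 2),
      |localSum (ξ n) (h n) (x, y₀) (fun i => ε n i ω) f ((y - y₀) / h n) ψ| ≤ s := by
  obtain ⟨hpos, h0, hnh, hnh3⟩ := hb.asymptotics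
  obtain ⟨C, hC0, hC⟩ := hε.exists_block_bound hξ hf hs
  refine WithHighProb.of_le (a := fun n => 2 * C / ((n * h n) ^ 2 * h n)) ?_
    (hnh3.const_div_atTop (2 * C))
  filter_upwards [hpos, hnh.eventually_ge_atTop 1, h0.eventually (gt_mem_nhds one_pos)]
    with n hn hn1 hlt1
  set B : ℕ → Set Ω := fun j => {ω | ∃ w ∈ Icc (-y₀ / h n + j) (-y₀ / h n + j + 1),
    ∃ ψ ∈ Icc (-(π / 2)) (π / 2),
      s < |localSum (ξ n) (h n) (x, y₀) (fun i => ε n i ω) f w ψ|} with hB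
  have hsub : {ω | ¬ ∀ y ∈ Icc (0 : ℝ) 1, ∀ ψ ∈ Icc (-(π / 2)) (π / 2),
      |localSum (ξ n) (h n) (x, y₀) (fun i => ε n i ω) f ((y - y₀) / h n) ψ| ≤ s} ⊆
      ⋃ j ∈ Finset.range (⌊1 / h n⌋₊ + 1), B j := by
    intro ω hω
    simp only [mem_ofPred_eq, not_forall, not_le] at hω
    obtain ⟨y, hy, ψ, hψ, hlt⟩ := hω
    have hy0 : 0 ≤ y / h n := div_nonneg hy.1 hn.le
    refine mem_iUnion₂.2 ⟨⌊y / h n⌋₊, ?_, ?_⟩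
    · rw [Finset.mem_range, Nat.lt_add_one_iff]
      exact Nat.floor_le_floor (div_le_div_of_nonneg_right hy.2 hn.le)
    · have e : (y - y₀) / h n = -y₀ / h n + y / h n := by ring
      refine ⟨(y - y₀) / h n, ⟨?_, ?_⟩, ψ, hψ, hlt⟩
      · rw [e]; linarith [Nat.floor_le hy0]
      · rw [e]; linarith [Nat.lt_floor_add_one (y / h n)]
  refine (measure_mono hsub).trans ((measure_biUnion_finset_le _ _).trans ?_)
  refine (Finset.sum_le_sum fun (j : ℕ) _ => hC n (h n) hn hn1 (x, y₀) (-y₀ / h n + (j : ℝ))).trans ?_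
  rw [Finset.sum_const, Finset.card_range, nsmul_eq_mul,
    ← ENNReal.ofReal_natCast, ← ENNReal.ofReal_mul (Nat.cast_nonneg _)]
  refine ENNReal.ofReal_le_ofReal ?_
  have h1 : 1 ≤ 1 / h n := by rw [le_div_iff₀ hn]; linarith
  have h2 : ((⌊1 / h n⌋₊ + 1 : ℕ) : ℝ) ≤ 2 / h n := by
    push_cast
    have := Nat.floor_le (show 0 ≤ 1 / h n by positivity)
    have e : 2 / h n = 1 / h n + 1 / h n := by ring
    linarith
  calc _ ≤ 2 / h n * (C / (n * h n) ^ 2) := by gcongr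
    _ = _ := by field_simp

end ulln

/-! ### First-order conditions -/

lemma detContrast_observation {Ω : Type*} [MeasurableSpace Ω] {P : Measure Ω}
    [IsProbabilityMeasure P] {ν : Measure ℝ} {σ : ℝ} {ε : (n : ℕ) → Fin n × Fin n → Ω → ℝ}
    (hε : ErrorAssumption P ν σ ε) (m : ℝ × ℝ → ℝ) (τ φ K₁ K₂ : ℝ → ℝ) {n : ℕ} (ξ : Fin n → ℝ)
    (z : Fin 2 → ℝ) (ψ h : ℝ) :
    detContrast P K₁ K₂ ξ (observation m τ φ ξ (ε n)) z ψ h =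
      empContrast K₁ K₂ ξ (fun i => jumpImage m τ φ (ξ i.1) (ξ i.2)) z ψ h := by
  unfold detContrast empContrast observation
  rw [integral_const_mul, integral_finsetSum]
  · congr 1
    refine Finset.sum_congr rfl fun i _ => ?_
    rw [integral_mul_const, integral_add (integrable_const _) (hε.integrable_error n i),
      hε.integral_error, integral_const, add_zero]
    simp
  · intro i _
    exact ((integrable_const _).add (hε.integrable_error n i)).mul_const _

lemma localSum_eq_zero_of_isArgmaxOn {K₁ K₂ : ℝ → ℝ} (hK : KernelAssumption K₁ K₂) {n : ℕ}
    {ξ : Fin n → ℝ} {Y : Fin n × Fin n → ℝ} {x y₀ y ψ h : ℝ} (hh : 0 < h)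
    (hmax : IsArgmaxOn (fun p => empContrast K₁ K₂ ξ Y ![x, p.1] p.2 h) (searchRange h) (y, ψ))
    (hy : y ∈ Ioo (√2 * h) (1 - √2 * h)) (hψ : ψ ∈ Ioo (-(π / 2)) (π / 2)) :
    localSum ξ h (x, y₀) Y (winW K₁ (deriv K₁) K₂ (deriv K₂)) ((y - y₀) / h) ψ = 0 ∧
      localSum ξ h (x, y₀) Y (winP K₁ (deriv K₁) K₂ (deriv K₂)) ((y - y₀) / h) ψ = 0 := by
  have key (α β : ℝ) :
      α * localSum ξ h (x, y₀) Y (winW K₁ (deriv K₁) K₂ (deriv K₂)) ((y - y₀) / h) ψ +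
        β * localSum ξ h (x, y₀) Y (winP K₁ (deriv K₁) K₂ (deriv K₂)) ((y - y₀) / h) ψ = 0 := by
    have hd := (hasPathDeriv_win hK.c2₁ hK.c2₂).localSum ξ h (x, y₀) Y ((y - y₀) / h) ψ α β 0
    simp only [zero_mul, add_zero] at hd
    refine IsLocalMax.hasDerivAt_eq_zero ?_ hd
    have h1 : Tendsto (fun t : ℝ => y + h * (t * α)) (𝓝 0) (𝓝 y) := by
      have : Continuous fun t : ℝ => y + h * (t * α) := by fun_prop
      simpa using this.tendsto 0
    have h2 : Tendsto (fun t : ℝ => ψ + t * β) (𝓝 0) (𝓝 ψ) := by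
      have : Continuous fun t : ℝ => ψ + t * β := by fun_prop
      simpa using this.tendsto 0
    filter_upwards [h1 (Ioo_mem_nhds hy.1 hy.2), h2 (Ioo_mem_nhds hψ.1 hψ.2)] with t ht1 ht2
    have hle := hmax.2 (show (y + h * (t * α), ψ + t * β) ∈ searchRange h from
      ⟨Ioo_subset_Icc_self ht1, Ioo_subset_Icc_self ht2⟩)
    simp only [mem_ofPred_eq] at hle
    rw [empContrast_eq_localSum K₁ K₂ ξ Y x _ y₀ _ hh.ne',
      empContrast_eq_localSum K₁ K₂ ξ Y x _ y₀ _ hh.ne'] at hle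
    have e : (y + h * (t * α) - y₀) / h = (y - y₀) / h + t * α := by field_simp; ring
    rw [e] at hle
    simpa using hle
  have k1 := key 1 0
  have k2 := key 0 1
  constructor <;> linarith

/-! ### Consistency -/

section det
variable {m : ℝ × ℝ → ℝ} {τ φ K₁ K₂ : ℝ → ℝ} {x : ℝ} {ξ : (n : ℕ) → Fin n → ℝ} {h : ℕ → ℝ}

lemma slopeAngle_mem : slopeAngle φ x ∈ Ioo (-(π / 2)) (π / 2) := Real.arctan_mem_Ioo _

/-- Uniformity comes from convergence along the product filter of `n → ∞` and `(w, ψ) → (0,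
slopeAngle φ x)`; this is one reason for stating the limit theorems for a general filter. -/
lemma eventually_localSum_near (hs : SmoothnessAssumption m τ φ) (hx : x ∈ Ioo (0 : ℝ) 1)
    (hξ : RegularDesign ξ) (hb : BandwidthAssumption h) {f : ℝ → ℝ × ℝ → ℝ} (hf : IsWindow f)
    {I : ℝ} (hI : ∫ v, (m (x, φ x) + τ x * (jumpRegion (cos (slopeAngle φ x)) 0 0).indicator
      (fun _ => 1) v) * f (slopeAngle φ x) v = I) {η : ℝ} (hη : 0 < η) :
    ∃ ρ > 0, ∀ᶠ n in atTop, ∀ w ψ, |w| ≤ ρ → |ψ - slopeAngle φ x| ≤ ρ →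
      |localSum (ξ n) (h n) (x, φ x) (fun i => jumpImage m τ φ (ξ n i.1) (ξ n i.2)) f w ψ - I|
        ≤ η := by
  have hlim := tendsto_localSum_of_tendsto (L := atTop ×ˢ 𝓝 ((0 : ℝ), slopeAngle φ x)) hs hx hξ hb
    (N := fun k => k.1) (w := fun k => k.2.1) (ψ := fun k => k.2.2) tendsto_fst
    (ψ₀ := slopeAngle φ x) (w₀ := 0)
    ((continuous_snd.tendsto ((0 : ℝ), slopeAngle φ x)).comp tendsto_snd)
    ((continuous_fst.tendsto ((0 : ℝ), slopeAngle φ x)).comp tendsto_snd) hf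
  rw [sub_self, hI] at hlim
  have hev := hlim.eventually (Metric.closedBall_mem_nhds I hη)
  rw [Filter.eventually_prod_iff] at hev
  obtain ⟨p, hp, q, hq, hpq⟩ := hev
  obtain ⟨ρ, hρ, hρq⟩ := Metric.eventually_nhds_iff.1 hq
  refine ⟨ρ / 2, half_pos hρ, hp.mono fun n hn w ψ hw hψ => ?_⟩
  have hd : dist (w, ψ) ((0 : ℝ), slopeAngle φ x) < ρ := by
    rw [Prod.dist_eq, Real.dist_eq, Real.dist_eq, max_lt_iff]
    constructor
    · simp only [sub_zero]; linarith
    · simp only; linarith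
  have := hpq hn (hρq hd)
  rwa [Real.dist_eq] at this

lemma tendsto_contrast_center (hs : SmoothnessAssumption m τ φ) (hx : x ∈ Ioo (0 : ℝ) 1)
    (hξ : RegularDesign ξ) (hb : BandwidthAssumption h) (hK : KernelAssumption K₁ K₂) :
    Tendsto (fun n => localSum (ξ n) (h n) (x, φ x)
      (fun i => jumpImage m τ φ (ξ n i.1) (ξ n i.2)) (win K₁ K₂) 0 (slopeAngle φ x)) atTop
      (𝓝 (τ x)) := by
  have hlim := tendsto_localSum_of_tendsto (L := atTop) hs hx hξ hb (N := fun n => n)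
    (w := fun _ => 0) (ψ := fun _ => slopeAngle φ x) tendsto_id
    tendsto_const_nhds tendsto_const_nhds (isWindow_win hK.c2₁ hK.c2₂)
  rwa [sub_self, hK.integral_image_win, hK.integral_jumpRegion_win_zero, mul_one] at hlim

/-- Near-maximizers of the deterministic contrast are close to the true parameters. -/
lemma exists_near_of_contrast_ge (hs : SmoothnessAssumption m τ φ) (hx : x ∈ Ioo (0 : ℝ) 1)
    (hξ : RegularDesign ξ) (hb : BandwidthAssumption h) (hK : KernelAssumption K₁ K₂)
    {ρ : ℝ} (hρ : 0 < ρ) :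
    ∃ c > 0, ∀ᶠ n in atTop, ∀ p ∈ searchRange (h n),
      τ x - c ≤ localSum (ξ n) (h n) (x, φ x) (fun i => jumpImage m τ φ (ξ n i.1) (ξ n i.2))
        (win K₁ K₂) ((p.1 - φ x) / h n) p.2 →
      |(p.1 - φ x) / h n| < ρ ∧ |p.2 - slopeAngle φ x| < ρ := by
  by_contra hcon
  push Not at hcon
  obtain ⟨hpos, h0, hnh, -⟩ := hb.asymptotics
  obtain ⟨N, hNmono, hN⟩ := extraction_forall_of_frequently (fun k : ℕ =>
    (hcon (1 / ((k : ℝ) + 1)) (by positivity)).and_eventually hpos)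
  choose hN hNpos using hN
  choose p hp hge hfar using hN
  set w : ℕ → ℝ := fun k => ((p k).1 - φ x) / h (N k) with hw
  have hτ : 0 < τ x := hs.pos_τ x (Ioo_subset_Icc_self hx)
  have hyk (k : ℕ) : φ x + h (N k) * w k = (p k).1 := by
    have := (hNpos k).ne'
    simp only [hw]
    field_simp
    ring
  have h01 (k : ℕ) : (p k).1 ∈ Icc (0 : ℝ) 1 := by
    have h1 : 0 ≤ √2 * h (N k) := mul_nonneg (Real.sqrt_nonneg _) (hNpos k).le
    exact ⟨h1.trans (hp k).1.1, (hp k).1.2.trans (by linarith)⟩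
  -- The shifts may be unbounded, so they are compactified in `EReal`. Infinite limits contradict `τ
  -- x > 0` because the contrast then tends to 0. Finite ones are excluded by the unique maximum of
  -- the limit, except the true point, which contradicts `hfar`.
  have hcomp : IsCompact ((univ : Set EReal) ×ˢ (Icc (0 : ℝ) 1 ×ˢ Icc (-(π / 2)) (π / 2))) :=
    isCompact_univ.prod (isCompact_Icc.prod isCompact_Icc)
  obtain ⟨q, hq, θ, hθ, hlim⟩ := hcomp.tendsto_subseq
    (x := fun k => ((w k : EReal), (p k).1, (p k).2)) fun k => ⟨mem_univ _, h01 k, (hp k).2⟩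
  have hNθ : Tendsto (fun k => N (θ k)) atTop atTop := (hNmono.comp hθ).tendsto_atTop
  have lw : Tendsto (fun k => (w (θ k) : EReal)) atTop (𝓝 q.1) :=
    (continuous_fst.tendsto q).comp hlim
  have ly : Tendsto (fun k => φ x + h (N (θ k)) * w (θ k)) atTop (𝓝 q.2.1) := by
    simp only [hyk]
    exact (continuous_fst.comp continuous_snd).tendsto q |>.comp hlim
  have lψ : Tendsto (fun k => (p (θ k)).2) atTop (𝓝 q.2.2) :=
    (continuous_snd.comp continuous_snd).tendsto q |>.comp hlim
  have hlow : Tendsto (fun k : ℕ => τ x - 1 / (((θ k : ℕ) : ℝ) + 1)) atTop (𝓝 (τ x)) := by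
    simpa using (tendsto_one_div_add_atTop_nhds_zero_nat.comp hθ.tendsto_atTop).const_sub (τ x)
  have hwin := isWindow_win hK.c2₁ hK.c2₂
  have hrange : ∀ᶠ k in atTop, φ x + h (N (θ k)) * w (θ k) ∈
      Icc (√2 * h (N (θ k))) (1 - √2 * h (N (θ k))) :=
    Eventually.of_forall fun k => by rw [hyk]; exact (hp (θ k)).1
  have hinf (hw' : Tendsto (fun k => w (θ k)) atTop atTop ∨ Tendsto (fun k => w (θ k)) atTop atBot) :
      False := by
    have hl := tendsto_localSum_of_tendsto_infty hs hx hξ hb hNθ lψ ly hq.2.1 hrange hw' hwin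
      (hK.integral_win _)
    have := le_of_tendsto_of_tendsto' hlow hl fun k => hge (θ k)
    linarith
  rcases hq1 : q.1 with _ | _ | r
  · rw [hq1] at lw
    exact hinf (Or.inr (EReal.tendsto_coe_nhds_bot_iff.1 lw))
  · rw [hq1] at lw
    exact hinf (Or.inl (EReal.tendsto_coe_nhds_top_iff.1 lw))
  · rw [hq1] at lw
    have lw' : Tendsto (fun k => w (θ k)) atTop (𝓝 r) := EReal.tendsto_coe.1 lw
    have hl := tendsto_localSum_of_tendsto hs hx hξ hb hNθ lψ lw' hwin
    rw [hK.integral_image_win] at hl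
    have hle := le_of_tendsto_of_tendsto' hlow hl fun k => hge (θ k)
    have hψ0 := slopeAngle_mem (φ := φ) (x := x)
    by_cases hne : r ≠ 0 ∨ q.2.2 - slopeAngle φ x ≠ 0
    · have := hK.integral_jumpRegion_win_lt (ψ := q.2.2)
        (show 0 < cos (slopeAngle φ x) from Real.cos_arctan_pos _)
        (by linarith [hq.2.2.1, hψ0.2]) (by linarith [hq.2.2.2, hψ0.1]) hne
      nlinarith
    · push Not at hne
      rw [hne.1] at lw'
      rw [sub_eq_zero.1 hne.2] at lψ
      have e1 : ∀ᶠ k in atTop, |w (θ k)| < ρ := by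
        have := lw'.abs
        rw [abs_zero] at this
        exact this.eventually (gt_mem_nhds hρ)
      have e2 : ∀ᶠ k in atTop, |(p (θ k)).2 - slopeAngle φ x| < ρ := by
        have := (lψ.sub_const (slopeAngle φ x)).abs
        rw [sub_self, abs_zero] at this
        exact this.eventually (gt_mem_nhds hρ)
      obtain ⟨k, hk1, hk2⟩ := (e1.and e2).exists
      exact absurd hk2 (not_lt.2 (hfar (θ k) hk1))

end det

/-! ### Mean value estimates -/

/-- `f` has partial derivatives `p` and `q` along all line segments. -/
def HasPartials (f p q : ℝ → ℝ → ℝ) : Prop :=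
  ∀ w ψ α β t : ℝ, HasDerivAt (fun t => f (w + t * α) (ψ + t * β))
    (α * p (w + t * α) (ψ + t * β) + β * q (w + t * α) (ψ + t * β)) t

lemma HasPartials.exists_mean_value {f p q : ℝ → ℝ → ℝ} (hf : HasPartials f p q)
    (w₀ ψ₀ w₁ ψ₁ : ℝ) : ∃ t ∈ Ioo (0 : ℝ) 1, f w₁ ψ₁ - f w₀ ψ₀ =
      (w₁ - w₀) * p (w₀ + t * (w₁ - w₀)) (ψ₀ + t * (ψ₁ - ψ₀)) +
        (ψ₁ - ψ₀) * q (w₀ + t * (w₁ - w₀)) (ψ₀ + t * (ψ₁ - ψ₀)) := by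
  have hd := fun t => hf w₀ ψ₀ (w₁ - w₀) (ψ₁ - ψ₀) t
  obtain ⟨t, ht, he⟩ := exists_hasDerivAt_eq_slope _ _ (zero_lt_one' ℝ)
    (fun t _ => (hd t).continuousAt.continuousWithinAt) fun t _ => hd t
  refine ⟨t, ht, ?_⟩
  rw [he]
  simp

lemma abs_segment_le {a b c r t : ℝ} (ht : t ∈ Ioo (0 : ℝ) 1) (ha : |a - c| ≤ r)
    (hb : |b - c| ≤ r) : |a + t * (b - a) - c| ≤ r := by
  rw [abs_le] at *
  have h0 := ht.1
  have h1 := ht.2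
  constructor <;> nlinarith

lemma HasPartials.abs_sub_sub_le {f p q : ℝ → ℝ → ℝ} (hf : HasPartials f p q)
    {a b η ρ ψc : ℝ} (hp : ∀ w ψ, |w| ≤ ρ → |ψ - ψc| ≤ ρ → |p w ψ - a| ≤ η)
    (hq : ∀ w ψ, |w| ≤ ρ → |ψ - ψc| ≤ ρ → |q w ψ - b| ≤ η) {w₀ ψ₀ w₁ ψ₁ : ℝ}
    (hw₀ : |w₀| ≤ ρ) (hψ₀ : |ψ₀ - ψc| ≤ ρ) (hw₁ : |w₁| ≤ ρ) (hψ₁ : |ψ₁ - ψc| ≤ ρ) :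
    |f w₁ ψ₁ - f w₀ ψ₀ - (a * (w₁ - w₀) + b * (ψ₁ - ψ₀))| ≤
      η * (|w₁ - w₀| + |ψ₁ - ψ₀|) := by
  obtain ⟨t, ht, he⟩ := hf.exists_mean_value w₀ ψ₀ w₁ ψ₁
  have h1 : |w₀ + t * (w₁ - w₀)| ≤ ρ := by
    simpa using abs_segment_le (c := 0) ht (by simpa using hw₀) (by simpa using hw₁)
  have h2 := abs_segment_le ht hψ₀ hψ₁
  have hp' := hp _ _ h1 h2
  have hq' := hq _ _ h1 h2
  set P := p (w₀ + t * (w₁ - w₀)) (ψ₀ + t * (ψ₁ - ψ₀))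
  set Q := q (w₀ + t * (w₁ - w₀)) (ψ₀ + t * (ψ₁ - ψ₀))
  rw [he]
  have e : (w₁ - w₀) * P + (ψ₁ - ψ₀) * Q - (a * (w₁ - w₀) + b * (ψ₁ - ψ₀)) =
      (w₁ - w₀) * (P - a) + (ψ₁ - ψ₀) * (Q - b) := by ring
  rw [e]
  refine (abs_add_le _ _).trans ?_
  rw [abs_mul, abs_mul, mul_add, mul_comm η, mul_comm η]
  gcongr

/-- The estimates behind one Newton step: `(w₁, ψ₁)` is a critical point of `M` and the Hessian of
`M` is close to `diag(-A, -B)`. -/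
lemma newton_estimates {M p q pp r qq : ℝ → ℝ → ℝ} (hM : HasPartials M p q)
    (hp : HasPartials p pp r) (hq : HasPartials q r qq) {A B η ρ ψc : ℝ} (hA : 0 ≤ A) (hB : 0 ≤ B)
    (hη : 0 ≤ η)
    (hpp : ∀ w ψ, |w| ≤ ρ → |ψ - ψc| ≤ ρ → |pp w ψ - -A| ≤ η)
    (hr : ∀ w ψ, |w| ≤ ρ → |ψ - ψc| ≤ ρ → |r w ψ - 0| ≤ η)
    (hqq : ∀ w ψ, |w| ≤ ρ → |ψ - ψc| ≤ ρ → |qq w ψ - -B| ≤ η) {w₀ ψ₀ w₁ ψ₁ : ℝ}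
    (hw₀ : |w₀| ≤ ρ) (hψ₀ : |ψ₀ - ψc| ≤ ρ) (hw₁ : |w₁| ≤ ρ) (hψ₁ : |ψ₁ - ψc| ≤ ρ)
    (hp₁ : p w₁ ψ₁ = 0) (hq₁ : q w₁ ψ₁ = 0) :
    |p w₀ ψ₀ - A * (w₁ - w₀)| ≤ η * (|w₁ - w₀| + |ψ₁ - ψ₀|) ∧
    |q w₀ ψ₀ - B * (ψ₁ - ψ₀)| ≤ η * (|w₁ - w₀| + |ψ₁ - ψ₀|) ∧
    |M w₁ ψ₁ - M w₀ ψ₀| ≤ (A + B + 2 * η) * (|w₁ - w₀| + |ψ₁ - ψ₀|) ^ 2 := by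
  have P1 {w ψ : ℝ} (hw : |w| ≤ ρ) (hψ : |ψ - ψc| ≤ ρ) :
      |p w ψ - A * (w₁ - w)| ≤ η * (|w₁ - w| + |ψ₁ - ψ|) := by
    have := hp.abs_sub_sub_le hpp hr hw hψ hw₁ hψ₁
    rw [hp₁, ← abs_neg] at this
    convert this using 2
    ring
  have Q1 {w ψ : ℝ} (hw : |w| ≤ ρ) (hψ : |ψ - ψc| ≤ ρ) :
      |q w ψ - B * (ψ₁ - ψ)| ≤ η * (|w₁ - w| + |ψ₁ - ψ|) := by
    have := hq.abs_sub_sub_le hr hqq hw hψ hw₁ hψ₁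
    rw [hq₁, ← abs_neg] at this
    convert this using 2
    ring
  refine ⟨P1 hw₀ hψ₀, Q1 hw₀ hψ₀, ?_⟩
  -- The gradient at the intermediate point is itself linear in the distance to the critical point,
  -- which makes the change in `M` quadratic.
  obtain ⟨t, ht, he⟩ := hM.exists_mean_value w₀ ψ₀ w₁ ψ₁
  have h1 : |w₀ + t * (w₁ - w₀)| ≤ ρ := by
    simpa using abs_segment_le (c := 0) ht (by simpa using hw₀) (by simpa using hw₁)
  have h2 := abs_segment_le ht hψ₀ hψ₁
  have e1 : |w₁ - (w₀ + t * (w₁ - w₀))| ≤ |w₁ - w₀| := by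
    rw [show w₁ - (w₀ + t * (w₁ - w₀)) = (1 - t) * (w₁ - w₀) by ring, abs_mul]
    refine mul_le_of_le_one_left (abs_nonneg _) ?_
    rw [abs_le]; constructor <;> linarith [ht.1, ht.2]
  have e2 : |ψ₁ - (ψ₀ + t * (ψ₁ - ψ₀))| ≤ |ψ₁ - ψ₀| := by
    rw [show ψ₁ - (ψ₀ + t * (ψ₁ - ψ₀)) = (1 - t) * (ψ₁ - ψ₀) by ring, abs_mul]
    refine mul_le_of_le_one_left (abs_nonneg _) ?_
    rw [abs_le]; constructor <;> linarith [ht.1, ht.2]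
  have hP := P1 h1 h2
  have hQ := Q1 h1 h2
  rw [he]
  set D := |w₁ - w₀| + |ψ₁ - ψ₀| with hD
  have d1 : |w₁ - w₀| ≤ D := by rw [hD]; linarith [abs_nonneg (ψ₁ - ψ₀)]
  have d2 : |ψ₁ - ψ₀| ≤ D := by rw [hD]; linarith [abs_nonneg (w₁ - w₀)]
  have hD0 : 0 ≤ D := (abs_nonneg _).trans d1
  have hPb : |p (w₀ + t * (w₁ - w₀)) (ψ₀ + t * (ψ₁ - ψ₀))| ≤ (A + η) * D := by
    have := abs_sub_abs_le_abs_sub (p (w₀ + t * (w₁ - w₀)) (ψ₀ + t * (ψ₁ - ψ₀)))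
      (A * (w₁ - (w₀ + t * (w₁ - w₀))))
    have k1 : |A * (w₁ - (w₀ + t * (w₁ - w₀)))| ≤ A * D := by
      rw [abs_mul, abs_of_nonneg hA]; gcongr; exact e1.trans d1
    have k2 : η * (|w₁ - (w₀ + t * (w₁ - w₀))| + |ψ₁ - (ψ₀ + t * (ψ₁ - ψ₀))|) ≤ η * D := by
      gcongr
      exact add_le_add e1 e2
    linarith
  have hQb : |q (w₀ + t * (w₁ - w₀)) (ψ₀ + t * (ψ₁ - ψ₀))| ≤ (B + η) * D := by
    have := abs_sub_abs_le_abs_sub (q (w₀ + t * (w₁ - w₀)) (ψ₀ + t * (ψ₁ - ψ₀)))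
      (B * (ψ₁ - (ψ₀ + t * (ψ₁ - ψ₀))))
    have k1 : |B * (ψ₁ - (ψ₀ + t * (ψ₁ - ψ₀)))| ≤ B * D := by
      rw [abs_mul, abs_of_nonneg hB]; gcongr; exact e2.trans d2
    have k2 : η * (|w₁ - (w₀ + t * (w₁ - w₀))| + |ψ₁ - (ψ₀ + t * (ψ₁ - ψ₀))|) ≤ η * D := by
      gcongr
      exact add_le_add e1 e2
    linarith
  refine (abs_add_le _ _).trans ?_
  rw [abs_mul, abs_mul]
  calc _ ≤ D * ((A + η) * D) + D * ((B + η) * D) := by gcongr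
    _ = _ := by ring

/-- The Newton step on the scale `N`. -/
lemma newton_scaled {A B η Λ N dw dψ s₁ s₂ κ dM : ℝ} (hκ : 0 < κ) (hA : κ ≤ A) (hB : κ ≤ B)
    (hN : 0 < N) (hη : η ≤ κ / 4) (hη0 : 0 ≤ η)
    (h1 : |s₁ - A * dw| ≤ η * (|dw| + |dψ|)) (h2 : |s₂ - B * dψ| ≤ η * (|dw| + |dψ|))
    (h3 : |dM| ≤ (A + B + 2 * η) * (|dw| + |dψ|) ^ 2) (hs₁ : |N * s₁| ≤ Λ) (hs₂ : |N * s₂| ≤ Λ) :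
    |N * dw - N * s₁ / A| ≤ 4 * Λ * η / κ ^ 2 ∧ |N * dψ - N * s₂ / B| ≤ 4 * Λ * η / κ ^ 2 ∧
      |N * dM| ≤ (A + B + κ) * (4 * Λ / κ) ^ 2 / N := by
  have hA0 : 0 < A := hκ.trans_le hA
  have hB0 : 0 < B := hκ.trans_le hB
  rw [abs_mul, abs_of_pos hN] at hs₁ hs₂
  set D := |dw| + |dψ| with hD
  have hD0 : 0 ≤ D := by positivity
  have hAd : A * |dw| ≤ |s₁| + η * D := by
    have := abs_sub_abs_le_abs_sub (A * dw) s₁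
    rw [abs_sub_comm, abs_mul, abs_of_pos hA0] at this
    linarith
  have hBd : B * |dψ| ≤ |s₂| + η * D := by
    have := abs_sub_abs_le_abs_sub (B * dψ) s₂
    rw [abs_sub_comm, abs_mul, abs_of_pos hB0] at this
    linarith
  have k1 : κ * |dw| ≤ A * |dw| := by gcongr
  have k2 : κ * |dψ| ≤ B * |dψ| := by gcongr
  have k3 : η * D ≤ κ / 4 * D := by gcongr
  -- The two error terms add up to at most `2 η D ≤ κ D / 2`, which is absorbed on the left.
  have hDS : κ * D ≤ 2 * (|s₁| + |s₂|) := by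
    have : κ * D = κ * |dw| + κ * |dψ| := by rw [hD]; ring
    linarith
  have hND : N * D ≤ 4 * Λ / κ := by
    rw [le_div_iff₀ hκ]
    nlinarith
  have hΛ : 0 ≤ Λ := (by positivity : 0 ≤ N * |s₁|).trans hs₁
  have main {C d s : ℝ} (hC : κ ≤ C) (h : |s - C * d| ≤ η * D) :
      |N * d - N * s / C| ≤ 4 * Λ * η / κ ^ 2 := by
    have hC0 : 0 < C := hκ.trans_le hC
    have e : N * d - N * s / C = -(N * (s - C * d) / C) := by field_simp; ring
    rw [e, abs_neg, abs_div, abs_mul, abs_of_pos hN, abs_of_pos hC0]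
    calc N * |s - C * d| / C ≤ N * (η * D) / κ := by gcongr
      _ = η * (N * D) / κ := by ring
      _ ≤ η * (4 * Λ / κ) / κ := by gcongr
      _ = _ := by field_simp
  refine ⟨main hA h1, main hB h2, ?_⟩
  rw [abs_mul, abs_of_pos hN]
  calc N * |dM| ≤ N * ((A + B + 2 * η) * D ^ 2) := by gcongr
    _ = (A + B + 2 * η) * (N * D) ^ 2 / N := by field_simp
    _ ≤ (A + B + κ) * (4 * Λ / κ) ^ 2 / N := by gcongr; linarith

/-! ### Positivity of the limiting constants -/

section positivity
variable {m : ℝ × ℝ → ℝ} {τ φ K₁ K₂ : ℝ → ℝ} {x : ℝ}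

lemma VHφ_pos (hs : SmoothnessAssumption m τ φ) (hK : KernelAssumption K₁ K₂)
    (hx : x ∈ Ioo (0 : ℝ) 1) : 0 < VHφ K₂ τ φ x := by
  have h1 := hs.pos_τ x (Ioo_subset_Icc_self hx)
  have h2 : 0 < cos (slopeAngle φ x) := Real.cos_arctan_pos _
  have h3 := hK.deriv_pos₂
  unfold VHφ
  positivity

lemma VHψ_pos (hs : SmoothnessAssumption m τ φ) (hK : KernelAssumption K₁ K₂)
    (hx : x ∈ Ioo (0 : ℝ) 1) : 0 < VHψ K₁ K₂ τ x := by
  have h1 := hs.pos_τ x (Ioo_subset_Icc_self hx)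
  have h3 := hK.deriv_pos₂
  have hc : Continuous K₁ := hK.c2₁.continuous
  have h2 : 0 < ∫ y in (-1 : ℝ)..1, y ^ 2 * K₁ y := by
    refine intervalIntegral.integral_pos (by norm_num) (by fun_prop) (fun y hy => ?_)
      ⟨1 / 2, by norm_num, ?_⟩
    · rcases hy.2.eq_or_lt with rfl | hlt
      · have h0 := (hK.boundary₁ 0 (by norm_num)).2
        rw [iteratedDerivWithin_zero] at h0
        simp [h0]
      · exact mul_nonneg (sq_nonneg _) (hK.pos₁ y ⟨hy.1, hlt⟩).le
    · exact mul_pos (by norm_num) (hK.pos₁ _ (by norm_num))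
  unfold VHψ
  positivity

lemma posSemidef_smul_asympCov (σ : ℝ) (K₁ K₂ τ φ : ℝ → ℝ) (x : ℝ) :
    (σ ^ 2 • asympCov K₁ K₂ τ φ x).PosSemidef := by
  refine Matrix.PosSemidef.smul (Matrix.PosSemidef.diagonal fun i => ?_) (sq_nonneg σ)
  have h1 : 0 ≤ VSφ K₁ K₂ φ x := by
    unfold VSφ
    have k1 := integral_nonneg (μ := volume.restrict (Icc (-1 : ℝ) 1 ×ˢ Icc (-1 : ℝ) 1))
      (f := fun z : ℝ × ℝ => (deriv K₁ z.1 * K₂ z.2) ^ 2) fun z => sq_nonneg _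
    have k2 := integral_nonneg (μ := volume.restrict (Icc (-1 : ℝ) 1 ×ˢ Icc (-1 : ℝ) 1))
      (f := fun z : ℝ × ℝ => (K₁ z.1 * deriv K₂ z.2) ^ 2) fun z => sq_nonneg _
    positivity
  have h2 : 0 ≤ VSψ K₁ K₂ := by
    unfold VSψ
    refine intervalIntegral.integral_nonneg_of_forall (by norm_num) fun z => ?_
    exact intervalIntegral.integral_nonneg_of_forall (by norm_num) fun y => sq_nonneg _
  have h3 : 0 ≤ VSτ K₁ K₂ := integral_nonneg fun z => sq_nonneg _
  fin_cases i
  · exact div_nonneg h1 (sq_nonneg _)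
  · exact div_nonneg h2 (sq_nonneg _)
  · exact h3

end positivity

/-! ### Maximizers of perturbed contrasts -/

section perturbed
variable {m : ℝ × ℝ → ℝ} {τ φ K₁ K₂ : ℝ → ℝ} {x : ℝ} {ξ : (n : ℕ) → Fin n → ℝ} {h : ℕ → ℝ}

/-- A maximizer of a contrast with uniformly small noise is close to the true parameters, and it
satisfies the first-order conditions. -/
lemma exists_near_of_isArgmaxOn (hs : SmoothnessAssumption m τ φ) (hx : x ∈ Ioo (0 : ℝ) 1)
    (hξ : RegularDesign ξ) (hb : BandwidthAssumption h) (hK : KernelAssumption K₁ K₂)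
    {ρ : ℝ} (hρ : 0 < ρ) :
    ∃ s > 0, ∀ᶠ n in atTop, ∀ Z : Fin n × Fin n → ℝ,
      (∀ y ∈ Icc (0 : ℝ) 1, ∀ ψ ∈ Icc (-(π / 2)) (π / 2),
        |localSum (ξ n) (h n) (x, φ x) Z (win K₁ K₂) ((y - φ x) / h n) ψ| ≤ s) →
      ∀ y ψ, IsArgmaxOn (fun p => empContrast K₁ K₂ (ξ n)
          (fun i => jumpImage m τ φ (ξ n i.1) (ξ n i.2) + Z i) ![x, p.1] p.2 (h n))
        (searchRange (h n)) (y, ψ) →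
      |(y - φ x) / h n| ≤ ρ ∧ |ψ - slopeAngle φ x| ≤ ρ ∧
      localSum (ξ n) (h n) (x, φ x) (fun i => jumpImage m τ φ (ξ n i.1) (ξ n i.2) + Z i)
        (winW K₁ (deriv K₁) K₂ (deriv K₂)) ((y - φ x) / h n) ψ = 0 ∧
      localSum (ξ n) (h n) (x, φ x) (fun i => jumpImage m τ φ (ξ n i.1) (ξ n i.2) + Z i)
        (winP K₁ (deriv K₁) K₂ (deriv K₂)) ((y - φ x) / h n) ψ = 0 := by
  obtain ⟨hpos, h0, hnh, -⟩ := hb.asymptotics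
  have hψ0 := slopeAngle_mem (φ := φ) (x := x)
  have hφ := hs.range_φ x (Ioo_subset_Icc_self hx)
  -- Shrinking the radius keeps the angle in the open interval, so that the first-order conditions
  -- apply.
  set ρ' := min ρ (min (slopeAngle φ x - -(π / 2)) (π / 2 - slopeAngle φ x)) with hρ'
  have hρ'0 : 0 < ρ' := lt_min hρ (lt_min (by linarith [hψ0.1]) (by linarith [hψ0.2]))
  have hρ'1 : ρ' ≤ ρ := min_le_left _ _
  have hρ'2 : ρ' ≤ slopeAngle φ x - -(π / 2) := (min_le_right _ _).trans (min_le_left _ _)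
  have hρ'3 : ρ' ≤ π / 2 - slopeAngle φ x := (min_le_right _ _).trans (min_le_right _ _)
  obtain ⟨c, hc, hev⟩ := exists_near_of_contrast_ge hs hx hξ hb hK hρ'0
  have hlim := (tendsto_contrast_center hs hx hξ hb hK).eventually
    (lt_mem_nhds (show τ x - c / 3 < τ x by linarith))
  have hlow : ∀ᶠ n in atTop, (√2 + ρ) * h n < min (φ x) (1 - φ x) := by
    have := h0.const_mul (√2 + ρ)
    rw [mul_zero] at this
    exact this.eventually (gt_mem_nhds (lt_min hφ.1 (by linarith [hφ.2])))
  -- Three losses of `c / 3`: the noise at the maximizer, the noise at the true point, and the gap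
  -- between the contrast at the true point and its limit.
  refine ⟨c / 3, by positivity, ?_⟩
  filter_upwards [hpos, hev, hlim, hlow] with n hn hnear hcen hl Z hZ y ψ hmax
  have hl1 := hl.trans_le (min_le_left _ _)
  have hl2 := hl.trans_le (min_le_right _ _)
  have hρh : 0 < ρ * h n := by positivity
  have hmem : ((φ x, slopeAngle φ x) : ℝ × ℝ) ∈ searchRange (h n) :=
    ⟨⟨by simp only; linarith, by simp only; linarith⟩, Ioo_subset_Icc_self hψ0⟩
  have h2h : 0 ≤ √2 * h n := by positivity
  have hy := hmax.1.1
  have hψ := hmax.1.2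
  simp only at hy hψ
  have hy01 : y ∈ Icc (0 : ℝ) 1 := ⟨h2h.trans hy.1, hy.2.trans (by linarith)⟩
  have hle := hmax.2 hmem
  simp only [mem_ofPred_eq] at hle
  rw [empContrast_eq_localSum K₁ K₂ _ _ x _ (φ x) _ hn.ne',
    empContrast_eq_localSum K₁ K₂ _ _ x _ (φ x) _ hn.ne', localSum_add, localSum_add] at hle
  have b1 := hZ (φ x) ⟨hφ.1.le, hφ.2.le⟩ (slopeAngle φ x) (Ioo_subset_Icc_self hψ0)
  have b2 := hZ y hy01 ψ hψ
  rw [abs_le] at b1 b2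
  rw [sub_self, zero_div] at hle b1
  obtain ⟨n1, n2⟩ := hnear (y, ψ) hmax.1 (by simp only; linarith [b1.1, b2.2])
  simp only at n1 n2
  refine ⟨n1.le.trans hρ'1, n2.le.trans hρ'1, ?_⟩
  have n1' := n1.trans_le hρ'1
  rw [abs_lt, div_lt_iff₀ hn, lt_div_iff₀ hn] at n1'
  rw [abs_lt] at n2
  refine localSum_eq_zero_of_isArgmaxOn hK hn hmax ⟨?_, ?_⟩ ⟨?_, ?_⟩ <;> linarith [n1'.1, n1'.2, n2.1, n2.2]

end perturbed

/-! ### Quadratic expansion of the contrast -/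

section expansion
variable {m : ℝ × ℝ → ℝ} {τ φ K₁ K₂ : ℝ → ℝ} {x : ℝ} {ξ : (n : ℕ) → Fin n → ℝ} {h : ℕ → ℝ}

/-- This is `newton_estimates` for the noisy contrast. Half of `η` is spent on the deterministic
Hessian and half on its noise. The gradient at the deterministic critical point reduces to the noise
`Z`, because the image part vanishes there. -/
lemma eventually_expansion (hs : SmoothnessAssumption m τ φ) (hx : x ∈ Ioo (0 : ℝ) 1)
    (hξ : RegularDesign ξ) (hb : BandwidthAssumption h) (hK : KernelAssumption K₁ K₂)
    {η : ℝ} (hη : 0 < η) :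
    ∃ ρ > 0, ∀ᶠ n in atTop, ∀ Z : Fin n × Fin n → ℝ,
      (∀ f ∈ [winWW K₁ (deriv K₁) (deriv (deriv K₁)) K₂ (deriv K₂) (deriv (deriv K₂)),
          winWP K₁ (deriv K₁) (deriv (deriv K₁)) K₂ (deriv K₂) (deriv (deriv K₂)),
          winPP K₁ (deriv K₁) (deriv (deriv K₁)) K₂ (deriv K₂) (deriv (deriv K₂))],
        ∀ w ∈ Icc (-(1 / 2) : ℝ) (1 / 2), ∀ ψ ∈ Icc (-(π / 2)) (π / 2),
          |localSum (ξ n) (h n) (x, φ x) Z f w ψ| ≤ η / 2) →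
      ∀ w₀ ψ₀ w₁ ψ₁, |w₀| ≤ ρ → |ψ₀ - slopeAngle φ x| ≤ ρ → |w₁| ≤ ρ →
        |ψ₁ - slopeAngle φ x| ≤ ρ →
      (∀ f ∈ [winW K₁ (deriv K₁) K₂ (deriv K₂), winP K₁ (deriv K₁) K₂ (deriv K₂)],
        localSum (ξ n) (h n) (x, φ x) (fun i => jumpImage m τ φ (ξ n i.1) (ξ n i.2))
          f w₀ ψ₀ = 0 ∧
        localSum (ξ n) (h n) (x, φ x) (fun i => jumpImage m τ φ (ξ n i.1) (ξ n i.2) + Z i)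
          f w₁ ψ₁ = 0) →
      |localSum (ξ n) (h n) (x, φ x) Z (winW K₁ (deriv K₁) K₂ (deriv K₂)) w₀ ψ₀
        - VHφ K₂ τ φ x * (w₁ - w₀)| ≤ η * (|w₁ - w₀| + |ψ₁ - ψ₀|) ∧
      |localSum (ξ n) (h n) (x, φ x) Z (winP K₁ (deriv K₁) K₂ (deriv K₂)) w₀ ψ₀
        - VHψ K₁ K₂ τ x * (ψ₁ - ψ₀)| ≤ η * (|w₁ - w₀| + |ψ₁ - ψ₀|) ∧
      |localSum (ξ n) (h n) (x, φ x) (fun i => jumpImage m τ φ (ξ n i.1) (ξ n i.2) + Z i)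
          (win K₁ K₂) w₁ ψ₁
        - localSum (ξ n) (h n) (x, φ x) (fun i => jumpImage m τ φ (ξ n i.1) (ξ n i.2) + Z i)
          (win K₁ K₂) w₀ ψ₀| ≤
        (VHφ K₂ τ φ x + VHψ K₁ K₂ τ x + 2 * η) * (|w₁ - w₀| + |ψ₁ - ψ₀|) ^ 2 := by
  have hk := hK.c2₁
  have hl := hK.c2₂
  have hψ0 := slopeAngle_mem (φ := φ) (x := x)
  obtain ⟨ρ₁, hρ₁, h₁⟩ := eventually_localSum_near hs hx hξ hb (isWindow_winWW hk hl)
    (hK.hessian_WW (m (x, φ x)) (τ x) _ _) (half_pos hη)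
  obtain ⟨ρ₂, hρ₂, h₂⟩ := eventually_localSum_near hs hx hξ hb (isWindow_winWP hk hl)
    (hK.hessian_WP (m (x, φ x)) (τ x) _ _) (half_pos hη)
  obtain ⟨ρ₃, hρ₃, h₃⟩ := eventually_localSum_near hs hx hξ hb (isWindow_winPP hk hl)
    (hK.hessian_PP (m (x, φ x)) (τ x) _ _) (half_pos hη)
  obtain ⟨ρ, hρ, hρb⟩ : ∃ ρ > 0, ρ ≤ ρ₁ ∧ ρ ≤ ρ₂ ∧ ρ ≤ ρ₃ ∧ ρ ≤ 1 / 2 ∧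
      ρ ≤ slopeAngle φ x - -(π / 2) ∧ ρ ≤ π / 2 - slopeAngle φ x := by
    refine ⟨min ρ₁ (min ρ₂ (min ρ₃ (min (1 / 2) (min (slopeAngle φ x - -(π / 2))
      (π / 2 - slopeAngle φ x))))), ?_, ?_⟩
    · simp only [gt_iff_lt, lt_min_iff]
      exact ⟨hρ₁, hρ₂, hρ₃, by norm_num, by linarith [hψ0.1], by linarith [hψ0.2]⟩
    · rw [← le_min_iff, ← le_min_iff, ← le_min_iff, ← le_min_iff, ← le_min_iff]
  obtain ⟨l1, l2, l3, l4, l5, l6⟩ := hρb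
  refine ⟨ρ, hρ, ?_⟩
  filter_upwards [h₁, h₂, h₃] with n e₁ e₂ e₃ Z hZ w₀ ψ₀ w₁ ψ₁ hw₀ hψ₀ hw₁ hψ₁ hf
  obtain ⟨hW₀, hW₁⟩ := hf _ (List.mem_cons_self ..)
  obtain ⟨hP₀, hP₁⟩ := hf _ (List.mem_cons_of_mem _ (List.mem_cons_self ..))
  have box {w ψ : ℝ} (hw : |w| ≤ ρ) (hψ : |ψ - slopeAngle φ x| ≤ ρ) :
      w ∈ Icc (-(1 / 2) : ℝ) (1 / 2) ∧ ψ ∈ Icc (-(π / 2)) (π / 2) := by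
    rw [abs_le] at hw hψ
    exact ⟨⟨by linarith [hw.1], by linarith [hw.2]⟩, by linarith [hψ.1], by linarith [hψ.2]⟩
  have comb {f : ℝ → ℝ × ℝ → ℝ} {I w ψ : ℝ}
      (h1 : |localSum (ξ n) (h n) (x, φ x) (fun i => jumpImage m τ φ (ξ n i.1) (ξ n i.2)) f w ψ
        - I| ≤ η / 2) (h2 : |localSum (ξ n) (h n) (x, φ x) Z f w ψ| ≤ η / 2) :
      |localSum (ξ n) (h n) (x, φ x) (fun i => jumpImage m τ φ (ξ n i.1) (ξ n i.2) + Z i) f w ψ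
        - I| ≤ η := by
    rw [localSum_add]
    rw [abs_le] at *
    constructor <;> linarith [h1.1, h1.2, h2.1, h2.2]
  have main := newton_estimates (A := VHφ K₂ τ φ x) (B := VHψ K₁ K₂ τ x) (η := η) (ρ := ρ)
    (ψc := slopeAngle φ x)
    (M := localSum (ξ n) (h n) (x, φ x)
      (fun i => jumpImage m τ φ (ξ n i.1) (ξ n i.2) + Z i) (win K₁ K₂))
    (fun w ψ α β t => (hasPathDeriv_win hk hl).localSum _ _ _ _ w ψ α β t)
    (fun w ψ α β t => (hasPathDeriv_winW hk hl).localSum _ _ _ _ w ψ α β t)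
    (fun w ψ α β t => (hasPathDeriv_winP hk hl).localSum _ _ _ _ w ψ α β t)
    (VHφ_pos hs hK hx).le (VHψ_pos hs hK hx).le hη.le
    (fun w ψ hw hψ => comb (e₁ w ψ (hw.trans l1) (hψ.trans l1))
      (hZ _ (List.mem_cons_self ..) w (box hw hψ).1 ψ (box hw hψ).2))
    (fun w ψ hw hψ => comb (e₂ w ψ (hw.trans l2) (hψ.trans l2))
      (hZ _ (List.mem_cons_of_mem _ (List.mem_cons_self ..)) w (box hw hψ).1 ψ (box hw hψ).2))
    (fun w ψ hw hψ => comb (e₃ w ψ (hw.trans l3) (hψ.trans l3))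
      (hZ _ (List.mem_cons_of_mem _ (List.mem_cons_of_mem _ (List.mem_cons_self ..)))
        w (box hw hψ).1 ψ (box hw hψ).2))
    hw₀ hψ₀ hw₁ hψ₁ hW₁ hP₁
  rw [localSum_add, localSum_add, hW₀, hP₀, zero_add, zero_add] at main
  exact main

end expansion

/-! ### The linear part -/

section linear
variable {Ω : Type*} [MeasurableSpace Ω] {P : Measure Ω} [IsProbabilityMeasure P]
  {ν : Measure ℝ} {σ : ℝ} {ε : (n : ℕ) → Fin n × Fin n → Ω → ℝ}
  {τ φ K₁ K₂ : ℝ → ℝ} {x : ℝ} {ξ : (n : ℕ) → Fin n → ℝ} {h : ℕ → ℝ}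

lemma tendsto_localSum_one (hξ : RegularDesign ξ) (hb : BandwidthAssumption h)
    {z : ℝ × ℝ} (hz₁ : z.1 ∈ Ioo (0 : ℝ) 1) (hz₂ : z.2 ∈ Ioo (0 : ℝ) 1) {w ψ : ℕ → ℝ} {w₀ ψ₀ : ℝ}
    (hw : Tendsto w atTop (𝓝 w₀)) (hψ : Tendsto ψ atTop (𝓝 ψ₀))
    {f : ℝ → ℝ × ℝ → ℝ} (hf : IsWindow f) :
    Tendsto (fun n => localSum (ξ n) (h n) z (fun _ => 1) f (w n) (ψ n)) atTop
      (𝓝 (∫ v, f ψ₀ v)) := by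
  obtain ⟨hpos, h0, hnh, -⟩ := hb.asymptotics
  have := tendsto_localSum (L := atTop) hξ (N := fun n => n) (H := h) (w := w) (ψ := ψ) (x := z)
    (g := fun _ _ => 1) (γ := fun _ => 1) (C := 1) hf hpos hnh hψ (by simp) ?_ ?_
  · rw [integral_comp_rotArg ψ₀ (fun _ => 1) (f ψ₀)] at this
    simpa using this
  · intro a _
    have h1 : Tendsto (fun n => z.1 - h n * a.1) atTop (𝓝 z.1) := by
      simpa using (h0.mul_const a.1).const_sub z.1
    have h2 : Tendsto (fun n => z.2 + h n * w n - h n * a.2) atTop (𝓝 z.2) := by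
      simpa using ((h0.mul hw).const_add z.2).sub (h0.mul_const a.2)
    exact Filter.inter_mem (h1 (Ioo_mem_nhds hz₁.1 hz₁.2)) (h2 (Ioo_mem_nhds hz₂.1 hz₂.2))
  · exact Eventually.of_forall fun a b _ _ => tendsto_const_nhds

lemma norm_vec_three_le (a b c : ℝ) :
    ‖(!₂[a, b, c] : EuclideanSpace ℝ (Fin 3))‖ ≤ |a| + |b| + |c| := by
  rw [EuclideanSpace.norm_eq, Fin.sum_univ_three]
  refine Real.sqrt_le_iff.2 ⟨by positivity, ?_⟩
  simp only [Matrix.cons_val, Real.norm_eq_abs]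
  nlinarith [mul_nonneg (abs_nonneg a) (abs_nonneg b), mul_nonneg (abs_nonneg a) (abs_nonneg c),
    mul_nonneg (abs_nonneg b) (abs_nonneg c)]

lemma charFun_gaussian_asympCov (σ : ℝ) (K₁ K₂ τ φ : ℝ → ℝ) (x : ℝ)
    (t : EuclideanSpace ℝ (Fin 3)) :
    charFun (multivariateGaussian 0 (σ ^ 2 • asympCov K₁ K₂ τ φ x)) t =
      Complex.exp (-(σ ^ 2 * ((t 0 / VHφ K₂ τ φ x) ^ 2 * VSφ K₁ K₂ φ x +
        (t 1 / VHψ K₁ K₂ τ x) ^ 2 * VSψ K₁ K₂ + (t 2) ^ 2 * VSτ K₁ K₂) / 2 : ℝ)) := by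
  rw [charFun_multivariateGaussian (posSemidef_smul_asympCov σ K₁ K₂ τ φ x)]
  have e : (t.ofLp ⬝ᵥ (σ ^ 2 • asympCov K₁ K₂ τ φ x) *ᵥ t.ofLp) =
      σ ^ 2 * ((t 0 / VHφ K₂ τ φ x) ^ 2 * VSφ K₁ K₂ φ x +
        (t 1 / VHψ K₁ K₂ τ x) ^ 2 * VSψ K₁ K₂ + (t 2) ^ 2 * VSτ K₁ K₂) := by
    simp only [asympCov, Matrix.smul_mulVec, dotProduct_smul, smul_eq_mul]
    congr 1
    simp only [dotProduct, Fin.sum_univ_three, Matrix.mulVec_diagonal, Matrix.cons_val]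
    ring
  rw [e]
  simp only [inner_zero_right, Complex.ofReal_zero, zero_mul, zero_sub,
    Complex.ofReal_div, Complex.ofReal_ofNat]

/-- The weights are window values divided by `n h`, so they are uniformly `O(1 / (n h))`. The sum of
their squared inner products with `t` is a localized sum, with constant data 1, of the square of one
combined window; its limit is the quadratic form of the covariance. -/
lemma ErrorAssumption.tendstoInDistribution_localSum (hε : ErrorAssumption P ν σ ε)
    (hξ : RegularDesign ξ) (hb : BandwidthAssumption h) (hK : KernelAssumption K₁ K₂)
    (τ : ℝ → ℝ) (hx : x ∈ Ioo (0 : ℝ) 1) (hφ : φ x ∈ Ioo (0 : ℝ) 1) {w ψ : ℕ → ℝ} {w₀ : ℝ}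
    (hw : Tendsto w atTop (𝓝 w₀)) (hψ : Tendsto ψ atTop (𝓝 (slopeAngle φ x))) :
    TendstoInDistribution (fun (n : ℕ) (ω : Ω) => ((n : ℝ) * h n) •
      !₂[localSum (ξ n) (h n) (x, φ x) (fun i => ε n i ω)
          (winW K₁ (deriv K₁) K₂ (deriv K₂)) (w n) (ψ n) / VHφ K₂ τ φ x,
        localSum (ξ n) (h n) (x, φ x) (fun i => ε n i ω)
          (winP K₁ (deriv K₁) K₂ (deriv K₂)) (w n) (ψ n) / VHψ K₁ K₂ τ x,
        localSum (ξ n) (h n) (x, φ x) (fun i => ε n i ω) (win K₁ K₂) (w n) (ψ n)])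
      atTop (id : EuclideanSpace ℝ (Fin 3) → EuclideanSpace ℝ (Fin 3)) (fun _ => P)
      (multivariateGaussian 0 (σ ^ 2 • asympCov K₁ K₂ τ φ x)) := by
  obtain ⟨hpos, h0, hnh, -⟩ := hb.asymptotics
  set A := VHφ K₂ τ φ x
  set B := VHψ K₁ K₂ τ x
  set F₁ := winW K₁ (deriv K₁) K₂ (deriv K₂) with hF₁
  set F₂ := winP K₁ (deriv K₁) K₂ (deriv K₂) with hF₂
  set F₃ := win K₁ K₂ with hF₃
  have w1 : IsWindow F₁ := isWindow_winW hK.c2₁ hK.c2₂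
  have w2 : IsWindow F₂ := isWindow_winP hK.c2₁ hK.c2₂
  have w3 : IsWindow F₃ := isWindow_win hK.c2₁ hK.c2₂
  set r : (n : ℕ) → Fin n × Fin n → ℝ × ℝ := fun n i =>
    rotArg (ψ n) ((x - ξ n i.1) / h n, (φ x - ξ n i.2) / h n + w n) with hr
  set c : (n : ℕ) → Fin n × Fin n → EuclideanSpace ℝ (Fin 3) := fun n i =>
    ((n : ℝ) * h n)⁻¹ • !₂[F₁ (ψ n) (r n i) / A, F₂ (ψ n) (r n i) / B, F₃ (ψ n) (r n i)] with hc
  obtain ⟨M₁, hM₁0, hM₁⟩ := w1.exists_bound (slopeAngle φ x - 1) (slopeAngle φ x + 1)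
  obtain ⟨M₂, hM₂0, hM₂⟩ := w2.exists_bound (slopeAngle φ x - 1) (slopeAngle φ x + 1)
  obtain ⟨M₃, hM₃0, hM₃⟩ := w3.exists_bound (slopeAngle φ x - 1) (slopeAngle φ x + 1)
  have hψM : ∀ᶠ n in atTop, ψ n ∈ Icc (slopeAngle φ x - 1) (slopeAngle φ x + 1) :=
    hψ (Icc_mem_nhds (by linarith) (by linarith))
  have main := hε.tendstoInDistribution_sum c
    (b := fun n => ((n : ℝ) * h n)⁻¹ * (M₁ / |A| + M₂ / |B| + M₃))
    (by simpa using (tendsto_inv_atTop_zero.comp hnh).mul_const (M₁ / |A| + M₂ / |B| + M₃)) ?_ ?_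
    (charFun_gaussian_asympCov σ K₁ K₂ τ φ x)
  · convert main using 0
    congr! 1
    funext n ω
    rw [hc]
    simp only [localSum]
    have key (f : ℝ → ℝ × ℝ → ℝ) : (n * h n) * (((n * h n) ^ 2)⁻¹ * ∑ i, ε n i ω * f (ψ n)
        (rotArg (ψ n) ((x - ξ n i.1) / h n, (φ x - ξ n i.2) / h n + w n))) =
        ∑ i, ε n i ω * ((n * h n)⁻¹ * f (ψ n) (r n i)) := by
      rw [← mul_assoc, Finset.mul_sum]
      refine Finset.sum_congr rfl fun i _ => ?_
      have : (n * h n) * ((n * h n) ^ 2)⁻¹ = (n * h n)⁻¹ := by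
        rcases eq_or_ne (n * h n) 0 with h | h
        · simp [h]
        · field_simp
      rw [this]
      ring
    ext k
    rw [WithLp.ofLp_sum, Finset.sum_apply]
    fin_cases k
    · simp only [Fin.zero_eta, PiLp.smul_apply, Matrix.cons_val, smul_eq_mul]
      rw [← mul_div_assoc, key, Finset.sum_div]
      exact Finset.sum_congr rfl fun i _ => by ring
    · simp only [Fin.mk_one, PiLp.smul_apply, Matrix.cons_val, smul_eq_mul]
      rw [← mul_div_assoc, key, Finset.sum_div]
      exact Finset.sum_congr rfl fun i _ => by ring
    · simp only [Fin.reduceFinMk, PiLp.smul_apply, Matrix.cons_val, smul_eq_mul]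
      rw [key]
  · filter_upwards [hψM, hnh.eventually_gt_atTop 0] with n hn hn0 i
    rw [hc]
    simp only
    rw [norm_smul, Real.norm_eq_abs, abs_of_pos (inv_pos.2 hn0)]
    refine mul_le_mul_of_nonneg_left ((norm_vec_three_le _ _ _).trans ?_) (inv_pos.2 hn0).le
    rw [abs_div, abs_div]
    gcongr
    · exact hM₁ _ hn _
    · exact hM₂ _ hn _
    · exact hM₃ _ hn _
  · intro t
    have hlim := tendsto_localSum_one hξ hb (z := (x, φ x)) hx hφ hw hψ
      (((w1.const_mul (t 0 / A)).add (w2.const_mul (t 1 / B))).add (w3.const_mul (t 2))).sq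
    rw [hK.integral_comb_sq] at hlim
    refine hlim.congr fun n => ?_
    rw [localSum, Finset.mul_sum]
    refine Finset.sum_congr rfl fun i _ => ?_
    have e : inner ℝ (c n i) t = (n * h n)⁻¹ * (t 0 / A * F₁ (ψ n) (r n i) +
        t 1 / B * F₂ (ψ n) (r n i) + t 2 * F₃ (ψ n) (r n i)) := by
      rw [hc]
      simp only [PiLp.inner_apply, Fin.sum_univ_three, PiLp.smul_apply, Matrix.cons_val,
        smul_eq_mul, RCLike.inner_apply, conj_trivial]
      ring
    rw [e, mul_pow ((n * h n)⁻¹), inv_pow, one_mul]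

end linear

/-! ### Asymptotic linearity -/

section remainder
variable {Ω : Type*} [MeasurableSpace Ω] {P : Measure Ω}

lemma ErrorAssumption.exists_tight_bound [IsProbabilityMeasure P] {ν : Measure ℝ} {σ : ℝ}
    {ε : (n : ℕ) → Fin n × Fin n → Ω → ℝ} (hε : ErrorAssumption P ν σ ε)
    {ξ : (n : ℕ) → Fin n → ℝ} (hξ : RegularDesign ξ) {h : ℕ → ℝ} (hb : BandwidthAssumption h)
    {f : ℝ → ℝ × ℝ → ℝ} (hf : IsWindow f) (z : ℝ × ℝ) (w : ℕ → ℝ) {ψ : ℕ → ℝ} {ψ₀ : ℝ}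
    (hψ : Tendsto ψ atTop (𝓝 ψ₀)) {e : ENNReal} (he : 0 < e) :
    ∃ Λ > 0, ∀ᶠ n : ℕ in atTop,
      P {ω | Λ ≤ |n * h n * localSum (ξ n) (h n) z (fun i => ε n i ω) f (w n) (ψ n)|} ≤ e := by
  obtain ⟨hpos, -, hnh, -⟩ := hb.asymptotics
  obtain ⟨M, -, hM⟩ := hf.exists_bound (ψ₀ - 1) (ψ₀ + 1)
  have hψM : ∀ᶠ n in atTop, ψ n ∈ Icc (ψ₀ - 1) (ψ₀ + 1) :=
    hψ (Icc_mem_nhds (by linarith) (by linarith))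
  have hlim : Tendsto (fun Λ : ℝ => ENNReal.ofReal (σ ^ 2 * (64 * M ^ 2) / Λ ^ 2)) atTop (𝓝 0) := by
    simpa using ENNReal.tendsto_ofReal
      ((tendsto_pow_atTop two_ne_zero).const_div_atTop (σ ^ 2 * (64 * M ^ 2)))
  obtain ⟨Λ, hΛe, hΛ⟩ :=
    ((ENNReal.tendsto_nhds_zero.1 hlim e he).and (eventually_gt_atTop 0)).exists
  refine ⟨Λ, hΛ, ?_⟩
  filter_upwards [hpos, hnh.eventually_ge_atTop 1, hψM] with n hn hn1 hnψ
  have hN : 0 < n * h n := by linarith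
  have hle := hε.meas_localSum_le hξ hf hn hn1 z (w n) (ψ n) (hM _ hnψ) (div_pos hΛ hN)
  refine (measure_mono fun ω hω => ?_).trans (hle.trans (le_trans (le_of_eq ?_) hΛe))
  · rw [mem_ofPred_eq] at hω ⊢
    rw [abs_mul, abs_of_pos hN] at hω
    rwa [div_le_iff₀' hN]
  · have hN0 := hN.ne'
    generalize (n : ℝ) * h n = N at hN0
    congr 1
    field_simp

/-- Tightness of the scaled scores fixes a level `Λ`; the relative error `η` of the Hessian is
chosen only afterwards. -/
lemma tendsto_remainder {s₁ s₂ dw dψ dM : ℕ → Ω → ℝ} {N : ℕ → ℝ} {A B : ℝ} (hA : 0 < A)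
    (hB : 0 < B) (hN : Tendsto N atTop atTop)
    (h₁ : ∀ e : ENNReal, 0 < e → ∃ Λ > 0, ∀ᶠ n in atTop, P {ω | Λ ≤ |N n * s₁ n ω|} ≤ e)
    (h₂ : ∀ e : ENNReal, 0 < e → ∃ Λ > 0, ∀ᶠ n in atTop, P {ω | Λ ≤ |N n * s₂ n ω|} ≤ e)
    (hexp : ∀ η > 0, WithHighProb P fun n ω =>
      |s₁ n ω - A * dw n ω| ≤ η * (|dw n ω| + |dψ n ω|) ∧
      |s₂ n ω - B * dψ n ω| ≤ η * (|dw n ω| + |dψ n ω|) ∧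
      |dM n ω| ≤ (A + B + 2 * η) * (|dw n ω| + |dψ n ω|) ^ 2) {δ : ℝ} (hδ : 0 < δ) :
    Tendsto (fun n => P {ω | δ ≤ |N n * dw n ω - N n * s₁ n ω / A| +
      |N n * dψ n ω - N n * s₂ n ω / B| + |N n * dM n ω|}) atTop (𝓝 0) := by
  rw [ENNReal.tendsto_nhds_zero]
  intro e he
  have he3 : 0 < e / 3 := ENNReal.div_pos he.ne' (by norm_num)
  obtain ⟨Λ₁, hΛ₁, k₁⟩ := h₁ _ he3
  obtain ⟨Λ₂, hΛ₂, k₂⟩ := h₂ _ he3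
  set Λ := max Λ₁ Λ₂ with hΛdef
  have hΛ : 0 < Λ := hΛ₁.trans_le (le_max_left _ _)
  set κ := min A B with hκdef
  have hκ : 0 < κ := lt_min hA hB
  -- With this choice the two linear remainders are at most `δ / 8` each, and the quadratic one is
  -- below `δ / 2` for large `n`.
  set η := min (κ / 4) (δ * κ ^ 2 / (32 * Λ)) with hηdef
  have hη : 0 < η := lt_min (by positivity) (by positivity)
  have hη2 : 4 * Λ * η / κ ^ 2 ≤ δ / 8 := by
    rw [div_le_iff₀ (by positivity)]
    calc 4 * Λ * η ≤ 4 * Λ * (δ * κ ^ 2 / (32 * Λ)) := by gcongr; exact min_le_right _ _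
      _ = δ / 8 * κ ^ 2 := by field_simp; norm_num
  have k₃ := ENNReal.tendsto_nhds_zero.1 (hexp η hη) _ he3
  have k₄ := (hN.const_div_atTop ((A + B + κ) * (4 * Λ / κ) ^ 2)).eventually
    (gt_mem_nhds (half_pos hδ))
  filter_upwards [k₁, k₂, k₃, k₄, hN.eventually_gt_atTop 0] with n b₁ b₂ b₃ b₄ hNn
  rw [← ENNReal.add_thirds e]
  refine le_trans ?_ (add_le_add (add_le_add b₁ b₂) b₃)
  refine (measure_mono fun ω hω => ?_).trans
    ((measure_union_le _ _).trans (add_le_add_left (measure_union_le _ _) _))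
  by_contra hcon
  simp only [mem_union, mem_ofPred_eq, not_or, not_le, not_not] at hcon hω
  obtain ⟨⟨c₁, c₂⟩, c₃, c₄, c₅⟩ := hcon
  obtain ⟨r₁, r₂, r₃⟩ := newton_scaled hκ (min_le_left _ _) (min_le_right _ _) hNn
    (min_le_left _ _) hη.le c₃ c₄ c₅ (c₁.le.trans (le_max_left _ _))
    (c₂.le.trans (le_max_right _ _))
  linarith

end remainder

/-! ### Measurability and the limit law -/

lemma aemeasurable_empContrast {Ω : Type*} [MeasurableSpace Ω] {P : Measure Ω} {K₁ K₂ : ℝ → ℝ}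
    (hK₁ : Continuous K₁) (hK₂ : Continuous K₂) {n : ℕ} (ξ : Fin n → ℝ)
    {Y : Fin n × Fin n → Ω → ℝ} (hY : ∀ i, AEMeasurable (Y i) P) (x h : ℝ) {y ψ : Ω → ℝ}
    (hy : AEMeasurable y P) (hψ : AEMeasurable ψ P) :
    AEMeasurable (fun ω => empContrast K₁ K₂ ξ (fun i => Y i ω) ![x, y ω] (ψ ω) h) P := by
  have e (i : Fin n × Fin n) (ω : Ω) : rotKernel K₁ K₂ (![x, y ω] - ![ξ i.1, ξ i.2]) (ψ ω) h =
      K₁ (h⁻¹ * ((x - ξ i.1) * cos (ψ ω) + (y ω - ξ i.2) * sin (ψ ω))) *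
        K₂ (h⁻¹ * (-((x - ξ i.1) * sin (ψ ω)) + (y ω - ξ i.2) * cos (ψ ω))) / h ^ 2 := by
    simp [rotKernel, rotMatrix]
  have hm (i : Fin n × Fin n) : AEMeasurable
      (fun ω => rotKernel K₁ K₂ (![x, y ω] - ![ξ i.1, ξ i.2]) (ψ ω) h) P := by
    simp only [e]
    have h₁ := hK₁.measurable
    have h₂ := hK₂.measurable
    fun_prop
  unfold empContrast
  exact (Finset.aemeasurable_fun_sum _ fun i _ => (hY i).mul (hm i)).const_mul _

lemma iIndepFun_gaussian_asympCov (σ : ℝ) (K₁ K₂ τ φ : ℝ → ℝ) (x : ℝ) :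
    iIndepFun (fun (k : Fin 3) (v : EuclideanSpace ℝ (Fin 3)) => v k)
      (multivariateGaussian 0 (σ ^ 2 • asympCov K₁ K₂ τ φ x)) := by
  refine HasGaussianLaw.iIndepFun_of_covariance_eq_zero ?_ fun i j hij => ?_
  · have : HasGaussianLaw (id : EuclideanSpace ℝ (Fin 3) → EuclideanSpace ℝ (Fin 3))
      (multivariateGaussian 0 (σ ^ 2 • asympCov K₁ K₂ τ φ x)) := IsGaussian.hasGaussianLaw_id
    exact this.map_equiv (EuclideanSpace.equiv (Fin 3) ℝ)
  · rw [covariance_eval_multivariateGaussian (posSemidef_smul_asympCov σ K₁ K₂ τ φ x)]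
    simp [asympCov, Matrix.diagonal_apply_ne _ hij]

theorem mainTheorem4
    {Ω : Type*} [MeasurableSpace Ω] (P : Measure Ω) [IsProbabilityMeasure P]
    (ν : Measure ℝ) (σ : ℝ)
    (m : ℝ × ℝ → ℝ) (τ φ K₁ K₂ : ℝ → ℝ) (h : ℕ → ℝ)
    (ξ : (n : ℕ) → Fin n → ℝ) (ε : (n : ℕ) → Fin n × Fin n → Ω → ℝ)
    (hξ : RegularDesign ξ)
    (hε : ErrorAssumption P ν σ ε)
    (hsmooth : SmoothnessAssumption m τ φ)
    (hband : BandwidthAssumption h)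
    (hker : KernelAssumption K₁ K₂)
    (x : ℝ) (hx : x ∈ Set.Ioo (0 : ℝ) 1)
    -- the estimators of location and slope at `x`
    (φhat ψhat : ℕ → Ω → ℝ)
    (hφmeas : ∀ n, AEMeasurable (φhat n) P) (hψmeas : ∀ n, AEMeasurable (ψhat n) P)
    (hhat : ∀ᶠ n in atTop, ∀ᵐ ω ∂P,
      IsArgmaxOn (fun p => empContrast K₁ K₂ (ξ n)
          (fun i => observation m τ φ (ξ n) (ε n) i ω) ![x, p.1] p.2 (h n))
        (searchRange (h n)) (φhat n ω, ψhat n ω))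
    -- the maximizers of the deterministic contrast at `x`
    (φdet ψdet : ℕ → ℝ)
    (hdet : ∀ᶠ n in atTop,
      IsArgmaxOn (fun p => detContrast P K₁ K₂ (ξ n)
          (observation m τ φ (ξ n) (ε n)) ![x, p.1] p.2 (h n))
        (searchRange (h n)) (φdet n, ψdet n))
    -- the rescaled locations
    (what : ℕ → Ω → ℝ) (hwhat : ∀ n ω, what n ω = (φhat n ω - φ x) / h n)
    (wdet : ℕ → ℝ) (hwdet : ∀ n, wdet n = (φdet n - φ x) / h n)
    -- the estimator of the jump height, and its deterministic counterpart
    (τhat : ℕ → Ω → ℝ)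
    (hτhat : ∀ n ω, τhat n ω = empContrast K₁ K₂ (ξ n)
      (fun i => observation m τ φ (ξ n) (ε n) i ω) ![x, φhat n ω] (ψhat n ω) (h n))
    (τdet : ℕ → ℝ)
    (hτdet : ∀ n, τdet n = detContrast P K₁ K₂ (ξ n)
      (observation m τ φ (ξ n) (ε n)) ![x, φdet n] (ψdet n) (h n)) :
    TendstoInDistribution
        (fun (n : ℕ) (ω : Ω) => ((n : ℝ) * h n) •
          !₂[what n ω - wdet n, ψhat n ω - ψdet n, τhat n ω - τdet n])
        atTop (id : EuclideanSpace ℝ (Fin 3) → EuclideanSpace ℝ (Fin 3)) (fun _ => P)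
        (multivariateGaussian 0 (σ ^ 2 • asympCov K₁ K₂ τ φ x)) ∧
      iIndepFun (fun (k : Fin 3) (v : EuclideanSpace ℝ (Fin 3)) => v k)
        (multivariateGaussian 0 (σ ^ 2 • asympCov K₁ K₂ τ φ x)) := by
  refine ⟨?_, iIndepFun_gaussian_asympCov σ K₁ K₂ τ φ x⟩
  obtain ⟨hpos, h0, hnh, -⟩ := hband.asymptotics
  have hA := VHφ_pos hsmooth hker hx
  have hB := VHψ_pos hsmooth hker hx
  have hφ := hsmooth.range_φ x (Ioo_subset_Icc_self hx)
  have hk := hker.c2₁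
  have hl := hker.c2₂
  set img : (n : ℕ) → Fin n × Fin n → ℝ := fun n i => jumpImage m τ φ (ξ n i.1) (ξ n i.2)
    with himg
  set S : (n : ℕ) → (Fin n × Fin n → ℝ) → (ℝ → ℝ × ℝ → ℝ) → ℝ → ℝ → ℝ :=
    fun n Y f w ψ => localSum (ξ n) (h n) (x, φ x) Y f w ψ with hS
  have det_near {ρ : ℝ} (hρ : 0 < ρ) : ∀ᶠ n in atTop,
      |wdet n| ≤ ρ ∧ |ψdet n - slopeAngle φ x| ≤ ρ ∧
      S n (img n) (winW K₁ (deriv K₁) K₂ (deriv K₂)) (wdet n) (ψdet n) = 0 ∧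
      S n (img n) (winP K₁ (deriv K₁) K₂ (deriv K₂)) (wdet n) (ψdet n) = 0 := by
    obtain ⟨s, hs, hev⟩ := exists_near_of_isArgmaxOn hsmooth hx hξ hband hker hρ
    filter_upwards [hev, hdet] with n hn hmax
    simp only [detContrast_observation hε] at hmax
    -- The deterministic maximizer is the case of zero noise.
    have := hn 0 (fun y _ ψ _ => by simp [localSum, hs.le]) (φdet n) (ψdet n) (by simpa using hmax)
    simpa [← hwdet] using this
  have hat_near {ρ : ℝ} (hρ : 0 < ρ) : WithHighProb P fun n ω =>
      |what n ω| ≤ ρ ∧ |ψhat n ω - slopeAngle φ x| ≤ ρ ∧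
      S n (fun i => img n i + ε n i ω) (winW K₁ (deriv K₁) K₂ (deriv K₂)) (what n ω) (ψhat n ω) = 0
        ∧
      S n (fun i => img n i + ε n i ω) (winP K₁ (deriv K₁) K₂ (deriv K₂)) (what n ω) (ψhat n ω)
        = 0 := by
    obtain ⟨s, hs, hev⟩ := exists_near_of_isArgmaxOn hsmooth hx hξ hband hker hρ
    refine (hε.global_ulln hξ hband (isWindow_win hk hl) x (φ x) hs).mono ?_
    filter_upwards [hev, hhat] with n hn hmax
    filter_upwards [hmax] with ω hω hu
    have := hn (fun i => ε n i ω) hu (φhat n ω) (ψhat n ω) hω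
    simpa only [← hwhat] using this
  have wdet_lim : Tendsto wdet atTop (𝓝 0) := by
    refine Metric.tendsto_nhds.2 fun e he => ?_
    filter_upwards [det_near (half_pos he)] with n hn
    rw [Real.dist_eq, sub_zero]
    linarith [hn.1]
  have ψdet_lim : Tendsto ψdet atTop (𝓝 (slopeAngle φ x)) := by
    refine Metric.tendsto_nhds.2 fun e he => ?_
    filter_upwards [det_near (half_pos he)] with n hn
    rw [Real.dist_eq]
    linarith [hn.2.1]
  -- Both values are taken from the noisy contrast, so that `τhat - τdet` is `dM`, which is
  -- negligible, plus the noise at the deterministic point.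
  set dM : ℕ → Ω → ℝ := fun n ω =>
    S n (fun i => img n i + ε n i ω) (win K₁ K₂) (what n ω) (ψhat n ω) -
      S n (fun i => img n i + ε n i ω) (win K₁ K₂) (wdet n) (ψdet n) with hdM
  have hexp : ∀ η > 0, WithHighProb P fun n ω =>
      |S n (fun i => ε n i ω) (winW K₁ (deriv K₁) K₂ (deriv K₂)) (wdet n) (ψdet n) -
        VHφ K₂ τ φ x * (what n ω - wdet n)| ≤
          η * (|what n ω - wdet n| + |ψhat n ω - ψdet n|) ∧
      |S n (fun i => ε n i ω) (winP K₁ (deriv K₁) K₂ (deriv K₂)) (wdet n) (ψdet n) -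
        VHψ K₁ K₂ τ x * (ψhat n ω - ψdet n)| ≤
          η * (|what n ω - wdet n| + |ψhat n ω - ψdet n|) ∧
      |dM n ω| ≤ (VHφ K₂ τ φ x + VHψ K₁ K₂ τ x + 2 * η) *
        (|what n ω - wdet n| + |ψhat n ω - ψdet n|) ^ 2 := by
    intro η hη
    obtain ⟨ρ, hρ, hev⟩ := eventually_expansion hsmooth hx hξ hband hker hη
    have u₁ := hε.local_ulln hξ hband (isWindow_winWW hk hl) (x, φ x) (half_pos hη)
    have u₂ := hε.local_ulln hξ hband (isWindow_winWP hk hl) (x, φ x) (half_pos hη)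
    have u₃ := hε.local_ulln hξ hband (isWindow_winPP hk hl) (x, φ x) (half_pos hη)
    refine ((u₁.and (u₂.and u₃)).and (hat_near hρ)).mono ?_
    filter_upwards [hev, det_near hρ] with n hn hd
    refine Eventually.of_forall fun ω hω => ?_
    obtain ⟨⟨b₁, b₂, b₃⟩, c₁, c₂, c₃, c₄⟩ := hω
    obtain ⟨d₁, d₂, d₃, d₄⟩ := hd
    exact hn (fun i => ε n i ω)
      (List.forall_mem_cons.2 ⟨b₁, List.forall_mem_cons.2 ⟨b₂, List.forall_mem_singleton.2 b₃⟩⟩)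
      _ _ _ _ d₁ d₂ c₁ c₂
      (List.forall_mem_cons.2 ⟨⟨d₃, c₃⟩, List.forall_mem_singleton.2 ⟨d₄, c₄⟩⟩)
  have hrem {δ : ℝ} (hδ : 0 < δ) := tendsto_remainder hA hB hnh
    (fun e he => hε.exists_tight_bound hξ hband (isWindow_winW hk hl) (x, φ x) wdet ψdet_lim he)
    (fun e he => hε.exists_tight_bound hξ hband (isWindow_winP hk hl) (x, φ x) wdet ψdet_lim he)
    hexp hδ
  have hobs (n : ℕ) (i : Fin n × Fin n) :
      AEMeasurable (fun ω => observation m τ φ (ξ n) (ε n) i ω) P :=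
    (hε.aemeasurable n i).const_add _
  have hτm (n : ℕ) : AEMeasurable (τhat n) P := by
    rw [funext (hτhat n)]
    exact aemeasurable_empContrast hk.continuous hl.continuous (ξ n) (hobs n) x (h n)
      (hφmeas n) (hψmeas n)
  have hwm (n : ℕ) : AEMeasurable (what n) P := by
    rw [funext (hwhat n)]
    exact ((hφmeas n).sub_const _).div_const _
  refine tendstoInDistribution_of_tendstoInMeasure_sub _ _
    (hε.tendstoInDistribution_localSum hξ hband hker τ hx hφ wdet_lim ψdet_lim) ?_ ?_
  · rw [tendstoInMeasure_iff_norm]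
    intro δ hδ
    refine tendsto_of_tendsto_of_tendsto_of_le_of_le' tendsto_const_nhds (hrem hδ)
      (Eventually.of_forall fun _ => zero_le) ?_
    filter_upwards [hpos] with n hn
    refine measure_mono fun ω hω => ?_
    rw [mem_ofPred_eq] at hω ⊢
    refine hω.trans (le_trans (le_of_eq ?_) (norm_vec_three_le _ _ _))
    have hτ : τhat n ω - τdet n = dM n ω + S n (fun i => ε n i ω) (win K₁ K₂) (wdet n) (ψdet n) := by
      rw [hτhat, hτdet, detContrast_observation hε,
        empContrast_eq_localSum K₁ K₂ _ _ x _ (φ x) _ hn.ne',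
        empContrast_eq_localSum K₁ K₂ _ _ x _ (φ x) _ hn.ne', ← hwhat, ← hwdet]
      have e := localSum_add (ξ n) (h n) (x, φ x) (img n) (fun i => ε n i ω) (win K₁ K₂)
        (wdet n) (ψdet n)
      simp only [hdM, hS]
      rw [e]
      simp only [observation, himg]
      ring
    congr 1
    ext k
    simp only [Pi.sub_apply, Pi.zero_apply, sub_zero, PiLp.sub_apply, PiLp.smul_apply, smul_eq_mul]
    fin_cases k
    · simp [mul_sub, mul_div_assoc]
    · simp [mul_sub, mul_div_assoc]
    · simp [hτ, hS, mul_add]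
  · intro n
    have : Measurable fun v : Fin 3 → ℝ =>
        (n * h n : ℝ) • (WithLp.toLp 2 v : EuclideanSpace ℝ (Fin 3)) := by
      fun_prop
    refine this.comp_aemeasurable (aemeasurable_pi_lambda _ fun k => ?_)
    fin_cases k
    · exact (hwm n).sub_const _
    · exact (hψmeas n).sub_const _
    · exact (hτm n).sub_const _
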